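/- **Setting.** Let $1\le d\le 3$ and let $\mathcal T$ be a finite conforming triangulation of $\Omega\subset\mathbb R^d$ into open simplices $K$ (that is, $\Omega$ is the interior of the union of the closed cells, and two closed cells meet in a common face or not at all). Let $\mathcal F$ be the union of all facets, $\vec n$ the outward unit normal on $\partial K$ (on $\partial\Omega$: of $\Omega$), and $\partial\Omega=\Gamma_D\cup\Gamma_N$ with $\Gamma_D\cap\Gamma_N=\emptyset$ (measurable). Let $\nu\ge0$, $\beta\ge 0$, $\alpha\in\mathbb R$, let $h_K>0$ be a measure of the size of the cell $K$ (on a facet, $h_K$ denotes the average over the adjacent cells), let $t\in(0,t_N]$, $\vec f(t)\in[L^2(\Omega)]^d$ and $\vec h(t)\in[L^2(\Gamma_N)]^d$. Write $[\nabla\vec u]_{ij}=\partial u_i/\partial x_j$, $\nabla^s\vec u=(\nabla\vec u+\nabla\vec u^T)/2$, $\vec\sigma_d=p\vec I-2\nu\nabla^s\vec u$ and $\vec\sigma=\vec\sigma_d+\vec u\otimes\vec u$. For $\vec U=(\vec u,\bar{\vec u},p,\bar p)$ (cell velocity, facet velocity, cell pressure, facet pressure) put, on $\partial K$, with values of cell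 fields taken as traces from $K$, $$\hat{\vec u}=\vec u-\frac{\beta h_K}{\nu+1}(\bar p-p)\vec n,\qquad \hat{\vec\sigma}_d=\bar p\,\vec I-2\nu\nabla^s\vec u-\frac{\alpha}{h_K}2\nu(\bar{\vec u}-\vec u)\otimes\vec n,$$ and $\lambda=1$ where $\hat{\vec u}\cdot\vec n<0$, $\lambda=0$ where $\hat{\vec u}\cdot\vec n\ge0$. For $\vec W=(\vec v,\bar{\vec v},q,\bar q)$ and $\chi\in[0,1]$ let $F(\vec U;\vec W)=F_m(\vec U;\vec v)+\bar F_m(\vec U;\bar{\vec v})+F_c(\vec U;q)+\bar F_c(\vec U;\bar q)$, where $$F_c=\sum_K\int_K\vec u\cdot\nabla q\,dx-\sum_K\int_{\partial K}\hat{\vec u}\cdot\vec n\,q\,ds,\qquad \bar F_c=\sum_K\int_{\partial K}\hat{\vec u}\cdot\vec n\,\bar q\,ds-\int_{\partial\Omega}\bar{\vec u}\cdot\vec n\,\bar q\,ds,$$ $$\begin{aligned}F_m={}&\int_\Omega\frac{\partial\vec u}{\partial t}\cdot\vec v\,dx-\chi\sum_K\int_K(\vec u\otimes\vec u):\nabla\vec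 v\,dx+(1-\chi)\sum_K\int_K(\nabla\vec u\,\vec u)\cdot\vec v\,dx+\chi\sum_K\int_{\partial K}(\hat{\vec u}\cdot\vec n)\,\vec u\cdot\vec v\,ds\\&+\sum_K\int_{\partial K}\lambda(\hat{\vec u}\cdot\vec n)(\bar{\vec u}-\vec u)\cdot\vec v\,ds-\sum_K\int_K\vec\sigma_d:\nabla\vec v\,dx+\sum_K\int_{\partial K}\hat{\vec\sigma}_d\vec n\cdot\vec v\,ds\\&+\sum_K\int_{\partial K}2\nu(\bar{\vec u}-\vec u)\cdot\nabla^s\vec v\,\vec n\,ds-\int_\Omega\vec f\cdot\vec v\,dx,\end{aligned}$$ $$\begin{aligned}\bar F_m={}&\chi\sum_K\int_{\partial K}(\hat{\vec u}\cdot\vec n)\,\vec u\cdot\bar{\vec v}\,ds-(1-\chi)\sum_K\int_{\partial K}(\hat{\vec u}\cdot\vec n)(\bar{\vec u}-\vec u)\cdot\bar{\vec v}\,ds+\sum_K\int_{\partial K}\lambda(\hat{\vec u}\cdot\vec n)(\bar{\vec u}-\vec u)\cdot\bar{\vec v}\,ds\\&+\sum_K\int_{\partial K}\hat{\vec\sigma}_d\vec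 n\cdot\bar{\vec v}\,ds-\int_{\Gamma_N}(\chi-\lambda)(\bar{\vec u}\cdot\vec n)\,\bar{\vec u}\cdot\bar{\vec v}\,ds-\int_{\Gamma_N}\vec h\cdot\bar{\vec v}\,ds.\end{aligned}$$ For orders $k\ge1$ and $\bar k,m,\bar m\ge0$ let $V_h$ and $Q_h$ be the vector and scalar functions that are polynomials of degree at most $k$, respectively $m$, on each cell (with no continuity between cells); let $\bar V_h$ and $\bar Q_h$ be the vector and scalar functions on $\mathcal F$ that are polynomials of degree at most $\bar k$, respectively $\bar m$, on each facet, those in $\bar V_h$ vanishing on $\Gamma_D$. **Proposition (consistency).** Suppose that at the time $t$ the functions $\vec u(t)\in[H^2(\Omega)]^d$ and $p(t)\in H^1(\Omega)$ satisfy, the first and third equations almost everywhere in $\Omega$ and the boundary conditions in the sense of traces, $$\frac{\partial\vec u}{\partial t}+\nabla\cdot\vec\sigma=\vec f,\quad \vec\sigma=p\vec I-2\nu\nabla^s\vec u+\vec u\otimes\vec u,\quad \nabla\cdot\vec u=0\ \text{ in }\Omega,$$ $$\vec u=\vec 0\ \text{ on }\Gamma_D,\qquad \vec\sigma\vec n-\max(\vec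 u\cdot\vec n,0)\,\vec u=\vec h\ \text{ on }\Gamma_N,$$ where $\partial\vec u/\partial t$ is the time derivative at $t$ in the sense of distributions on $\Omega$ (one-sided if $t=t_N$). Suppose that $\bar{\vec u}=\gamma(\vec u)$ and $\bar p=\gamma(p)$ on $\mathcal F$, where $\gamma$ is the trace operator. Then, for every $\chi\in[0,1]$, $$F(\vec U;\vec W_h)=0\qquad\text{for all }\ \vec W_h\in V_h\times\bar V_h\times Q_h\times\bar Q_h .$$ -/

import Mathlib

open MeasureTheory Filter Topology Set
open scoped ContDiff Matrix

noncomputable section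

namespace HybridNS

open scoped Classical

/-- Points of `ℝ^d` (Euclidean norm). -/
abbrev Pt (d : ℕ) := EuclideanSpace ℝ (Fin d)

/-- Values of vector fields. -/
abbrev Vec (d : ℕ) := Fin d → ℝ

/-- Values of tensor fields. -/
abbrev Ten (d : ℕ) := Matrix (Fin d) (Fin d) ℝ

variable {d : ℕ}

/-! ### Weak derivatives and the Sobolev spaces `H^m` -/

/-- Smooth functions with compact support in `Ω`. -/
def IsTestFunction (Ω : Set (Pt d)) (φ : Pt d → ℝ) : Prop :=
  ContDiff ℝ ∞ φ ∧ HasCompactSupport φ ∧ tsupport φ ⊆ Ω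

/-- The classical partial derivative `∂φ/∂x_j`. -/
def partialD (j : Fin d) (φ : Pt d → ℝ) (x : Pt d) : ℝ :=
  fderiv ℝ φ x (EuclideanSpace.single j 1)

/-- `g'` is the weak partial derivative `∂g/∂x_j` on the open set `Ω`. -/
def HasWeakPartial (Ω : Set (Pt d)) (j : Fin d) (g g' : Pt d → ℝ) : Prop :=
  LocallyIntegrableOn g Ω ∧ LocallyIntegrableOn g' Ω ∧
    ∀ φ, IsTestFunction Ω φ →
      ∫ x in Ω, g x * partialD j φ x = - ∫ x in Ω, g' x * φ x

/-- The weak partial derivative `∂g/∂x_j` on `Ω` (unique almost everywhere; `0` if there is none). -/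
def weakPartial (Ω : Set (Pt d)) (j : Fin d) (g : Pt d → ℝ) : Pt d → ℝ :=
  if h : ∃ g', HasWeakPartial Ω j g g' then h.choose else 0

/-- Membership in the Sobolev space `H^m(Ω)`. -/
def MemH : ℕ → Set (Pt d) → (Pt d → ℝ) → Prop
  | 0, Ω, g => MemLp g 2 (volume.restrict Ω)
  | m + 1, Ω, g => MemLp g 2 (volume.restrict Ω) ∧
      ∀ j, ∃ g', HasWeakPartial Ω j g g' ∧ MemH m Ω g'

/-- The weak gradient `[∇u]_{ij} = ∂u_i/∂x_j` on `Ω`. -/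
def grad (Ω : Set (Pt d)) (u : Pt d → Vec d) (x : Pt d) : Ten d :=
  Matrix.of fun i j => weakPartial Ω j (fun y => u y i) x

/-- The weak gradient of a scalar field on `Ω`. -/
def sgrad (Ω : Set (Pt d)) (q : Pt d → ℝ) (x : Pt d) : Vec d :=
  fun j => weakPartial Ω j q x

/-- The weak divergence of a vector field on `Ω`. -/
def divergence (Ω : Set (Pt d)) (u : Pt d → Vec d) (x : Pt d) : ℝ :=
  ∑ i, weakPartial Ω i (fun y => u y i) x

/-- The row-wise weak divergence `[∇·σ]_i = ∑_j ∂σ_{ij}/∂x_j` of a tensor field on `Ω`. -/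
def tensorDiv (Ω : Set (Pt d)) (σ : Pt d → Ten d) (x : Pt d) : Vec d :=
  fun i => ∑ j, weakPartial Ω j (fun y => σ y i j) x

/-- `w` is the time derivative at time `t` (relative to the time interval `I`) of `g`, in the sense
of distributions on `Ω`. -/
def HasTimeDeriv (I : Set ℝ) (Ω : Set (Pt d)) (g : ℝ → Pt d → ℝ) (t : ℝ) (w : Pt d → ℝ) : Prop :=
  (∀ s ∈ I, LocallyIntegrableOn (g s) Ω) ∧ LocallyIntegrableOn w Ω ∧
    ∀ φ, IsTestFunction Ω φ →
      HasDerivWithinAt (fun s => ∫ x in Ω, g s x * φ x) (∫ x in Ω, w x * φ x) I t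

/-- The time derivative `∂g/∂t` at time `t` (`0` if there is none). -/
def timeDeriv (I : Set ℝ) (Ω : Set (Pt d)) (g : ℝ → Pt d → ℝ) (t : ℝ) : Pt d → ℝ :=
  if h : ∃ w, HasTimeDeriv I Ω g t w then h.choose else 0

/-- The time derivative `∂u/∂t` at time `t` of a vector field. -/
def timeDerivV (I : Set ℝ) (Ω : Set (Pt d)) (u : ℝ → Pt d → Vec d) (t : ℝ) (x : Pt d) : Vec d :=
  fun i => timeDeriv I Ω (fun s y => u s y i) t x

/-! ### Tensor algebra -/

/-- The symmetric part of a tensor; `∇ˢu = symm (∇u)`. -/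
def symm (G : Ten d) : Ten d := (1 / 2 : ℝ) • (G + Gᵀ)

/-- The double contraction `A : B`. -/
def ddot (A B : Ten d) : ℝ := ∑ i, ∑ j, A i j * B i j

/-- The diffusive flux `p I - 2ν ∇ˢu` (as a function of the values of `p` and `∇u`). -/
def diffFlux (ν : ℝ) (p : ℝ) (G : Ten d) : Ten d :=
  p • (1 : Ten d) - (2 * ν) • symm G

/-- The momentum flux `σ = p I - 2ν ∇ˢu + u ⊗ u`. -/
def momentumFlux (ν : ℝ) (p : ℝ) (G : Ten d) (u : Vec d) : Ten d :=
  diffFlux ν p G + Matrix.vecMulVec u u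

/-! ### Triangulations, facets, normals, surface measure -/

/-- A (finite, conforming, simplicial) triangulation of `Ω`: a finite simplicial complex all of
whose maximal simplices are `d`-dimensional, and whose closed simplices fill out `Ω`. -/
structure Triangulation (Ω : Set (Pt d)) where
  complex : Geometry.SimplicialComplex ℝ (Pt d)
  finite : complex.faces.Finite
  pure : ∀ s ∈ complex.faces, ∃ K ∈ complex.faces, s ⊆ K ∧ K.card = d + 1
  domain_eq : Ω = interior complex.space

/-- The vertex sets of the cells. -/
def Triangulation.cells {Ω : Set (Pt d)} (T : Triangulation Ω) : Finset (Finset (Pt d)) :=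
  T.finite.toFinset.filter fun s => s.card = d + 1

/-- The vertex sets of the facets, including the exterior ones. -/
def Triangulation.facets {Ω : Set (Pt d)} (T : Triangulation Ω) : Finset (Finset (Pt d)) :=
  T.finite.toFinset.filter fun s => s.card = d

/-- The open cell with vertex set `K`. -/
def cell (K : Finset (Pt d)) : Set (Pt d) := interior (convexHull ℝ (K : Set (Pt d)))

/-- The `(d-1)`-dimensional surface measure on the facet with vertex set `F`. -/
def surf (F : Finset (Pt d)) : Measure (Pt d) :=
  (Measure.euclideanHausdorffMeasure (d - 1)).restrict (convexHull ℝ (F : Set (Pt d)))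

/-- The outward unit normal vector of the simplex `K` on the facet opposite to its vertex `a`: the
normalized component, orthogonal to the facet, of the vector from `a` to a point of the facet. -/
def normalPt (K : Finset (Pt d)) (a : Pt d) : Pt d :=
  let w : Pt d := (vectorSpan ℝ ((K.erase a : Finset (Pt d)) : Set (Pt d)))ᗮ.starProjection
    ((K.erase a).centroid ℝ id - a)
  ‖w‖⁻¹ • w

/-- The coordinates of the outward unit normal vector. -/
def normal (K : Finset (Pt d)) (a : Pt d) : Vec d := fun i => normalPt K a i

/-- `∫_{∂K} g ds` for the cell with vertex set `K`; the facets of `K` are indexed by their opposite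
vertices. -/
def cellBdryIntegral (K : Finset (Pt d)) (g : Pt d → Pt d → ℝ) : ℝ :=
  ∑ a ∈ K, ∫ x, g a x ∂(surf (K.erase a))

/-- `∑_K ∫_{∂K} g ds`. -/
def Triangulation.skeletonIntegral {Ω : Set (Pt d)} (T : Triangulation Ω)
    (g : Finset (Pt d) → Pt d → Pt d → ℝ) : ℝ :=
  ∑ K ∈ T.cells, cellBdryIntegral K (g K)

/-- `∑_K ∫_K g dx`. -/
def Triangulation.cellIntegral {Ω : Set (Pt d)} (T : Triangulation Ω)
    (g : Finset (Pt d) → Pt d → ℝ) : ℝ :=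
  ∑ K ∈ T.cells, ∫ x in cell K, g K x

/-- The facet of `K` opposite to `a` lies on the boundary of `Ω`. -/
def IsExterior (Ω : Set (Pt d)) (K : Finset (Pt d)) (a : Pt d) : Prop :=
  convexHull ℝ ((K.erase a : Finset (Pt d)) : Set (Pt d)) ⊆ frontier Ω

/-- `∫_Γ g ds` for a part `Γ` of `∂Ω`. The integrand may refer to the cell `K` and the facet of `K`
(given by its opposite vertex) on which it is evaluated. -/
def Triangulation.bdryIntegral {Ω : Set (Pt d)} (T : Triangulation Ω) (Γ : Set (Pt d))
    (g : Finset (Pt d) → Pt d → Pt d → ℝ) : ℝ :=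
  ∑ K ∈ T.cells, ∑ a ∈ K.filter (fun a => IsExterior Ω K a),
    ∫ x in Γ, g K a x ∂(surf (K.erase a))

/-! ### Traces -/

/-- `τ ∈ L²(F)` is the trace of `g ∈ H¹(K)` on the facet `F` of the cell with vertex set `K`: the
limit in `L²(F)` of the restrictions of functions that are smooth up to the boundary of `K` and
converge to `g` in `H¹(K)`. -/
def IsTrace (K F : Finset (Pt d)) (g τ : Pt d → ℝ) : Prop :=
  MemH 1 (cell K) g ∧ MemLp τ 2 (surf F) ∧
    ∃ φ : ℕ → Pt d → ℝ, (∀ n, ContDiff ℝ ∞ (φ n)) ∧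
      Tendsto (fun n => eLpNorm (φ n - g) 2 (volume.restrict (cell K))) atTop (𝓝 0) ∧
      (∀ j, Tendsto (fun n => eLpNorm (partialD j (φ n) - weakPartial (cell K) j g) 2
        (volume.restrict (cell K))) atTop (𝓝 0)) ∧
      Tendsto (fun n => eLpNorm (φ n - τ) 2 (surf F)) atTop (𝓝 0)

/-- The trace on the facet `F`, taken from the cell `K` (`0` if there is none). -/
def trace (K F : Finset (Pt d)) (g : Pt d → ℝ) : Pt d → ℝ :=
  if h : ∃ τ, IsTrace K F g τ then h.choose else 0

/-- The trace of a vector field. -/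
def traceV (K F : Finset (Pt d)) (u : Pt d → Vec d) (x : Pt d) : Vec d :=
  fun i => trace K F (fun y => u y i) x

/-- The trace of the gradient of a vector field. -/
def traceGrad (K F : Finset (Pt d)) (u : Pt d → Vec d) (x : Pt d) : Ten d :=
  Matrix.of fun i j => trace K F (fun y => grad (cell K) u y i j) x

/-- `gbar = γ(g)` on the union of all facets. On an interior facet the trace may be taken from
either adjacent cell (for `g ∈ H¹(Ω)` both give the same function). -/
def Triangulation.EqTrace {Ω : Set (Pt d)} (T : Triangulation Ω) (g gbar : Pt d → ℝ) : Prop :=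
  ∀ F ∈ T.facets, ∃ K ∈ T.cells, F ⊆ K ∧ ∀ᵐ x ∂(surf F), gbar x = trace K F g x

/-! ### The Navier-Stokes problem -/

/-- The data of the incompressible Navier-Stokes problem on `Ω × (0, tN]`. -/
structure Problem (d : ℕ) where
  Ω : Set (Pt d)
  ΓD : Set (Pt d)
  ΓN : Set (Pt d)
  union_eq : ΓD ∪ ΓN = frontier Ω
  disj : ΓD ∩ ΓN = ∅
  measD : MeasurableSet ΓD
  tN : ℝ
  ν : ℝ
  ν_nonneg : 0 ≤ ν
  f : ℝ → Pt d → Vec d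
  h : ℝ → Pt d → Vec d

/-- The time interval `(0, tN]`. -/
def Problem.I (P : Problem d) : Set ℝ := Ioc 0 P.tN

/-- The momentum flux field `σ` at a time at which velocity and pressure are `u` and `p`. -/
def Problem.σ (P : Problem d) (u : Pt d → Vec d) (p : Pt d → ℝ) (x : Pt d) : Ten d :=
  momentumFlux P.ν (p x) (grad P.Ω u x) (u x)

/-- `u` and `p` solve, at time `t`, the momentum equation and the incompressibility constraint
almost everywhere in `Ω`, and the boundary conditions on `Γ_D` and `Γ_N` in the sense of traces.
(The traces on `∂Ω` are computed facet by facet from the cell of `T` adjacent to the boundary.) -/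
structure Problem.SolvesAt (P : Problem d) (T : Triangulation P.Ω) (t : ℝ)
    (u : ℝ → Pt d → Vec d) (p : ℝ → Pt d → ℝ) : Prop where
  exists_timeDeriv : ∀ i, ∃ w, HasTimeDeriv P.I P.Ω (fun s x => u s x i) t w
  momentum : ∀ᵐ x ∂(volume.restrict P.Ω),
    timeDerivV P.I P.Ω u t x + tensorDiv P.Ω (P.σ (u t) (p t)) x = P.f t x
  incompressible : ∀ᵐ x ∂(volume.restrict P.Ω), divergence P.Ω (u t) x = 0
  dirichlet : ∀ K ∈ T.cells, ∀ a ∈ K, IsExterior P.Ω K a →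
    ∀ᵐ x ∂(surf (K.erase a)), x ∈ P.ΓD → traceV K (K.erase a) (u t) x = 0
  neumann : ∀ K ∈ T.cells, ∀ a ∈ K, IsExterior P.Ω K a →
    ∀ᵐ x ∂(surf (K.erase a)), x ∈ P.ΓN →
      momentumFlux P.ν (trace K (K.erase a) (p t) x) (traceGrad K (K.erase a) (u t) x)
          (traceV K (K.erase a) (u t) x) *ᵥ normal K a
        - max (traceV K (K.erase a) (u t) x ⬝ᵥ normal K a) 0 • traceV K (K.erase a) (u t) x
      = P.h t x

/-! ### Finite element spaces -/

/-- The polynomial function on `ℝ^d` given by `P`. -/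
def polyFun (P : MvPolynomial (Fin d) ℝ) (x : Pt d) : ℝ := MvPolynomial.eval (fun i => x i) P

/-- `Q_h`: scalar functions that are polynomials of degree at most `m` on each cell. -/
def Qh {Ω : Set (Pt d)} (T : Triangulation Ω) (m : ℕ) : Set (Pt d → ℝ) :=
  {q | ∀ K ∈ T.cells, ∃ P : MvPolynomial (Fin d) ℝ, P.totalDegree ≤ m ∧
    ∀ᵐ x ∂(volume.restrict (cell K)), q x = polyFun P x}

/-- `V_h`: vector functions that are polynomials of degree at most `k` on each cell. -/
def Vh {Ω : Set (Pt d)} (T : Triangulation Ω) (k : ℕ) : Set (Pt d → Vec d) :=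
  {v | ∀ i, (fun x => v x i) ∈ Qh T k}

/-- `Qbar_h`: scalar functions on the union of all facets that are polynomials of degree at most
`m` on each facet. -/
def Qbarh {Ω : Set (Pt d)} (T : Triangulation Ω) (m : ℕ) : Set (Pt d → ℝ) :=
  {q | ∀ F ∈ T.facets, ∃ P : MvPolynomial (Fin d) ℝ, P.totalDegree ≤ m ∧
    ∀ᵐ x ∂(surf F), q x = polyFun P x}

/-- `Vbar_h`: vector functions on the union of all facets that are polynomials of degree at most
`k` on each facet and that vanish on `Γ_D`. -/
def Vbarh {Ω : Set (Pt d)} (T : Triangulation Ω) (ΓD : Set (Pt d)) (k : ℕ) : Set (Pt d → Vec d) :=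
  {v | (∀ i, (fun x => v x i) ∈ Qbarh T k) ∧
    ∀ F ∈ T.facets, ∀ᵐ x ∂(surf F), x ∈ ΓD → v x = 0}

/-! ### The hybrid scheme -/

/-- The parameters of the scheme: the triangulation, a positive measure `h_K` of the size of each
cell, the penalty parameter `α` and the stabilization parameter `β`. -/
structure Scheme (P : Problem d) where
  T : Triangulation P.Ω
  cellSize : Finset (Pt d) → ℝ
  cellSize_pos : ∀ K ∈ T.cells, 0 < cellSize K
  α : ℝ
  β : ℝ
  β_nonneg : 0 ≤ β

/-- `U = (u, ubar, p, pbar)`: time-dependent cell and facet fields. -/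
structure Fields (d : ℕ) where
  u : ℝ → Pt d → Vec d
  ubar : ℝ → Pt d → Vec d
  p : ℝ → Pt d → ℝ
  pbar : ℝ → Pt d → ℝ

/-- `W = (v, vbar, q, qbar)`: test functions. -/
structure TestFields (d : ℕ) where
  v : Pt d → Vec d
  vbar : Pt d → Vec d
  q : Pt d → ℝ
  qbar : Pt d → ℝ

namespace Scheme

variable {P : Problem d} (S : Scheme P)

/-- The cells adjacent to the facet `F`. -/
def adjacent (F : Finset (Pt d)) : Finset (Finset (Pt d)) := S.T.cells.filter fun K => F ⊆ K

/-- The size `h_K` on the facet `F`: the average of the sizes of the adjacent cells. -/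
def facetSize (F : Finset (Pt d)) : ℝ :=
  (∑ K ∈ S.adjacent F, S.cellSize K) / ((S.adjacent F).card : ℝ)

/-- `W_h ∈ V_h × Vbar_h × Q_h × Qbar_h`, with polynomial orders `k, kbar, m, mbar`. -/
def IsDiscrete (k kbar m mbar : ℕ) (W : TestFields d) : Prop :=
  W.v ∈ Vh S.T k ∧ W.vbar ∈ Vbarh S.T P.ΓD kbar ∧ W.q ∈ Qh S.T m ∧ W.qbar ∈ Qbarh S.T mbar

variable (U : Fields d) (t : ℝ)

/-- The numerical mass flux `uhat = u - β h_K / (ν + 1) (pbar - p) n` on `∂K`. -/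
def uhat (K : Finset (Pt d)) (a x : Pt d) : Vec d :=
  traceV K (K.erase a) (U.u t) x
    - (S.β * S.facetSize (K.erase a) / (P.ν + 1)
        * (U.pbar t x - trace K (K.erase a) (U.p t) x)) • normal K a

/-- `uhat · n` on `∂K`. -/
def uhatN (K : Finset (Pt d)) (a x : Pt d) : ℝ := S.uhat U t K a x ⬝ᵥ normal K a

/-- The upwinding function: `1` on inflow and `0` on outflow cell boundaries. -/
def lam (K : Finset (Pt d)) (a x : Pt d) : ℝ := if S.uhatN U t K a x < 0 then 1 else 0

/-- The jump `ubar - u` on `∂K`. -/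
def jump (K : Finset (Pt d)) (a x : Pt d) : Vec d := U.ubar t x - traceV K (K.erase a) (U.u t) x

/-- The numerical diffusive flux
`pbar I - 2ν ∇ˢu - (α / h_K) 2ν (ubar - u) ⊗ n` on `∂K`. -/
def diffFluxHat (K : Finset (Pt d)) (a x : Pt d) : Ten d :=
  diffFlux P.ν (U.pbar t x) (traceGrad K (K.erase a) (U.u t) x)
    - (S.α / S.facetSize (K.erase a) * (2 * P.ν)) •
        Matrix.vecMulVec (jump U t K a x) (normal K a)

/-- The local continuity functional. -/
def Fc (q : Pt d → ℝ) : ℝ :=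
  S.T.cellIntegral (fun K x => U.u t x ⬝ᵥ sgrad (cell K) q x)
    - S.T.skeletonIntegral (fun K a x => S.uhatN U t K a x * trace K (K.erase a) q x)

/-- The global continuity functional. -/
def Fcbar (qbar : Pt d → ℝ) : ℝ :=
  S.T.skeletonIntegral (fun K a x => S.uhatN U t K a x * qbar x)
    - S.T.bdryIntegral (frontier P.Ω) (fun K a x => (U.ubar t x ⬝ᵥ normal K a) * qbar x)

/-- The local momentum functional. -/
def Fm (χ : ℝ) (v : Pt d → Vec d) : ℝ :=
  (∫ x in P.Ω, timeDerivV P.I P.Ω U.u t x ⬝ᵥ v x)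
    - χ * S.T.cellIntegral (fun K x =>
        ddot (Matrix.vecMulVec (U.u t x) (U.u t x)) (grad (cell K) v x))
    + (1 - χ) * S.T.cellIntegral (fun K x => (grad (cell K) (U.u t) x *ᵥ U.u t x) ⬝ᵥ v x)
    + χ * S.T.skeletonIntegral (fun K a x => S.uhatN U t K a x *
        (traceV K (K.erase a) (U.u t) x ⬝ᵥ traceV K (K.erase a) v x))
    + S.T.skeletonIntegral (fun K a x => S.lam U t K a x * S.uhatN U t K a x *
        (jump U t K a x ⬝ᵥ traceV K (K.erase a) v x))
    - S.T.cellIntegral (fun K x =>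
        ddot (diffFlux P.ν (U.p t x) (grad (cell K) (U.u t) x)) (grad (cell K) v x))
    + S.T.skeletonIntegral (fun K a x =>
        (S.diffFluxHat U t K a x *ᵥ normal K a) ⬝ᵥ traceV K (K.erase a) v x)
    + S.T.skeletonIntegral (fun K a x => 2 * P.ν *
        (jump U t K a x ⬝ᵥ (symm (traceGrad K (K.erase a) v x) *ᵥ normal K a)))
    - ∫ x in P.Ω, P.f t x ⬝ᵥ v x

/-- The global momentum functional. -/
def Fmbar (χ : ℝ) (vbar : Pt d → Vec d) : ℝ :=
  χ * S.T.skeletonIntegral (fun K a x => S.uhatN U t K a x *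
        (traceV K (K.erase a) (U.u t) x ⬝ᵥ vbar x))
    - (1 - χ) * S.T.skeletonIntegral (fun K a x => S.uhatN U t K a x *
        (jump U t K a x ⬝ᵥ vbar x))
    + S.T.skeletonIntegral (fun K a x => S.lam U t K a x * S.uhatN U t K a x *
        (jump U t K a x ⬝ᵥ vbar x))
    + S.T.skeletonIntegral (fun K a x =>
        (S.diffFluxHat U t K a x *ᵥ normal K a) ⬝ᵥ vbar x)
    - S.T.bdryIntegral P.ΓN (fun K a x => (χ - S.lam U t K a x) *
        (U.ubar t x ⬝ᵥ normal K a) * (U.ubar t x ⬝ᵥ vbar x))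
    - S.T.bdryIntegral P.ΓN (fun _ _ x => P.h t x ⬝ᵥ vbar x)

/-- The residual functional `F(U; W)` at time `t`. -/
def F (χ : ℝ) (W : TestFields d) : ℝ :=
  S.Fm U t χ W.v + S.Fmbar U t χ W.vbar + S.Fc U t W.q + S.Fcbar U t W.qbar

end Scheme

end HybridNS

end

open HybridNS

open MeasureTheory Filter Topology Set
open scoped ContDiff Matrix

noncomputable section

namespace HybridNS

open scoped Classical

variable {d : ℕ}

/-! ### Barycentric coordinates of a simplex -/

/-! Inserting the exact solution makes every facet unknown agree with the trace of the cell unknown.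
All jumps then vanish almost everywhere on the skeleton, the numerical mass flux becomes `u · n`,
and the numerical diffusive flux becomes the trace of `pI - 2ν∇ˢu`. What remains of the four
functionals vanishes separately.

`Fc` and `Fm` vanish cell by cell. Green's formula turns `Fc` into the integral of `q div u`. In
`Fm` it turns the conservative convection term into the integral of `(∇·(u ⊗ u)) · v`. The advective
term has the same value because `div u = 0`, so `χ` drops out and the momentum equation tested with
`v` is left.

`Fcbar` and `Fmbar` are sums over facets of cells. On an interior facet the traces from the two
sides agree and the normals are opposite, so the two contributions cancel
(`sum_skeleton_eq_sum_exterior`). On exterior facets `Fcbar` is an identity. For `Fmbar` the test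
function vanishes on `Γ_D`, and on `Γ_N` the identity `λ y = y - max(y, 0)` for `y = u · n`
reproduces the Neumann condition (`momentum_exterior`).

The bulk of the proof justifies these integrations by parts for weak derivatives, L² traces and
Hausdorff surface measure. The divergence theorem on a simplex (`integral_fderiv_cell`) comes from
integrating by parts on the whole space against a product of smooth steps `η(λ_a / ε)` of the
barycentric coordinates. As `ε → 0` the product tends to the indicator of the cell, and each
differentiated factor concentrates on one facet. Density of smooth functions in `H¹` of a convex set
(`MemH.exists_tendsto_contDiff`) uses mollification combined with contraction towards an interior
point. Together with a trace inequality it yields existence and uniqueness of traces and Green's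
formula for a product of two `H¹` functions (`green`). Working with such products treats `u ⊗ u`
without Sobolev embeddings.

Passing from cells to `Ω` uses only the combinatorics of the triangulation, since `Ω` need not be a
Lipschitz domain. A facet not contained in the boundary belongs to exactly two cells, which lie on
opposite sides of it. Summing Green's formula over the cells against a test function of `Ω` then
shows that traces agree across the facet (`IsNeighbor.trace_ae_eq`) and that the product rule holds
weakly on `Ω` (`hasWeakPartial_mul`). -/

theorem isOpen_cell (K : Finset (Pt d)) : IsOpen (cell K) := isOpen_interior

/-- `K` is the vertex set of a nondegenerate `d`-dimensional simplex. -/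
def IsSimplex (K : Finset (Pt d)) : Prop :=
  AffineIndependent ℝ ((↑) : K → Pt d) ∧ K.card = d + 1

/-- The vertices of a simplex as an affine basis. -/
def IsSimplex.basis {K : Finset (Pt d)} (h : IsSimplex K) : AffineBasis K ℝ (Pt d) :=
  ⟨(↑), h.1, by
    rw [h.1.affineSpan_eq_top_iff_card_eq_finrank_add_one]
    simp [h.2]⟩

/-- The barycentric coordinate of `K` belonging to the vertex `a`. -/
def bary (K : Finset (Pt d)) (a : Pt d) : Pt d →ᵃ[ℝ] ℝ :=
  if h : IsSimplex K ∧ a ∈ K then h.1.basis.coord ⟨a, h.2⟩ else 0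

section Bary

variable {K : Finset (Pt d)} (hK : IsSimplex K)
include hK

theorem bary_eq (a : K) : bary K a = hK.basis.coord a := by
  simp [bary, hK]

theorem basis_apply (a : K) : hK.basis a = a := rfl

theorem bary_self {a : Pt d} (ha : a ∈ K) : bary K a a = 1 := by
  rw [bary_eq hK ⟨a, ha⟩]
  exact hK.basis.coord_apply_eq ⟨a, ha⟩

theorem bary_ne {a b : Pt d} (ha : a ∈ K) (hb : b ∈ K) (hab : a ≠ b) : bary K a b = 0 := by
  rw [bary_eq hK ⟨a, ha⟩]
  exact hK.basis.coord_apply_ne (j := ⟨b, hb⟩) (by simpa [Subtype.ext_iff] using hab)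

theorem sum_bary (x : Pt d) : ∑ a ∈ K, bary K a x = 1 := by
  rw [← hK.basis.sum_coord_apply_eq_one x, ← Finset.sum_coe_sort]
  exact Finset.sum_congr rfl fun a _ => by rw [bary_eq hK]

theorem sum_bary_smul (x : Pt d) : ∑ a ∈ K, bary K a x • a = x := by
  conv_rhs => rw [← hK.basis.linear_combination_coord_eq_self x]
  rw [← Finset.sum_coe_sort]
  exact Finset.sum_congr rfl fun a _ => by rw [bary_eq hK, basis_apply]

theorem range_basis : range hK.basis = (K : Set (Pt d)) := by
  ext x; simp [basis_apply]

theorem mem_convexHull_iff_bary {x : Pt d} :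
    x ∈ convexHull ℝ (K : Set (Pt d)) ↔ ∀ a ∈ K, 0 ≤ bary K a x := by
  rw [← range_basis hK, hK.basis.convexHull_eq_nonneg_coord]
  simp only [Set.mem_ofPred_eq]
  exact ⟨fun h a ha => by rw [bary_eq hK ⟨a, ha⟩]; exact h _,
    fun h a => by rw [← bary_eq hK]; exact h _ a.2⟩

theorem mem_cell_iff {x : Pt d} : x ∈ cell K ↔ ∀ a ∈ K, 0 < bary K a x := by
  rw [cell, ← range_basis hK, hK.basis.interior_convexHull]
  simp only [Set.mem_ofPred_eq]
  exact ⟨fun h a ha => by rw [bary_eq hK ⟨a, ha⟩]; exact h _,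
    fun h a => by rw [← bary_eq hK]; exact h _ a.2⟩

/-- The coordinate of a vertex outside `S` vanishes at the points of `S`, hence on their hull,
because the zero set of an affine map is convex. Conversely, the barycentric expansion of `x` then
involves only vertices in `S`. -/
theorem mem_convexHull_subset_iff {S : Finset (Pt d)} (hS : S ⊆ K) {x : Pt d} :
    x ∈ convexHull ℝ (S : Set (Pt d)) ↔
      (∀ a ∈ S, 0 ≤ bary K a x) ∧ ∀ a ∈ K, a ∉ S → bary K a x = 0 := by
  constructor
  · intro hx
    have hx' := convexHull_mono (by exact_mod_cast hS : (S : Set (Pt d)) ⊆ K) hx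
    refine ⟨fun a ha => (mem_convexHull_iff_bary hK).1 hx' a (hS ha), fun a ha haS => ?_⟩
    have : (S : Set (Pt d)) ⊆ {y | bary K a y = 0} := fun b hb =>
      bary_ne hK ha (hS hb) (fun h => haS (h ▸ hb))
    have hc : Convex ℝ {y | bary K a y = 0} :=
      (convex_singleton (0 : ℝ)).affine_preimage (bary K a)
    exact convexHull_min this hc hx
  · rintro ⟨h0, h1⟩
    rw [← sum_bary_smul hK x, ← Finset.sum_subset hS
      (fun a ha haS => by rw [h1 a ha haS, zero_smul])]
    refine (convex_convexHull ℝ _).sum_mem h0 ?_ (fun a ha => subset_convexHull ℝ _ ha)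
    rw [Finset.sum_subset hS h1, sum_bary hK]

theorem mem_facet_iff {a : Pt d} (ha : a ∈ K) {x : Pt d} :
    x ∈ convexHull ℝ ((K.erase a : Finset (Pt d)) : Set (Pt d)) ↔
      bary K a x = 0 ∧ ∀ b ∈ K.erase a, 0 ≤ bary K b x := by
  rw [mem_convexHull_subset_iff hK (Finset.erase_subset _ _), and_comm]
  refine and_congr_left fun _ => ⟨fun h => h a ha (by simp), fun h b hb hbK => ?_⟩
  obtain rfl : b = a := by by_contra hne; exact hbK (Finset.mem_erase.2 ⟨hne, hb⟩)
  exact h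

end Bary

/-- The linear part of the barycentric coordinate. -/
def baryL (K : Finset (Pt d)) (a : Pt d) : Pt d →L[ℝ] ℝ :=
  LinearMap.toContinuousLinearMap (bary K a).linear

/-- The gradient of the barycentric coordinate. -/
def baryGrad (K : Finset (Pt d)) (a : Pt d) : Pt d :=
  (InnerProductSpace.toDual ℝ (Pt d)).symm (baryL K a)

theorem inner_baryGrad (K : Finset (Pt d)) (a v : Pt d) :
    inner ℝ (baryGrad K a) v = baryL K a v := by
  rw [baryGrad, InnerProductSpace.toDual_symm_apply]

theorem bary_add (K : Finset (Pt d)) (a x v : Pt d) :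
    bary K a (x + v) = bary K a x + baryL K a v := by
  have := (bary K a).map_vadd x v
  rw [vadd_eq_add, vadd_eq_add] at this
  rw [add_comm x, this, add_comm]; rfl

theorem baryL_sub (K : Finset (Pt d)) (a x y : Pt d) :
    baryL K a (x - y) = bary K a x - bary K a y := by
  have := bary_add K a y (x - y)
  rw [add_sub_cancel] at this
  linarith

theorem hasFDerivAt_bary (K : Finset (Pt d)) (a x : Pt d) :
    HasFDerivAt (bary K a) (baryL K a) x := by
  have h : (bary K a : Pt d → ℝ) = fun y => baryL K a y + bary K a 0 := by
    funext y
    have := baryL_sub K a y 0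
    rw [sub_zero] at this
    linarith
  rw [h]
  exact (baryL K a).hasFDerivAt.add_const _

theorem contDiff_bary (K : Finset (Pt d)) (a : Pt d) : ContDiff ℝ ∞ (bary K a) := by
  have h : (bary K a : Pt d → ℝ) = fun y => baryL K a y + bary K a 0 := by
    funext y
    have := baryL_sub K a y 0
    rw [sub_zero] at this
    linarith
  rw [h]
  fun_prop

theorem continuous_bary (K : Finset (Pt d)) (a : Pt d) : Continuous (bary K a) :=
  (contDiff_bary K a).continuous

section Bary2

variable {K : Finset (Pt d)} (hK : IsSimplex K)
include hK

theorem baryGrad_ne_zero (hd : 1 ≤ d) {a : Pt d} (ha : a ∈ K) : baryGrad K a ≠ 0 := by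
  obtain ⟨b, hb, hba⟩ := Finset.exists_mem_ne (by rw [hK.2]; omega) a
  intro h
  have := inner_baryGrad K a (a - b)
  rw [h, inner_zero_left, baryL_sub, bary_self hK ha, bary_ne hK ha hb hba.symm] at this
  norm_num at this

theorem baryL_eq_zero_of_mem_vectorSpan {a : Pt d} (ha : a ∈ K) {v : Pt d}
    (hv : v ∈ vectorSpan ℝ ((K.erase a : Finset (Pt d)) : Set (Pt d))) : baryL K a v = 0 := by
  have : vectorSpan ℝ ((K.erase a : Finset (Pt d)) : Set (Pt d)) ≤
      LinearMap.ker (baryL K a : Pt d →ₗ[ℝ] ℝ) := by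
    rw [vectorSpan_def, Submodule.span_le]
    rintro _ ⟨x, hx, y, hy, rfl⟩
    simp only [Finset.coe_erase, Set.mem_sdiff, Finset.mem_coe, Set.mem_singleton_iff] at hx hy
    simp only [vsub_eq_sub, SetLike.mem_coe, LinearMap.mem_ker, ContinuousLinearMap.coe_coe]
    rw [baryL_sub, bary_ne hK ha hx.1 (Ne.symm hx.2), bary_ne hK ha hy.1 (Ne.symm hy.2), sub_zero]
  exact this hv

theorem finrank_vectorSpan_erase (hd : 1 ≤ d) {a : Pt d} (ha : a ∈ K) :
    Module.finrank ℝ (vectorSpan ℝ ((K.erase a : Finset (Pt d)) : Set (Pt d))) = d - 1 := by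
  have hi : AffineIndependent ℝ ((↑) : ↥(K.erase a) → Pt d) :=
    hK.1.mono (t := (K : Set (Pt d))) (s := ((K.erase a : Finset (Pt d)) : Set (Pt d)))
      (by exact_mod_cast Finset.erase_subset a K)
  have := hi.finrank_vectorSpan (n := d - 1) (by
    rw [Fintype.card_coe, Finset.card_erase_of_mem ha, hK.2]; omega)
  have hr : range ((↑) : ↥(K.erase a) → Pt d) = ((K.erase a : Finset (Pt d)) : Set (Pt d)) := by
    ext x; simp [and_comm]
  rwa [hr] at this

/-- The coordinate of `a` is constant along the facet, which gives one inclusion. Both sides have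
dimension `d - 1`. -/
theorem vectorSpan_erase_eq (hd : 1 ≤ d) {a : Pt d} (ha : a ∈ K) :
    vectorSpan ℝ ((K.erase a : Finset (Pt d)) : Set (Pt d)) = (ℝ ∙ baryGrad K a)ᗮ := by
  apply Submodule.eq_of_le_of_finrank_eq
  · intro v hv
    rw [Submodule.mem_orthogonal_singleton_iff_inner_right, inner_baryGrad]
    exact baryL_eq_zero_of_mem_vectorSpan hK ha hv
  · rw [finrank_vectorSpan_erase hK hd ha]
    have := (ℝ ∙ baryGrad K a).finrank_add_finrank_orthogonal
    rw [finrank_span_singleton (baryGrad_ne_zero hK hd ha), finrank_euclideanSpace_fin] at this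
    omega

/-- The orthogonal complement of the facet directions is the line spanned by the gradient of the
coordinate of `a`. That coordinate falls from 1 at `a` to 0 at the centroid of the facet, so the
projected vector is a negative multiple of the gradient. -/
theorem normalPt_eq (hd : 1 ≤ d) {a : Pt d} (ha : a ∈ K) :
    normalPt K a = -(‖baryGrad K a‖⁻¹ • baryGrad K a) := by
  have hg := baryGrad_ne_zero hK hd ha
  have hne : (K.erase a).Nonempty := by
    rw [← Finset.card_pos, Finset.card_erase_of_mem ha, hK.2]; omega
  have hc : bary K a ((K.erase a).centroid ℝ id) = 0 := by
    rw [Finset.centroid_def, Finset.map_affineCombination _ _ _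
      (Finset.sum_centroidWeights_eq_one_of_nonempty ℝ _ hne)]
    rw [Finset.affineCombination_eq_linear_combination _ _ _
      (Finset.sum_centroidWeights_eq_one_of_nonempty ℝ _ hne)]
    refine Finset.sum_eq_zero fun b hb => ?_
    rw [Finset.mem_erase] at hb
    simp [bary_ne hK ha hb.2 (Ne.symm hb.1)]
  have hw : (vectorSpan ℝ ((K.erase a : Finset (Pt d)) : Set (Pt d)))ᗮ.starProjection
      ((K.erase a).centroid ℝ id - a) = -((‖baryGrad K a‖ ^ 2)⁻¹ • baryGrad K a) := by
    have hs : (vectorSpan ℝ ((K.erase a : Finset (Pt d)) : Set (Pt d)))ᗮ = ℝ ∙ baryGrad K a := by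
      rw [vectorSpan_erase_eq hK hd ha, Submodule.orthogonal_orthogonal]
    simp_rw [hs]
    rw [Submodule.starProjection_singleton, inner_baryGrad, baryL_sub, hc, bary_self hK ha]
    simp [neg_div]
  rw [normalPt]
  simp only [hw]
  rw [norm_neg, norm_smul, smul_neg, smul_smul]
  have : ‖baryGrad K a‖ ≠ 0 := norm_ne_zero_iff.2 hg
  congr 2
  simp
  field_simp

theorem inner_normalPt (hd : 1 ≤ d) {a : Pt d} (ha : a ∈ K) (v : Pt d) :
    inner ℝ (normalPt K a) v = -(‖baryGrad K a‖⁻¹ * baryL K a v) := by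
  rw [normalPt_eq hK hd ha, inner_neg_left, real_inner_smul_left, inner_baryGrad]

end Bary2

/-! ### The divergence theorem on a simplex -/

/-- Splitting along a unit normal is an isometry onto a line times a hyperplane. This lets Fubini
separate the direction across a facet from the directions along it. -/
theorem measurePreserving_normal_coordinates {n : Pt d} (hn : ‖n‖ = 1) (p : Pt d) :
    MeasurePreserving (fun q : ℝ × (ℝ ∙ n)ᗮ => q.1 • n + (q.2 : Pt d) + p)
      (volume.prod volume) volume := by
  have h1 := ((ℝ ∙ n).measurePreserving_measurableEquivProd p).symm
  rw [InnerProductSpace.euclideanHausdorffMeasure_eq_volume] at h1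
  have h2 := (LinearIsometryEquiv.toSpanUnitSingleton n hn).measurePreserving.prod
    (MeasurePreserving.id (volume : Measure ((ℝ ∙ n)ᗮ)))
  have h3 := h1.comp h2
  convert! h3 using 1

/-- The normal variable is rescaled so that a layer of thickness of order `ε` around a facet becomes
a fixed strip, which permits dominated convergence as `ε → 0`. -/
theorem integral_normal_coordinates_scaled {n : Pt d} (hn : ‖n‖ = 1) (p : Pt d) {c : ℝ}
    (hc : 0 < c) {G : Pt d → ℝ} (hG : Continuous G) :
    ∫ x, G x = c * ∫ q : ℝ × (ℝ ∙ n)ᗮ, G ((c * q.1) • n + (q.2 : Pt d) + p) := by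
  have h1 := measurePreserving_normal_coordinates hn p
  have hm : Measure.map (Prod.map (fun r : ℝ => c * r) (id : (ℝ ∙ n)ᗮ → (ℝ ∙ n)ᗮ))
      (volume.prod volume) = ENNReal.ofReal c⁻¹ • (volume.prod volume) := by
    rw [← Measure.map_prod_map _ _ (by fun_prop) measurable_id, Measure.map_id,
      Real.map_volume_mul_left hc.ne', Measure.prod_smul_left, abs_of_pos (inv_pos.2 hc)]
  have h2 : ∫ x, G x = ∫ q : ℝ × (ℝ ∙ n)ᗮ, G (q.1 • n + (q.2 : Pt d) + p)
      ∂(volume.prod volume) := by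
    rw [← h1.map_eq, integral_map h1.measurable.aemeasurable hG.aestronglyMeasurable]
  have h3 : ∫ q : ℝ × (ℝ ∙ n)ᗮ, G ((c * q.1) • n + (q.2 : Pt d) + p) =
      ∫ q : ℝ × (ℝ ∙ n)ᗮ, G (q.1 • n + (q.2 : Pt d) + p) ∂(Measure.map (Prod.map
        (fun r : ℝ => c * r) (id : (ℝ ∙ n)ᗮ → (ℝ ∙ n)ᗮ)) (volume.prod volume)) := by
    rw [integral_map (by fun_prop)]
    · rfl
    · exact Continuous.aestronglyMeasurable (by fun_prop)
  rw [h3, hm, integral_smul_measure, h2, ENNReal.toReal_ofReal (inv_pos.2 hc).le, smul_eq_mul,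
    ← mul_assoc, mul_inv_cancel₀ hc.ne', one_mul]

/-! ### The smooth step function -/

/-- At every such point the step attains its global minimum 0 or its global maximum 1. -/
theorem deriv_smoothTransition_eq_zero {r : ℝ} (hr : r ∉ Icc (0 : ℝ) 1) :
    deriv Real.smoothTransition r = 0 := by
  rcases not_and_or.1 hr with h | h
  · have hmin : IsLocalMin Real.smoothTransition r :=
      Eventually.of_forall fun y => by
        rw [Real.smoothTransition.zero_of_nonpos (not_le.1 h).le]
        exact Real.smoothTransition.nonneg y
    exact hmin.deriv_eq_zero
  · have hmax : IsLocalMax Real.smoothTransition r :=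
      Eventually.of_forall fun y => by
        rw [Real.smoothTransition.one_of_one_le (not_le.1 h).le]
        exact Real.smoothTransition.le_one y
    exact hmax.deriv_eq_zero

/-- This normalization makes `ε⁻¹ η'(· / ε)` an approximate delta function with the correct mass. -/
theorem integral_deriv_smoothTransition : ∫ r, deriv Real.smoothTransition r = 1 := by
  have hs : ∀ r, r ∉ Icc (0 : ℝ) 1 → deriv Real.smoothTransition r = 0 := fun r hr =>
    deriv_smoothTransition_eq_zero hr
  rw [← setIntegral_eq_integral_of_forall_compl_eq_zero hs,
    integral_Icc_eq_integral_Ioc, ← intervalIntegral.integral_of_le zero_le_one, intervalIntegral.integral_deriv_eq_sub]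
  · simp
  · intro x _
    exact (Real.smoothTransition.contDiff (n := 1)).differentiable (by norm_num) x
  · exact ((Real.smoothTransition.contDiff (n := 1)).continuous_deriv (by norm_num)).intervalIntegrable _ _

theorem continuous_deriv_smoothTransition : Continuous (deriv Real.smoothTransition) :=
  (Real.smoothTransition.contDiff (n := 1)).continuous_deriv (by norm_num)

theorem isCompact_convexHull_finset (S : Finset (Pt d)) :
    IsCompact (convexHull ℝ (S : Set (Pt d))) :=
  S.finite_toSet.isCompact_convexHull ℝ

/-! ### Surface measure of a facet via its hyperplane -/

section Hyperplane

variable {K : Finset (Pt d)} (hK : IsSimplex K) (hd : 1 ≤ d) {a p n : Pt d} (ha : a ∈ K)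
  (hp : p ∈ K.erase a) (hn : n = ‖baryGrad K a‖⁻¹ • baryGrad K a)
include hK hd ha hn

/-- The translated inclusion is an isometry and therefore preserves Hausdorff measure. On the
hyperplane, whose dimension is `d - 1`, that measure is the volume. -/
theorem map_hyperplane (p : Pt d) :
    Measure.map (fun y : (ℝ ∙ n)ᗮ => (y : Pt d) + p) volume =
      (Measure.euclideanHausdorffMeasure (d - 1)).restrict
        (range fun y : (ℝ ∙ n)ᗮ => (y : Pt d) + p) := by
  have hg := baryGrad_ne_zero hK hd ha
  have hn0 : n ≠ 0 := by
    rw [hn]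
    exact smul_ne_zero (inv_ne_zero (norm_ne_zero_iff.2 hg)) hg
  have hfr : Module.finrank ℝ ((ℝ ∙ n)ᗮ : Submodule ℝ (Pt d)) = d - 1 := by
    have := (ℝ ∙ n).finrank_add_finrank_orthogonal
    rw [finrank_span_singleton hn0, finrank_euclideanSpace_fin] at this
    omega
  have hiso : Isometry (fun y : (ℝ ∙ n)ᗮ => (y : Pt d) + p) :=
    (IsometryEquiv.addRight p).isometry.comp isometry_subtype_coe
  have hvol : (Measure.euclideanHausdorffMeasure (d - 1) : Measure ((ℝ ∙ n)ᗮ : Submodule ℝ (Pt d)))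
      = volume := by
    rw [← hfr]; exact InnerProductSpace.euclideanHausdorffMeasure_eq_volume
  rw [← hvol]
  exact hiso.map_euclideanHausdorffMeasure

include hp

omit hd in
theorem facet_subset_hyperplane : convexHull ℝ ((K.erase a : Finset (Pt d)) : Set (Pt d)) ⊆
    range (fun y : (ℝ ∙ n)ᗮ => (y : Pt d) + p) := by
  intro x hx
  refine ⟨⟨x - p, ?_⟩, by simp⟩
  rw [Submodule.mem_orthogonal_singleton_iff_inner_right, hn, real_inner_smul_left,
    inner_baryGrad, baryL_sub, ((mem_facet_iff hK ha).1 hx).1,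
    bary_ne hK ha (Finset.mem_of_mem_erase hp) (Finset.ne_of_mem_erase hp).symm]
  simp

omit hd in
-- The zero set is an affine subspace of the hyperplane. It is proper because the vertex `b` itself
-- lies in the hyperplane and has coordinate 1 there.
theorem ae_hyperplane_bary_ne_zero {b : Pt d} (hb : b ∈ K.erase a) :
    ∀ᵐ y : (ℝ ∙ n)ᗮ, bary K b ((y : Pt d) + p) ≠ 0 := by
  set φ : (ℝ ∙ n)ᗮ →ᵃ[ℝ] ℝ := (bary K b).comp
    ((ℝ ∙ n)ᗮ.subtype.toAffineMap + AffineMap.const ℝ _ p) with hφ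
  have hφa : ∀ y : (ℝ ∙ n)ᗮ, φ y = bary K b ((y : Pt d) + p) := fun y => rfl
  have hz := Measure.addHaar_affineSubspace (volume : Measure ((ℝ ∙ n)ᗮ))
    ((AffineSubspace.mk' (0 : ℝ) ⊥).comap φ) (by
      intro htop
      have hmem : b - p ∈ (ℝ ∙ n)ᗮ := by
        rw [Submodule.mem_orthogonal_singleton_iff_inner_right, hn, real_inner_smul_left,
          inner_baryGrad, baryL_sub, bary_ne hK ha (Finset.mem_of_mem_erase hp)
          (Finset.ne_of_mem_erase hp).symm, bary_ne hK ha (Finset.mem_of_mem_erase hb)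
          (Finset.ne_of_mem_erase hb).symm]
        simp
      have h1 : (⟨b - p, hmem⟩ : (ℝ ∙ n)ᗮ) ∈ (AffineSubspace.mk' (0 : ℝ) ⊥).comap φ := by
        rw [htop]; trivial
      rw [AffineSubspace.mem_comap, hφa] at h1
      simp [bary_self hK (Finset.mem_of_mem_erase hb)] at h1)
  rw [ae_iff]
  refine measure_mono_null (fun y hy => ?_) hz
  rw [SetLike.mem_coe, AffineSubspace.mem_comap, hφa]
  have hy' : bary K b ((y : Pt d) + p) = 0 := by simpa using hy
  simp [hy']

/-- Integrals over a facet in terms of its hyperplane. -/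
theorem integral_surf_eq {f : Pt d → ℝ} (hf : Continuous f) :
    ∫ x, f x ∂(surf (K.erase a)) = ∫ y : (ℝ ∙ n)ᗮ,
      (convexHull ℝ ((K.erase a : Finset (Pt d)) : Set (Pt d))).indicator f ((y : Pt d) + p) := by
  have hcl : IsClosed (convexHull ℝ ((K.erase a : Finset (Pt d)) : Set (Pt d))) :=
    (isCompact_convexHull_finset _).isClosed
  rw [surf, ← integral_indicator hcl.measurableSet,
    ← integral_map (φ := fun y : (ℝ ∙ n)ᗮ => (y : Pt d) + p)
    (f := (convexHull ℝ ((K.erase a : Finset (Pt d)) : Set (Pt d))).indicator f)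
    (by fun_prop) (hf.stronglyMeasurable.indicator hcl.measurableSet).aestronglyMeasurable,
    map_hyperplane hK hd ha hn p, setIntegral_eq_integral_of_forall_compl_eq_zero]
  intro x hx
  exact indicator_of_notMem (fun h => hx (facet_subset_hyperplane hK ha hp hn h)) _

end Hyperplane

theorem isFiniteMeasure_surf {K : Finset (Pt d)} (hK : IsSimplex K) (hd : 1 ≤ d) {a : Pt d}
    (ha : a ∈ K) : IsFiniteMeasure (surf (K.erase a)) := by
  obtain ⟨p, hp⟩ : (K.erase a).Nonempty := by
    rw [← Finset.card_pos, Finset.card_erase_of_mem ha, hK.2]; omega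
  obtain ⟨n, hn⟩ : ∃ n, n = ‖baryGrad K a‖⁻¹ • baryGrad K a := ⟨_, rfl⟩
  set C := convexHull ℝ ((K.erase a : Finset (Pt d)) : Set (Pt d)) with hC
  have hCc : IsCompact C := isCompact_convexHull_finset _
  have hiso : Isometry (fun y : (ℝ ∙ n)ᗮ => (y : Pt d) + p) :=
    (IsometryEquiv.addRight p).isometry.comp isometry_subtype_coe
  have h1 := congrArg (fun μ => μ C) (map_hyperplane hK hd ha hn p)
  simp only at h1
  rw [Measure.map_apply hiso.continuous.measurable hCc.measurableSet,
    Measure.restrict_apply hCc.measurableSet,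
    inter_eq_left.2 (facet_subset_hyperplane hK ha hp hn)] at h1
  refine isFiniteMeasure_restrict.2 ?_
  rw [← h1]
  exact (hiso.isClosedEmbedding.isCompact_preimage hCc).measure_lt_top.ne

/-- Almost every point of a facet lies in its relative interior. -/
theorem ae_surf_bary_pos {K : Finset (Pt d)} (hK : IsSimplex K) (hd : 1 ≤ d) {a : Pt d}
    (ha : a ∈ K) : ∀ᵐ x ∂(surf (K.erase a)), bary K a x = 0 ∧ ∀ b ∈ K.erase a, 0 < bary K b x := by
  obtain ⟨p, hp⟩ : (K.erase a).Nonempty := by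
    rw [← Finset.card_pos, Finset.card_erase_of_mem ha, hK.2]; omega
  obtain ⟨n, hn⟩ : ∃ n, n = ‖baryGrad K a‖⁻¹ • baryGrad K a := ⟨_, rfl⟩
  have hne : ∀ b ∈ K.erase a, ∀ᵐ x ∂(surf (K.erase a)), bary K b x ≠ 0 := by
    intro b hb
    have h1 : ∀ᵐ x ∂(Measure.map (fun y : (ℝ ∙ n)ᗮ => (y : Pt d) + p) volume), bary K b x ≠ 0 :=
      (ae_map_iff (p := fun x => bary K b x ≠ 0) (by fun_prop)
        ((continuous_bary K b).measurable (measurableSet_singleton 0).compl)).2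
        (ae_hyperplane_bary_ne_zero hK ha hp hn hb)
    rw [map_hyperplane hK hd ha hn p] at h1
    exact ae_mono (Measure.restrict_mono (facet_subset_hyperplane hK ha hp hn) le_rfl) h1
  filter_upwards [(Finset.eventually_all (K.erase a)).2 hne,
    ae_restrict_mem (isCompact_convexHull_finset (K.erase a)).measurableSet] with x hx hxF
  rw [mem_facet_iff hK ha] at hxF
  exact ⟨hxF.1, fun b hb => lt_of_le_of_ne (hxF.2 b hb) (hx b hb).symm⟩

theorem tendsto_smoothTransition_div {t c r : ℝ} (ht : t ≠ 0) :
    Tendsto (fun ε : ℝ => Real.smoothTransition (t / ε + r * c)) (𝓝[>] 0)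
      (𝓝 (if 0 < t then 1 else 0)) := by
  have hinv : Tendsto (fun ε : ℝ => ε⁻¹) (𝓝[>] 0) atTop := tendsto_inv_nhdsGT_zero
  split_ifs with h
  · have : Tendsto (fun ε : ℝ => t / ε + r * c) (𝓝[>] 0) atTop :=
      tendsto_atTop_add_const_right _ _ (hinv.const_mul_atTop h)
    refine tendsto_const_nhds.congr' ?_
    filter_upwards [this.eventually_ge_atTop 1] with ε hε
    exact (Real.smoothTransition.one_of_one_le hε).symm
  · have hneg : t < 0 := lt_of_le_of_ne (not_lt.1 h) ht
    have : Tendsto (fun ε : ℝ => t / ε + r * c) (𝓝[>] 0) atBot :=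
      tendsto_atBot_add_const_right _ _ (hinv.const_mul_atTop_of_neg hneg)
    refine tendsto_const_nhds.congr' ?_
    filter_upwards [this.eventually_le_atBot 0] with ε hε
    exact (Real.smoothTransition.zero_of_nonpos hε).symm

/-- The smoothed indicator functions concentrate on the facet. -/
theorem tendsto_integral_facet {K : Finset (Pt d)} (hK : IsSimplex K) (hd : 1 ≤ d) {a : Pt d}
    (ha : a ∈ K) {f : Pt d → ℝ} (hf : Continuous f) (hfc : HasCompactSupport f) :
    Tendsto (fun ε : ℝ => ∫ x, f x * (ε⁻¹ * deriv Real.smoothTransition (bary K a x / ε)) *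
        ∏ b ∈ K.erase a, Real.smoothTransition (bary K b x / ε)) (𝓝[>] 0)
      (𝓝 (‖baryGrad K a‖⁻¹ * ∫ x, f x ∂(surf (K.erase a)))) := by
  have hg := baryGrad_ne_zero hK hd ha
  set κ := ‖baryGrad K a‖ with hκ
  have hκ0 : 0 < κ := norm_pos_iff.2 hg
  obtain ⟨p, hp⟩ : (K.erase a).Nonempty := by
    rw [← Finset.card_pos, Finset.card_erase_of_mem ha, hK.2]; omega
  obtain ⟨n, hn⟩ : ∃ n, n = κ⁻¹ • baryGrad K a := ⟨_, rfl⟩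
  have hn1 : ‖n‖ = 1 := by
    rw [hn, norm_smul, norm_inv, hκ, norm_norm, inv_mul_cancel₀ (norm_ne_zero_iff.2 hg)]
  have hLn : baryL K a n = κ := by
    rw [hn, map_smul, ← inner_baryGrad, real_inner_self_eq_norm_sq, smul_eq_mul, ← hκ]
    field_simp
  have hLy : ∀ y : (ℝ ∙ n)ᗮ, baryL K a y = 0 := fun y => by
    have h1 := Submodule.mem_orthogonal_singleton_iff_inner_right.1 y.2
    have h2 : ∀ v, inner ℝ n v = κ⁻¹ * baryL K a v := fun v => by
      rw [hn, real_inner_smul_left, inner_baryGrad]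
    rw [h2] at h1
    exact (mul_eq_zero.1 h1).resolve_left (inv_ne_zero hκ0.ne')
  have hpa : bary K a p = 0 :=
    bary_ne hK ha (Finset.mem_of_mem_erase hp) (Finset.ne_of_mem_erase hp).symm
  have hcoordb : ∀ (b : Pt d) (c r : ℝ) (y : (ℝ ∙ n)ᗮ),
      bary K b ((c * r) • n + (y : Pt d) + p) = bary K b ((y : Pt d) + p) + c * r * baryL K b n := by
    intro b c r y
    rw [show (c * r) • n + (y : Pt d) + p = ((y : Pt d) + p) + (c * r) • n by abel, bary_add,
      map_smul, smul_eq_mul]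
  have hcoorda : ∀ (y : (ℝ ∙ n)ᗮ), bary K a ((y : Pt d) + p) = 0 := by
    intro y
    rw [add_comm, bary_add, hpa, hLy, add_zero]
  -- The integrand after the substitution with scale `ε / κ`. The coordinate of `a` grows at rate
  -- `κ` along `n`, so divided by `ε` it becomes exactly `q.1`. The Jacobian `ε / κ` absorbs the
  -- factor `ε⁻¹` and leaves `κ⁻¹`.
  set Φ : ℝ → ℝ × (ℝ ∙ n)ᗮ → ℝ := fun ε q =>
    f ((ε / κ * q.1) • n + (q.2 : Pt d) + p) * deriv Real.smoothTransition q.1 *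
      ∏ b ∈ K.erase a, Real.smoothTransition
        (bary K b ((q.2 : Pt d) + p) / ε + q.1 * (baryL K b n / κ)) with hΦ
  have hηc := continuous_deriv_smoothTransition
  have key : ∀ ε : ℝ, 0 < ε → ∫ x, f x * (ε⁻¹ * deriv Real.smoothTransition (bary K a x / ε)) *
        ∏ b ∈ K.erase a, Real.smoothTransition (bary K b x / ε) = κ⁻¹ * ∫ q, Φ ε q := by
    intro ε hε
    rw [integral_normal_coordinates_scaled hn1 p (c := ε / κ) (by positivity)]
    · rw [← integral_const_mul, ← integral_const_mul]
      refine integral_congr_ae (Eventually.of_forall fun q => ?_)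
      simp only [hΦ, hcoordb, hcoorda, hLn]
      have e1 : (0 + ε / κ * q.1 * κ) / ε = q.1 := by field_simp; ring
      rw [e1]
      have e2 : ∀ b, (bary K b ((q.2 : Pt d) + p) + ε / κ * q.1 * baryL K b n) / ε =
          bary K b ((q.2 : Pt d) + p) / ε + q.1 * (baryL K b n / κ) := by
        intro b; field_simp
      simp only [e2]
      field_simp
    · have := continuous_bary K
      have := Real.smoothTransition.continuous
      refine (hf.mul (continuous_const.mul (hηc.comp ((continuous_bary K a).div_const _)))).mul ?_
      exact continuous_finsetProd _ fun b _ => Real.smoothTransition.continuous.comp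
        ((continuous_bary K b).div_const _)
  have hlim : Tendsto (fun ε : ℝ => ∫ q, Φ ε q) (𝓝[>] 0)
      (𝓝 (∫ q : ℝ × (ℝ ∙ n)ᗮ, deriv Real.smoothTransition q.1 *
        (convexHull ℝ ((K.erase a : Finset (Pt d)) : Set (Pt d))).indicator f
          ((q.2 : Pt d) + p))) := by
    obtain ⟨M, hM⟩ := hfc.exists_bound_of_continuous hf
    obtain ⟨Mη, hMη⟩ := isCompact_Icc.exists_bound_of_continuousOn (s := Icc (0 : ℝ) 1)
      hηc.continuousOn
    obtain ⟨R, hR⟩ := hfc.isBounded.exists_norm_le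
    have hM0 : 0 ≤ M := (norm_nonneg _).trans (hM 0)
    have hMη0 : 0 ≤ Mη := (norm_nonneg _).trans (hMη 0 (by simp))
    -- A compact set outside which all integrands with `0 < ε < 1` vanish. The derivative of the
    -- step confines the normal variable to `[0, 1]`. The support of `f` has radius `R`, and `1 / κ`
    -- and `‖p‖` account for the normal displacement and the base point.
    set B : Set (ℝ × (ℝ ∙ n)ᗮ) := Icc 0 1 ×ˢ Metric.closedBall 0 (R + 1 / κ + ‖p‖) with hB
    have hBc : IsCompact B := isCompact_Icc.prod (isCompact_closedBall _ _)
    refine tendsto_integral_filter_of_dominated_convergence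
      (B.indicator fun _ => M * Mη) ?_ ?_ ?_ ?_
    · refine Eventually.of_forall fun ε => Continuous.aestronglyMeasurable ?_
      refine ((hf.comp (by fun_prop)).mul (hηc.comp continuous_fst)).mul ?_
      refine continuous_finsetProd _ fun b _ => Real.smoothTransition.continuous.comp ?_
      exact (((continuous_bary K b).comp (by fun_prop)).div_const _).add (by fun_prop)
    · filter_upwards [Ioo_mem_nhdsGT (zero_lt_one' ℝ)] with ε hε
      refine Eventually.of_forall fun q => ?_
      by_cases hq : q ∈ B
      · rw [indicator_of_mem hq, norm_mul, norm_mul]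
        refine (mul_le_of_le_one_right (by positivity) ?_).trans
          (mul_le_mul (hM _) (hMη _ hq.1) (norm_nonneg _) hM0)
        rw [Real.norm_of_nonneg (Finset.prod_nonneg fun _ _ => Real.smoothTransition.nonneg _)]
        exact Finset.prod_le_one (fun _ _ => Real.smoothTransition.nonneg _)
          fun _ _ => Real.smoothTransition.le_one _
      · rw [indicator_of_notMem hq]
        refine (norm_eq_zero.2 ?_).le
        by_cases h1 : q.1 ∈ Icc (0 : ℝ) 1
        · have : f ((ε / κ * q.1) • n + (q.2 : Pt d) + p) = 0 := by
            by_contra hne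
            have hle := hR _ (subset_tsupport f hne)
            apply hq
            refine ⟨h1, ?_⟩
            rw [mem_closedBall_zero_iff]
            have e : ((q.2 : (ℝ ∙ n)ᗮ) : Pt d) = ((ε / κ * q.1) • n + (q.2 : Pt d) + p) -
              (ε / κ * q.1) • n - p := by abel
            have hq1 : ‖(ε / κ * q.1) • n‖ ≤ 1 / κ := by
              rw [norm_smul, hn1, mul_one, Real.norm_of_nonneg
                (mul_nonneg (div_nonneg hε.1.le hκ0.le) h1.1), div_mul_eq_mul_div]
              gcongr
              exact mul_le_one₀ hε.2.le h1.1 h1.2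
            calc ‖q.2‖ = ‖((q.2 : (ℝ ∙ n)ᗮ) : Pt d)‖ := rfl
              _ ≤ _ := by
                rw [e]
                refine (norm_sub_le _ _).trans (add_le_add_left ((norm_sub_le _ _).trans
                  (add_le_add hle hq1)) _)
          simp only [hΦ, this, zero_mul]
        · simp only [hΦ, deriv_smoothTransition_eq_zero h1, mul_zero, zero_mul]
    · exact (integrable_indicator_iff hBc.measurableSet).2
        (integrableOn_const (hBc.measure_lt_top.ne))
    · have hnull : ∀ b ∈ K.erase a, ∀ᵐ q : ℝ × (ℝ ∙ n)ᗮ, bary K b ((q.2 : Pt d) + p) ≠ 0 :=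
        fun b hb => (Measure.quasiMeasurePreserving_snd (μ := (volume : Measure ℝ))
          (ν := (volume : Measure ((ℝ ∙ n)ᗮ)))).ae (ae_hyperplane_bary_ne_zero hK ha hp hn hb)
      filter_upwards [(Finset.eventually_all (K.erase a)).2 hnull] with q hq
      have hprod : Tendsto (fun ε : ℝ => ∏ b ∈ K.erase a, Real.smoothTransition
          (bary K b ((q.2 : Pt d) + p) / ε + q.1 * (baryL K b n / κ))) (𝓝[>] 0)
          (𝓝 (∏ b ∈ K.erase a, if 0 < bary K b ((q.2 : Pt d) + p) then 1 else 0)) :=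
        tendsto_finsetProd _ fun b hb => tendsto_smoothTransition_div (hq b hb)
      have hfl : Tendsto (fun ε : ℝ => f ((ε / κ * q.1) • n + (q.2 : Pt d) + p)) (𝓝[>] 0)
          (𝓝 (f ((q.2 : Pt d) + p))) := by
        have : Continuous fun ε : ℝ => f ((ε / κ * q.1) • n + (q.2 : Pt d) + p) :=
          hf.comp (by fun_prop)
        have := this.tendsto 0
        simp only [zero_div, zero_mul, zero_smul, zero_add] at this
        exact this.mono_left nhdsWithin_le_nhds
      convert (hfl.mul_const (deriv Real.smoothTransition q.1)).mul hprod using 2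
      rw [Finset.prod_ite_zero, Finset.prod_const_one]
      -- Off the null set where a coordinate vanishes, the limit of the remaining factors is the
      -- indicator of the facet.
      have hiff : ((q.2 : Pt d) + p ∈ convexHull ℝ ((K.erase a : Finset (Pt d)) : Set (Pt d))) ↔
          ∀ b ∈ K.erase a, 0 < bary K b ((q.2 : Pt d) + p) := by
        rw [mem_facet_iff hK ha]
        exact ⟨fun h b hb => lt_of_le_of_ne (h.2 b hb) (hq b hb).symm,
          fun h => ⟨hcoorda _, fun b hb => (h b hb).le⟩⟩
      split_ifs with h
      · rw [indicator_of_mem (hiff.2 h)]; ring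
      · rw [indicator_of_notMem (fun h' => h (hiff.1 h'))]; ring
  have hfin := (hlim.const_mul κ⁻¹).congr' (f₂ := fun ε : ℝ => ∫ x, f x * (ε⁻¹ *
      deriv Real.smoothTransition (bary K a x / ε)) *
      ∏ b ∈ K.erase a, Real.smoothTransition (bary K b x / ε)) (by
    filter_upwards [self_mem_nhdsWithin] with ε hε
    exact (key ε hε).symm)
  convert hfin using 3
  rw [integral_surf_eq hK hd ha hp hn hf]
  have := integral_prod_mul (μ := (volume : Measure ℝ)) (ν := (volume : Measure ((ℝ ∙ n)ᗮ)))
    (deriv Real.smoothTransition)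
    (fun y => (convexHull ℝ ((K.erase a : Finset (Pt d)) : Set (Pt d))).indicator f ((y : Pt d) + p))
  rw [integral_deriv_smoothTransition, one_mul] at this
  exact this.symm

/-- Integration by parts on the whole space against `∏ η(λ_a / ε)` has no boundary terms. The
derivative of the product hits one factor at a time, and the term of `a` concentrates on the
opposite facet with weight `-∂_v λ_a / ‖∇λ_a‖`, the component of the outward normal along `v`. -/
theorem integral_fderiv_cell_of_hasCompactSupport {K : Finset (Pt d)} (hK : IsSimplex K)
    (hd : 1 ≤ d) {f : Pt d → ℝ} (hf : ContDiff ℝ ∞ f) (hfc : HasCompactSupport f) (v : Pt d) :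
    ∫ x in cell K, fderiv ℝ f x v =
      ∑ a ∈ K, inner ℝ (normalPt K a) v * ∫ x, f x ∂(surf (K.erase a)) := by
  set η := Real.smoothTransition with hη
  have hηs : ContDiff ℝ ∞ η := Real.smoothTransition.contDiff
  have hηd : ∀ x, HasDerivAt η (deriv η x) x := fun x =>
    (hηs.differentiable (by simp) x).hasDerivAt
  have hηc : Continuous (deriv η) := continuous_deriv_smoothTransition
  have hf1 : Continuous (fderiv ℝ f) := hf.continuous_fderiv (by simp)
  have hfd : ∀ x, HasFDerivAt f (fderiv ℝ f x) x := fun x =>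
    (hf.differentiable (by simp) x).hasFDerivAt
  have hηb : ∀ (a : Pt d) (ε : ℝ), ContDiff ℝ ∞ fun x => η (bary K a x / ε) := fun a ε =>
    hηs.comp ((contDiff_bary K a).div_const ε)
  have hident : ∀ ε : ℝ, (∫ x, fderiv ℝ f x v * ∏ a ∈ K, η (bary K a x / ε)) =
      ∑ a ∈ K, -(baryL K a v * ∫ x, f x * (ε⁻¹ * deriv η (bary K a x / ε)) *
        ∏ b ∈ K.erase a, η (bary K b x / ε)) := by
    intro ε
    set P : Pt d → ℝ := fun x => ∏ a ∈ K, η (bary K a x / ε) with hP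
    have hPs : ContDiff ℝ ∞ P := contDiff_prod fun a _ => hηb a ε
    have hPd : ∀ x, fderiv ℝ P x v = ∑ a ∈ K, baryL K a v * ((ε⁻¹ * deriv η (bary K a x / ε)) *
        ∏ b ∈ K.erase a, η (bary K b x / ε)) := by
      intro x
      have h1 : ∀ a ∈ K, HasFDerivAt (fun x => η (bary K a x / ε))
          ((deriv η (bary K a x / ε)) • (ε⁻¹ • baryL K a)) x := fun a _ => by
        refine (hηd _).comp_hasFDerivAt x ?_
        have := (hasFDerivAt_bary K a x).const_smul ε⁻¹
        convert! this using 1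
        funext y
        simp [div_eq_inv_mul]
      have h2 := (HasFDerivAt.finsetProd h1).fderiv
      simp only [hP]
      rw [h2]
      simp only [_root_.sum_apply, _root_.smul_apply, smul_eq_mul]
      refine Finset.sum_congr rfl fun a _ => by ring
    have hint : ∀ a ∈ K, Integrable (fun x => baryL K a v * (f x * (ε⁻¹ * deriv η (bary K a x / ε)) *
        ∏ b ∈ K.erase a, η (bary K b x / ε))) := by
      intro a _
      refine (Continuous.integrable_of_hasCompactSupport ?_ ?_).const_mul _
      · exact (hf.continuous.mul (continuous_const.mul (hηc.comp
          ((continuous_bary K a).div_const _)))).mul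
          (continuous_finsetProd _ fun b _ => (hηb b ε).continuous)
      · exact (hfc.mul_right).mul_right
    have hibp := integral_mul_fderiv_eq_neg_fderiv_mul_of_integrable (𝕜 := ℝ) (f := P) (g := f)
      (v := v) (μ := volume) ?_ ?_ ?_ ?_ ?_
    · have e1 : (∫ x, fderiv ℝ f x v * P x) = ∫ x, P x * fderiv ℝ f x v :=
        integral_congr_ae (Eventually.of_forall fun x => mul_comm _ _)
      rw [e1, hibp, Finset.sum_neg_distrib, neg_inj]
      simp_rw [← integral_const_mul]
      rw [← integral_finsetSum _ hint]
      refine integral_congr_ae (Eventually.of_forall fun x => ?_)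
      simp only [hPd, Finset.sum_mul]
      exact Finset.sum_congr rfl fun a _ => by ring
    · refine Continuous.integrable_of_hasCompactSupport ?_ hfc.mul_left
      exact ((hPs.continuous_fderiv (by simp)).clm_apply continuous_const).mul hf.continuous
    · refine Continuous.integrable_of_hasCompactSupport ?_ (hfc.fderiv_apply ℝ v).mul_left
      exact hPs.continuous.mul (hf1.clm_apply continuous_const)
    · exact (hPs.continuous.mul hf.continuous).integrable_of_hasCompactSupport hfc.mul_left
    · exact fun x _ => hPs.differentiable (by simp) x
    · exact fun x _ => hf.differentiable (by simp) x
  have hL : Tendsto (fun ε : ℝ => ∫ x, fderiv ℝ f x v * ∏ a ∈ K, η (bary K a x / ε)) (𝓝[>] 0)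
      (𝓝 (∫ x in cell K, fderiv ℝ f x v)) := by
    rw [← integral_indicator (isOpen_cell K).measurableSet]
    refine tendsto_integral_filter_of_dominated_convergence (fun x => ‖fderiv ℝ f x v‖) ?_ ?_ ?_ ?_
    · refine Eventually.of_forall fun ε => Continuous.aestronglyMeasurable ?_
      exact (hf1.clm_apply continuous_const).mul
        (continuous_finsetProd _ fun b _ => (hηb b ε).continuous)
    · refine Eventually.of_forall fun ε => Eventually.of_forall fun x => ?_
      rw [norm_mul]
      refine mul_le_of_le_one_right (norm_nonneg _) ?_
      rw [Real.norm_of_nonneg (Finset.prod_nonneg fun _ _ => Real.smoothTransition.nonneg _)]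
      exact Finset.prod_le_one (fun _ _ => Real.smoothTransition.nonneg _)
          fun _ _ => Real.smoothTransition.le_one _
    · exact ((hf1.clm_apply continuous_const).integrable_of_hasCompactSupport
        (hfc.fderiv_apply ℝ v)).norm
    · refine Eventually.of_forall fun x => ?_
      have hprod : Tendsto (fun ε : ℝ => ∏ a ∈ K, η (bary K a x / ε)) (𝓝[>] 0)
          (𝓝 (∏ a ∈ K, if 0 < bary K a x then 1 else 0)) := by
        refine tendsto_finsetProd _ fun b hb => ?_
        -- Since `η 0 = 0`, the limit is the indicator of the open cell at every point, including
        -- those with a vanishing coordinate.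
        rcases eq_or_ne (bary K b x) 0 with h0 | h0
        · simp [h0, hη]
        · simpa using tendsto_smoothTransition_div (c := 0) (r := 0) h0
      convert hprod.const_mul (fderiv ℝ f x v) using 2
      rw [Finset.prod_ite_zero, Finset.prod_const_one]
      split_ifs with h
      · rw [indicator_of_mem ((mem_cell_iff hK).2 h), mul_one]
      · rw [indicator_of_notMem (fun h' => h ((mem_cell_iff hK).1 h')), mul_zero]
  have hR : Tendsto (fun ε : ℝ => ∑ a ∈ K, -(baryL K a v * ∫ x, f x *
        (ε⁻¹ * deriv η (bary K a x / ε)) * ∏ b ∈ K.erase a, η (bary K b x / ε))) (𝓝[>] 0)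
      (𝓝 (∑ a ∈ K, -(baryL K a v * (‖baryGrad K a‖⁻¹ * ∫ x, f x ∂(surf (K.erase a)))))) :=
    tendsto_finsetSum _ fun a ha =>
      ((tendsto_integral_facet hK hd ha hf.continuous hfc).const_mul _).neg
  simp only [hident] at hL
  rw [tendsto_nhds_unique hL hR]
  refine Finset.sum_congr rfl fun a ha => ?_
  rw [inner_normalPt hK hd ha]
  ring

theorem exists_contDiff_hasCompactSupport_eq_on {f : Pt d → ℝ} (hf : ContDiff ℝ ∞ f)
    {C : Set (Pt d)} (hC : IsCompact C) :
    ∃ g : Pt d → ℝ, ContDiff ℝ ∞ g ∧ HasCompactSupport g ∧ ∃ U, IsOpen U ∧ C ⊆ U ∧ EqOn f g U := by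
  obtain ⟨R, hR⟩ := hC.isBounded.subset_ball 0
  have hR' : C ⊆ Metric.ball 0 (max R 1) := hR.trans (Metric.ball_subset_ball (le_max_left _ _))
  let ψ : ContDiffBump (0 : Pt d) := ⟨max R 1, max R 1 + 1, by positivity, by linarith⟩
  refine ⟨fun x => f x * ψ x, hf.mul ψ.contDiff, ψ.hasCompactSupport.mul_left,
    Metric.ball 0 (max R 1), Metric.isOpen_ball, hR', fun x hx => ?_⟩
  simp only
  rw [ψ.one_of_mem_closedBall (Metric.ball_subset_closedBall hx), mul_one]

/-- The **divergence theorem** on a simplex. -/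
theorem integral_fderiv_cell {K : Finset (Pt d)} (hK : IsSimplex K) (hd : 1 ≤ d) {f : Pt d → ℝ}
    (hf : ContDiff ℝ ∞ f) (v : Pt d) :
    ∫ x in cell K, fderiv ℝ f x v =
      ∑ a ∈ K, inner ℝ (normalPt K a) v * ∫ x, f x ∂(surf (K.erase a)) := by
  obtain ⟨g, hg, hgc, U, hU, hKU, hfg⟩ :=
    exists_contDiff_hasCompactSupport_eq_on hf (isCompact_convexHull_finset K)
  have h := integral_fderiv_cell_of_hasCompactSupport hK hd hg hgc v
  have e1 : ∫ x in cell K, fderiv ℝ f x v = ∫ x in cell K, fderiv ℝ g x v := by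
    refine setIntegral_congr_fun (isOpen_cell K).measurableSet fun x hx => ?_
    have : f =ᶠ[𝓝 x] g := hfg.eventuallyEq_of_mem (hU.mem_nhds (hKU (interior_subset hx)))
    simp only [this.fderiv_eq]
  rw [e1, h]
  refine Finset.sum_congr rfl fun a _ => ?_
  congr 1
  refine (setIntegral_congr_fun (isCompact_convexHull_finset _).measurableSet fun x hx => ?_).symm
  exact hfg (hKU (convexHull_mono (by exact_mod_cast Finset.erase_subset a K) hx))

/-! ### Weak derivatives -/

theorem partialD_continuous {φ : Pt d → ℝ} (hφ : ContDiff ℝ ∞ φ) (j : Fin d) :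
    Continuous (partialD j φ) :=
  (hφ.continuous_fderiv (by simp)).clm_apply continuous_const

theorem partialD_contDiff {φ : Pt d → ℝ} (hφ : ContDiff ℝ ∞ φ) (j : Fin d) :
    ContDiff ℝ ∞ (partialD j φ) :=
  (hφ.fderiv_right (m := ∞) (by simp)).clm_apply contDiff_const

theorem partialD_mul {φ ψ : Pt d → ℝ} (hφ : ContDiff ℝ ∞ φ) (hψ : ContDiff ℝ ∞ ψ) (j : Fin d)
    (x : Pt d) : partialD j (fun y => φ y * ψ y) x = partialD j φ x * ψ x + φ x * partialD j ψ x := by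
  simp only [partialD]
  rw [fderiv_fun_mul (hφ.differentiable (by simp) x) (hψ.differentiable (by simp) x)]
  simp
  ring

theorem tsupport_partialD_subset (φ : Pt d → ℝ) (j : Fin d) :
    tsupport (partialD j φ) ⊆ tsupport φ :=
  tsupport_fderiv_apply_subset ℝ _

theorem locallyIntegrableOn_congr {U : Set (Pt d)} {g g' : Pt d → ℝ}
    (h : LocallyIntegrableOn g U) (hgg' : g =ᵐ[volume.restrict U] g') :
    LocallyIntegrableOn g' U := by
  intro x hx
  obtain ⟨s, hs, hi⟩ := h x hx
  refine ⟨s ∩ U, inter_mem hs self_mem_nhdsWithin, ?_⟩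
  exact (hi.mono_set inter_subset_left).congr (ae_restrict_of_ae_restrict_of_subset
    inter_subset_right hgg')

theorem integrable_mul_of_tsupport_subset {U : Set (Pt d)} {g φ : Pt d → ℝ}
    (hg : LocallyIntegrableOn g U) (hφ : Continuous φ) (hc : HasCompactSupport φ)
    (hs : tsupport φ ⊆ U) : Integrable (fun x => g x * φ x) := by
  have h1 : IntegrableOn g (tsupport φ) := hg.integrableOn_compact_subset hs hc
  have h2 := h1.mul_continuousOn hφ.continuousOn hc
  rw [← integrableOn_iff_integrable_of_support_subset (s := tsupport φ)]
  · exact h2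
  · intro x hx
    exact subset_tsupport φ (right_ne_zero_of_mul hx)

theorem IsTestFunction.partialD {U : Set (Pt d)} {φ : Pt d → ℝ} (h : IsTestFunction U φ)
    (j : Fin d) : IsTestFunction U (partialD j φ) :=
  ⟨partialD_contDiff h.1 j, h.2.1.fderiv_apply ℝ _, (tsupport_partialD_subset φ j).trans h.2.2⟩

theorem IsTestFunction.integrable_mul {U : Set (Pt d)} {g φ : Pt d → ℝ} (h : IsTestFunction U φ)
    (hg : LocallyIntegrableOn g U) : Integrable (fun x => g x * φ x) :=
  integrable_mul_of_tsupport_subset hg h.1.continuous h.2.1 h.2.2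

theorem IsTestFunction.setIntegral_mul {U : Set (Pt d)} {φ : Pt d → ℝ} (h : IsTestFunction U φ)
    (g : Pt d → ℝ) : ∫ x in U, g x * φ x = ∫ x, g x * φ x := by
  refine setIntegral_eq_integral_of_forall_compl_eq_zero fun x hx => ?_
  rw [image_eq_zero_of_notMem_tsupport (fun h' => hx (h.2.2 h')), mul_zero]

theorem IsTestFunction.mono {U V : Set (Pt d)} {φ : Pt d → ℝ} (h : IsTestFunction V φ)
    (hVU : V ⊆ U) : IsTestFunction U φ := ⟨h.1, h.2.1, h.2.2.trans hVU⟩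

/-- The weak derivative is unique almost everywhere. -/
theorem HasWeakPartial.ae_eq {U : Set (Pt d)} (hU : IsOpen U) {j : Fin d} {g g₁ g₂ : Pt d → ℝ}
    (h₁ : HasWeakPartial U j g g₁) (h₂ : HasWeakPartial U j g g₂) :
    g₁ =ᵐ[volume.restrict U] g₂ := by
  have h := hU.ae_eq_zero_of_integral_contDiff_smul_eq_zero (μ := volume) (f := fun x => g₁ x - g₂ x)
    (h₁.2.1.sub h₂.2.1) (by
      intro φ hφ hc hs
      have ht : IsTestFunction U φ := ⟨hφ, hc, hs⟩
      have e1 := h₁.2.2 φ ht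
      have e2 := h₂.2.2 φ ht
      rw [e1, ht.setIntegral_mul, ht.setIntegral_mul, neg_inj] at e2
      have : ∀ x, φ x • (g₁ x - g₂ x) = g₁ x * φ x - g₂ x * φ x := fun x => by
        rw [smul_eq_mul]; ring
      simp_rw [this]
      rw [integral_sub (ht.integrable_mul h₁.2.1) (ht.integrable_mul h₂.2.1), e2, sub_self])
  rw [EventuallyEq, ae_restrict_iff' hU.measurableSet]
  filter_upwards [h] with x hx hxU
  exact sub_eq_zero.1 (hx hxU)

theorem HasWeakPartial.hasWeakPartial_weakPartial {U : Set (Pt d)} {j : Fin d} {g g' : Pt d → ℝ}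
    (h : HasWeakPartial U j g g') : HasWeakPartial U j g (weakPartial U j g) := by
  have h' : ∃ g', HasWeakPartial U j g g' := ⟨g', h⟩
  rw [weakPartial, dif_pos h']
  exact h'.choose_spec

theorem HasWeakPartial.weakPartial_ae_eq {U : Set (Pt d)} (hU : IsOpen U) {j : Fin d}
    {g g' : Pt d → ℝ} (h : HasWeakPartial U j g g') :
    weakPartial U j g =ᵐ[volume.restrict U] g' :=
  h.hasWeakPartial_weakPartial.ae_eq hU h

theorem HasWeakPartial.mono {U V : Set (Pt d)} (hVU : V ⊆ U) {j : Fin d} {g g' : Pt d → ℝ}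
    (h : HasWeakPartial U j g g') : HasWeakPartial V j g g' := by
  refine ⟨h.1.mono_set hVU, h.2.1.mono_set hVU, fun φ hφ => ?_⟩
  have := h.2.2 φ (hφ.mono hVU)
  rwa [(hφ.mono hVU).setIntegral_mul, ((hφ.mono hVU).partialD j).setIntegral_mul,
    ← hφ.setIntegral_mul, ← (hφ.partialD j).setIntegral_mul] at this

theorem HasWeakPartial.congr {U : Set (Pt d)} {j : Fin d} {g g' k k' : Pt d → ℝ}
    (h : HasWeakPartial U j g g') (hg : g =ᵐ[volume.restrict U] k)
    (hg' : g' =ᵐ[volume.restrict U] k') : HasWeakPartial U j k k' := by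
  refine ⟨locallyIntegrableOn_congr h.1 hg, locallyIntegrableOn_congr h.2.1 hg', fun φ hφ => ?_⟩
  have e1 : ∫ x in U, g x * HybridNS.partialD j φ x = ∫ x in U, k x * HybridNS.partialD j φ x :=
    integral_congr_ae (hg.mul (EventuallyEq.refl _ _))
  have e2 : ∫ x in U, g' x * φ x = ∫ x in U, k' x * φ x :=
    integral_congr_ae (hg'.mul (EventuallyEq.refl _ _))
  rw [← e1, ← e2]
  exact h.2.2 φ hφ

theorem HasWeakPartial.add {U : Set (Pt d)} {j : Fin d} {g g' k k' : Pt d → ℝ}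
    (h : HasWeakPartial U j g g') (h' : HasWeakPartial U j k k') :
    HasWeakPartial U j (fun x => g x + k x) (fun x => g' x + k' x) := by
  refine ⟨h.1.add h'.1, h.2.1.add h'.2.1, fun φ hφ => ?_⟩
  simp only [add_mul]
  rw [integral_add ((hφ.partialD j).integrable_mul h.1).integrableOn
    ((hφ.partialD j).integrable_mul h'.1).integrableOn,
    integral_add (hφ.integrable_mul h.2.1).integrableOn (hφ.integrable_mul h'.2.1).integrableOn,
    h.2.2 φ hφ, h'.2.2 φ hφ, neg_add]

theorem HasWeakPartial.const_mul {U : Set (Pt d)} {j : Fin d} {g g' : Pt d → ℝ} (c : ℝ)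
    (h : HasWeakPartial U j g g') : HasWeakPartial U j (fun x => c * g x) (fun x => c * g' x) := by
  refine ⟨h.1.smul c, h.2.1.smul c, fun φ hφ => ?_⟩
  simp only [mul_assoc]
  rw [integral_const_mul, integral_const_mul, h.2.2 φ hφ, mul_neg]

theorem hasWeakPartial_of_contDiff {U : Set (Pt d)} (j : Fin d) {g : Pt d → ℝ}
    (hg : ContDiff ℝ ∞ g) : HasWeakPartial U j g (HybridNS.partialD j g) := by
  refine ⟨hg.continuous.locallyIntegrable.locallyIntegrableOn _,
    (partialD_continuous hg j).locallyIntegrable.locallyIntegrableOn _, fun φ hφ => ?_⟩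
  rw [(hφ.partialD j).setIntegral_mul, hφ.setIntegral_mul]
  refine integral_mul_fderiv_eq_neg_fderiv_mul_of_integrable ?_ ?_ ?_ ?_ ?_
  · exact hφ.integrable_mul ((partialD_continuous hg j).locallyIntegrable.locallyIntegrableOn _)
  · exact (hφ.partialD j).integrable_mul (hg.continuous.locallyIntegrable.locallyIntegrableOn _)
  · exact hφ.integrable_mul (hg.continuous.locallyIntegrable.locallyIntegrableOn _)
  · exact fun x _ => hg.differentiable (by simp) x
  · exact fun x _ => hφ.1.differentiable (by simp) x

/-- Uniqueness of weak derivatives lets the chosen `weakPartial` replace the existential witnesses.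
-/
theorem memH_one_iff {U : Set (Pt d)} (hU : IsOpen U) {g : Pt d → ℝ} :
    MemH 1 U g ↔ MemLp g 2 (volume.restrict U) ∧ ∀ j, HasWeakPartial U j g (weakPartial U j g) ∧
      MemLp (weakPartial U j g) 2 (volume.restrict U) := by
  simp only [MemH]
  refine and_congr_right fun _ => forall_congr' fun j => ?_
  exact ⟨fun ⟨g', h1, h2⟩ => ⟨h1.hasWeakPartial_weakPartial,
    h2.ae_eq (h1.weakPartial_ae_eq hU).symm⟩, fun h => ⟨_, h.1, h.2⟩⟩

theorem MemH.congr {m : ℕ} {U : Set (Pt d)} {g k : Pt d → ℝ} (h : MemH m U g)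
    (hg : g =ᵐ[volume.restrict U] k) : MemH m U k := by
  cases m with
  | zero => exact MemLp.ae_eq hg h
  | succ m =>
    refine ⟨h.1.ae_eq hg, fun j => ?_⟩
    obtain ⟨g', h1, h2⟩ := h.2 j
    exact ⟨g', h1.congr hg (EventuallyEq.refl _ _), h2⟩

theorem MemH.mono {m : ℕ} {U V : Set (Pt d)} (hVU : V ⊆ U) {g : Pt d → ℝ} (h : MemH m U g) :
    MemH m V g := by
  induction m generalizing g with
  | zero => exact MemLp.mono_measure (Measure.restrict_mono hVU le_rfl) h
  | succ m ih =>
    refine ⟨h.1.mono_measure (Measure.restrict_mono hVU le_rfl), fun j => ?_⟩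
    obtain ⟨g', h1, h2⟩ := h.2 j
    exact ⟨g', h1.mono hVU, ih h2⟩

theorem MemH.of_succ {m : ℕ} {U : Set (Pt d)} {g : Pt d → ℝ} (h : MemH (m + 1) U g) :
    MemH m U g := by
  induction m generalizing g with
  | zero => exact h.1
  | succ m ih =>
    refine ⟨h.1, fun j => ?_⟩
    obtain ⟨g', h1, h2⟩ := h.2 j
    exact ⟨g', h1, ih h2⟩

theorem MemH.weakPartial {m : ℕ} {U : Set (Pt d)} (hU : IsOpen U) {g : Pt d → ℝ}
    (h : MemH (m + 1) U g) (j : Fin d) : MemH m U (weakPartial U j g) := by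
  obtain ⟨g', h1, h2⟩ := h.2 j
  exact h2.congr (h1.weakPartial_ae_eq hU).symm

theorem MemH.hasWeakPartial {m : ℕ} {U : Set (Pt d)} {g : Pt d → ℝ}
    (h : MemH (m + 1) U g) (j : Fin d) : HasWeakPartial U j g (HybridNS.weakPartial U j g) := by
  obtain ⟨g', h1, h2⟩ := h.2 j
  exact h1.hasWeakPartial_weakPartial

/-- Restricting to a smaller open set does not change the weak derivative. -/
theorem MemH.weakPartial_ae_eq {m : ℕ} {U V : Set (Pt d)} (hV : IsOpen V) (hVU : V ⊆ U)
    {g : Pt d → ℝ} (h : MemH (m + 1) U g) (j : Fin d) :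
    HybridNS.weakPartial V j g =ᵐ[volume.restrict V] HybridNS.weakPartial U j g :=
  ((h.hasWeakPartial j).mono hVU).weakPartial_ae_eq hV

theorem memLp_of_continuous {U : Set (Pt d)} (hU : Bornology.IsBounded U) {p : ENNReal}
    {g : Pt d → ℝ} (hg : Continuous g) : MemLp g p (volume.restrict U) := by
  obtain ⟨R, hR⟩ := hU.subset_closedBall 0
  obtain ⟨M, hM⟩ := (isCompact_closedBall (0 : Pt d) R).exists_bound_of_continuousOn hg.continuousOn
  have : IsFiniteMeasure (volume.restrict (Metric.closedBall (0 : Pt d) R)) :=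
    isFiniteMeasure_restrict.2 measure_closedBall_lt_top.ne
  have h : MemLp g p (volume.restrict (Metric.closedBall (0 : Pt d) R)) :=
    MemLp.of_bound hg.aestronglyMeasurable M
      (ae_restrict_of_forall_mem Metric.isClosed_closedBall.measurableSet hM)
  exact h.mono_measure (Measure.restrict_mono hR le_rfl)

theorem memH_one_of_contDiff {U : Set (Pt d)} (hU : Bornology.IsBounded U)
    {g : Pt d → ℝ} (hg : ContDiff ℝ ∞ g) : MemH 1 U g :=
  ⟨memLp_of_continuous hU hg.continuous, fun j => ⟨HybridNS.partialD j g,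
    hasWeakPartial_of_contDiff j hg, memLp_of_continuous hU (partialD_continuous hg j)⟩⟩

/-! ### Smooth functions are dense in `H¹` of a convex set -/

theorem eLpNorm_two_sq {α : Type*} [MeasurableSpace α] (μ : Measure α) (g : α → ℝ) :
    eLpNorm g 2 μ ^ 2 = ∫⁻ x, ‖g x‖ₑ ^ 2 ∂μ := by
  have := eLpNorm_nnreal_pow_eq_lintegral (f := g) (μ := μ) (p := 2) (by norm_num)
  simpa using this

/-- The convolution of `g` with the kernel `k`, evaluated at the contracted point. -/
def contractConv (k : Pt d → ℝ) (ε : ℝ) (g : Pt d → ℝ) (x : Pt d) : ℝ :=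
  convolution g k (ContinuousLinearMap.mul ℝ ℝ) volume ((1 - ε) • x)

theorem contractConv_apply (k : Pt d → ℝ) (ε : ℝ) (g : Pt d → ℝ) (x : Pt d) :
    contractConv k ε g x = ∫ z, k ((1 - ε) • x - z) * g z := by
  rw [contractConv, convolution_def]
  exact integral_congr_ae (Eventually.of_forall fun z => mul_comm _ _)

/-- Jensen's inequality for the probability measure with density `k (y - ·)`, in the form that the
L¹ norm is at most the L² norm. -/
theorem enorm_convolution_sq_le {k : Pt d → ℝ} (hk : Continuous k) (hk0 : ∀ x, 0 ≤ k x)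
    (hki : ∫ x, k x = 1) {g : Pt d → ℝ} (hg : AEStronglyMeasurable g volume) (y : Pt d) :
    ‖∫ z, k (y - z) * g z‖ₑ ^ 2 ≤ ∫⁻ z, ENNReal.ofReal (k (y - z)) * ‖g z‖ₑ ^ 2 := by
  have h1 : ‖∫ z, k (y - z) * g z‖ₑ ≤ ∫⁻ z, ENNReal.ofReal (k (y - z)) * ‖g z‖ₑ := by
    refine (enorm_integral_le_lintegral_enorm _).trans (lintegral_mono fun z => ?_)
    rw [enorm_mul, Real.enorm_of_nonneg (hk0 _)]
  have hkint : Integrable k := integrable_of_integral_eq_one hki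
  have hk1 : ∫⁻ z, ENNReal.ofReal (k (y - z)) = 1 := by
    rw [lintegral_sub_left_eq_self (fun z => ENNReal.ofReal (k z)) y,
      ← ofReal_integral_eq_lintegral_ofReal hkint (Eventually.of_forall hk0), hki,
      ENNReal.ofReal_one]
  set μ' := (volume : Measure (Pt d)).withDensity fun z => ENNReal.ofReal (k (y - z)) with hμ'
  have hmk : Measurable fun z => ENNReal.ofReal (k (y - z)) := by fun_prop
  have hprob : IsProbabilityMeasure μ' := ⟨by rw [hμ', withDensity_apply _ MeasurableSet.univ]; simpa using hk1⟩
  have hg' : AEStronglyMeasurable g μ' := hg.mono_ac (withDensity_absolutelyContinuous _ _)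
  have h2 := eLpNorm_le_eLpNorm_of_exponent_le (μ := μ') (p := 1) (q := 2) (by norm_num) hg'
  have h3 : eLpNorm g 1 μ' = ∫⁻ z, ENNReal.ofReal (k (y - z)) * ‖g z‖ₑ := by
    rw [eLpNorm_one_eq_lintegral_enorm, hμ', lintegral_withDensity_eq_lintegral_mul₀ hmk.aemeasurable
      hg.enorm]
    rfl
  have h4 : eLpNorm g 2 μ' ^ 2 = ∫⁻ z, ENNReal.ofReal (k (y - z)) * ‖g z‖ₑ ^ 2 := by
    rw [eLpNorm_two_sq, hμ', lintegral_withDensity_eq_lintegral_mul₀ hmk.aemeasurable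
      (hg.enorm.pow_const 2)]
    rfl
  rw [← h4]
  exact pow_le_pow_left' (h1.trans (h3 ▸ h2)) 2

/-- Jensen's inequality and Tonelli's theorem reduce the bound to the mass of the kernel under the
dilation by `1 - ε`. The Jacobian is `(1 - ε)^{-d}`, at most `2 ^ d`. The constant only has to be
uniform in `ε`. -/
theorem eLpNorm_contractConv_le {k : Pt d → ℝ} (hk : Continuous k) (hk0 : ∀ x, 0 ≤ k x)
    (hki : ∫ x, k x = 1) {ε : ℝ} (hε : ε ≤ 1 / 2) {g : Pt d → ℝ}
    (hg : AEStronglyMeasurable g volume) :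
    eLpNorm (contractConv k ε g) 2 volume ≤ 2 ^ d * eLpNorm g 2 volume := by
  have hε1 : 0 < 1 - ε := by linarith
  have h1 : eLpNorm (contractConv k ε g) 2 volume ^ 2 ≤ 2 ^ d * eLpNorm g 2 volume ^ 2 := by
    have hkm : Measurable fun q : Pt d × Pt d => ENNReal.ofReal (k ((1 - ε) • q.1 - q.2)) := by
      fun_prop
    rw [eLpNorm_two_sq, eLpNorm_two_sq]
    calc ∫⁻ x, ‖contractConv k ε g x‖ₑ ^ 2
        ≤ ∫⁻ x, ∫⁻ z, ENNReal.ofReal (k ((1 - ε) • x - z)) * ‖g z‖ₑ ^ 2 := by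
          refine lintegral_mono fun x => ?_
          rw [contractConv_apply]
          exact enorm_convolution_sq_le hk hk0 hki hg _
      _ = ∫⁻ z, ∫⁻ x, ENNReal.ofReal (k ((1 - ε) • x - z)) * ‖g z‖ₑ ^ 2 := by
          refine lintegral_lintegral_swap ?_
          exact (hkm.aemeasurable).mul ((hg.enorm.pow_const 2).comp_quasiMeasurePreserving
            Measure.quasiMeasurePreserving_snd)
      _ = ∫⁻ z, ENNReal.ofReal ((1 - ε) ^ d)⁻¹ * ‖g z‖ₑ ^ 2 := by
          refine lintegral_congr fun z => ?_
          rw [lintegral_mul_const _ (by fun_prop)]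
          congr 1
          have hm := Measure.map_addHaar_smul (volume : Measure (Pt d)) hε1.ne'
          have h2 : ∫⁻ x, ENNReal.ofReal (k ((1 - ε) • x - z)) =
              ∫⁻ x, ENNReal.ofReal (k (x - z)) ∂(Measure.map ((1 - ε) • ·) volume) := by
            rw [lintegral_map (by fun_prop) (by fun_prop)]
          rw [h2, hm, lintegral_smul_measure,
            lintegral_sub_right_eq_self (fun x => ENNReal.ofReal (k x)) z,
            ← ofReal_integral_eq_lintegral_ofReal (integrable_of_integral_eq_one hki)
              (Eventually.of_forall hk0), hki, ENNReal.ofReal_one, smul_eq_mul, mul_one,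
            finrank_euclideanSpace_fin, abs_of_pos (by positivity)]
      _ ≤ ∫⁻ z, 2 ^ d * ‖g z‖ₑ ^ 2 := by
          refine lintegral_mono fun z => ?_
          gcongr
          have : ((1 - ε) ^ d)⁻¹ ≤ (2 : ℝ) ^ d := by
            rw [← inv_pow]
            refine pow_le_pow_left₀ (by positivity) ?_ d
            rw [inv_le_comm₀ hε1 (by norm_num)]
            linarith
          refine (ENNReal.ofReal_le_ofReal this).trans ?_
          rw [ENNReal.ofReal_pow (by norm_num)]
          norm_num
      _ = 2 ^ d * ∫⁻ z, ‖g z‖ₑ ^ 2 := lintegral_const_mul' _ _ (by simp)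
  -- Enlarging `2 ^ d` to its square avoids a square root in the constant.
  have h2 : (2 : ENNReal) ^ d * eLpNorm g 2 volume ^ 2 ≤ (2 ^ d * eLpNorm g 2 volume) ^ 2 := by
    rw [mul_pow]
    refine mul_le_mul' ?_ le_rfl
    rw [sq]
    exact le_mul_of_one_le_right zero_le (one_le_pow₀ one_le_two)
  exact (ENNReal.pow_le_pow_left_iff (by norm_num)).1 (h1.trans h2)

section Density

variable {U : Set (Pt d)}

theorem contractConv_contDiff {k : Pt d → ℝ} (hk : ContDiff ℝ ∞ k) (hkc : HasCompactSupport k)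
    (ε : ℝ) {g : Pt d → ℝ} (hg : LocallyIntegrable g) : ContDiff ℝ ∞ (contractConv k ε g) :=
  (hkc.contDiff_convolution_right _ hg hk).comp (contDiff_const_smul _)

theorem fderiv_contractConv {k : Pt d → ℝ} (hk : ContDiff ℝ ∞ k) (hkc : HasCompactSupport k)
    (ε : ℝ) {g : Pt d → ℝ} (hg : LocallyIntegrable g) (j : Fin d) (x : Pt d) :
    partialD j (contractConv k ε g) x =
      (1 - ε) * ∫ z, partialD j k ((1 - ε) • x - z) * g z := by
  have h1 := hkc.hasFDerivAt_convolution_right (ContinuousLinearMap.mul ℝ ℝ) hg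
    (hk.of_le (by simp)) ((1 - ε) • x)
  have h2 : HasFDerivAt (fun y : Pt d => (1 - ε) • y)
      ((1 - ε) • ContinuousLinearMap.id ℝ (Pt d)) x :=
    (hasFDerivAt_id x).const_smul (1 - ε)
  have h3 := (h1.comp x h2).fderiv
  have h4 : partialD j (contractConv k ε g) x = fderiv ℝ ((convolution g k
    (ContinuousLinearMap.mul ℝ ℝ) volume) ∘ fun y : Pt d => (1 - ε) • y) x
      (EuclideanSpace.single j 1) := rfl
  rw [h4, h3]
  simp only [ContinuousLinearMap.comp_apply, _root_.smul_apply, ContinuousLinearMap.id_apply,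
    map_smul, smul_eq_mul]
  rw [convolution_precompR_apply _ hg (hkc.fderiv ℝ) (hk.continuous_fderiv (by simp)),
    convolution_def]
  congr 1
  exact integral_congr_ae (Eventually.of_forall fun z => mul_comm _ _)

/-- By `hx`, the reflected kernel `k ((1 - ε) • x - ·)` is a test function on `U`, so the weak
derivative can be moved onto `g`. The jump of the extension by zero across the boundary of `U` is
never seen. -/
theorem partialD_contractConv_indicator (hU : IsOpen U) {k : Pt d → ℝ} (hk : ContDiff ℝ ∞ k)
    (hkc : HasCompactSupport k) (ε : ℝ) {g g' : Pt d → ℝ} {j : Fin d}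
    (hgi : LocallyIntegrable (U.indicator g)) (hg : HasWeakPartial U j g g') {x : Pt d}
    (hx : ∀ z, (1 - ε) • x - z ∈ tsupport k → z ∈ U) :
    partialD j (contractConv k ε (U.indicator g)) x =
      (1 - ε) * contractConv k ε (U.indicator g') x := by
  rw [fderiv_contractConv hk hkc ε hgi, contractConv_apply]
  congr 1
  have hφs : ContDiff ℝ ∞ fun z => k ((1 - ε) • x - z) := hk.comp (contDiff_const.sub contDiff_id)
  have ht : IsTestFunction U fun z => k ((1 - ε) • x - z) := by
    refine ⟨hφs, hkc.comp_homeomorph (Homeomorph.subLeft ((1 - ε) • x)), fun z hz => hx z ?_⟩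
    exact tsupport_comp_subset_preimage k (f := fun z => (1 - ε) • x - z) (by fun_prop) hz
  have hd : ∀ z, partialD j (fun z => k ((1 - ε) • x - z)) z = -partialD j k ((1 - ε) • x - z) := by
    intro z
    have h2 : HasFDerivAt (fun z : Pt d => (1 - ε) • x - z) (-ContinuousLinearMap.id ℝ (Pt d)) z :=
      (hasFDerivAt_id z).const_sub _
    have h3 := ((hk.differentiable (by simp) ((1 - ε) • x - z)).hasFDerivAt.comp z h2).fderiv
    have h4 : partialD j (fun z => k ((1 - ε) • x - z)) z =
      fderiv ℝ (k ∘ fun z => (1 - ε) • x - z) z (EuclideanSpace.single j 1) := rfl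
    rw [h4, h3]
    simp [partialD]
  have h1 := hg.2.2 _ ht
  simp only [hd, mul_neg, integral_neg, neg_inj] at h1
  have e : ∀ (φ f : Pt d → ℝ), ∫ z, φ z * U.indicator f z = ∫ z in U, f z * φ z := by
    intro φ f
    rw [← integral_indicator hU.measurableSet]
    refine integral_congr_ae (Eventually.of_forall fun z => ?_)
    by_cases hz : z ∈ U <;> simp [hz, mul_comm]
  rw [e (fun z => partialD j k ((1 - ε) • x - z)), e (fun z => k ((1 - ε) • x - z)), h1]

/-- The kernel is a normalized bump centred at `-ε c` with outer radius `ε r`. If `(1 - ε) x - z`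
lies in its support, then `z = (1 - ε) x + ε w` with `w` in the ball around `c`, and convexity puts
`z` in `U`. -/
theorem exists_contraction_kernel (hc : Convex ℝ U) {c : Pt d} {r : ℝ} (hr : 0 < r)
    (hball : Metric.closedBall c r ⊆ U) {ε : ℝ} (hε : 0 < ε) (hε1 : ε ≤ 1) :
    ∃ k : Pt d → ℝ, ContDiff ℝ ∞ k ∧ HasCompactSupport k ∧ (∀ x, 0 ≤ k x) ∧ ∫ x, k x = 1 ∧
      Function.support k ⊆ Metric.ball 0 (ε * (‖c‖ + r)) ∧
      ∀ x ∈ U, ∀ z, (1 - ε) • x - z ∈ tsupport k → z ∈ U := by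
  let b : ContDiffBump (-(ε • c)) := ⟨ε * r / 2, ε * r, by positivity, by
    have : 0 < ε * r := by positivity
    linarith⟩
  refine ⟨b.normed volume, b.contDiff_normed, b.hasCompactSupport_normed, b.nonneg_normed,
    b.integral_normed, ?_, ?_⟩
  · rw [b.support_normed_eq]
    refine Metric.ball_subset_ball' ?_
    rw [dist_zero_right, norm_neg, norm_smul, Real.norm_of_nonneg hε.le]
    simp only [b]
    linarith
  · intro x hx z hz
    rw [b.tsupport_normed_eq, mem_closedBall_iff_norm] at hz
    have hw : ε⁻¹ • (z - (1 - ε) • x) ∈ U := by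
      apply hball
      rw [mem_closedBall_iff_norm]
      have : ε⁻¹ • (z - (1 - ε) • x) - c = -(ε⁻¹ • ((1 - ε) • x - z - -(ε • c))) := by
        rw [← smul_neg, show -((1 - ε) • x - z - -(ε • c)) = (z - (1 - ε) • x) - ε • c by abel,
          smul_sub ε⁻¹ _ (ε • c), smul_smul, inv_mul_cancel₀ hε.ne', one_smul]
      rw [this, norm_neg, norm_smul, norm_inv, Real.norm_of_nonneg hε.le, inv_mul_le_iff₀ hε]
      exact hz
    have := hc hx hw (a := 1 - ε) (b := ε) (by linarith) hε.le (by ring)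
    rw [smul_smul, mul_inv_cancel₀ hε.ne', one_smul] at this
    simpa using this

/-- The value at `x` averages `ψ` over points at distance less than `ε (M + R')` from `x`, where
`R'` bounds `U`. Uniform continuity makes the error uniformly small, and `U` has finite measure. -/
theorem tendsto_eLpNorm_contractConv_sub_of_continuous (hU : IsOpen U) (hb : Bornology.IsBounded U) {M : ℝ}
    {ε : ℕ → ℝ} (hε0 : ∀ n, 0 < ε n) (hε : Tendsto ε atTop (𝓝 0)) {k : ℕ → Pt d → ℝ}
    (hk0 : ∀ n x, 0 ≤ k n x) (hki : ∀ n, ∫ x, k n x = 1)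
    (hks : ∀ n, Function.support (k n) ⊆ Metric.ball 0 (ε n * M)) {ψ : Pt d → ℝ}
    (hψ : Continuous ψ) (hψc : HasCompactSupport ψ) :
    Tendsto (fun n => eLpNorm (contractConv (k n) (ε n) ψ - ψ) 2 (volume.restrict U)) atTop (𝓝 0) := by
  have hfin : IsFiniteMeasure (volume.restrict U) := isFiniteMeasure_restrict.2 hb.measure_lt_top.ne
  obtain ⟨R, hR⟩ := hb.exists_norm_le
  set R' := max R 0 with hR'
  have huc := hψc.uniformContinuous_of_continuous hψ
  rw [ENNReal.tendsto_nhds_zero]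
  intro δ hδ
  obtain ⟨η, hη0, hη⟩ := ENNReal.exists_nnreal_pos_mul_lt
    (a := (volume.restrict U) univ ^ (2 : ENNReal).toReal⁻¹) (b := δ)
    (ENNReal.rpow_ne_top_of_nonneg (by simp) (measure_ne_top _ _)) hδ.ne'
  obtain ⟨ρ, hρ, hρψ⟩ := Metric.uniformContinuous_iff.1 huc η hη0
  have hlim : Tendsto (fun n => ε n * (M + R')) atTop (𝓝 0) := by
    simpa using hε.mul_const (M + R')
  filter_upwards [hlim.eventually_lt_const hρ] with n hn
  refine (eLpNorm_le_of_ae_bound (C := η) ?_).trans ((mul_comm _ _).trans_le ?_)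
  · refine ae_restrict_of_forall_mem hU.measurableSet fun x hx => ?_
    have hconv : contractConv (k n) (ε n) ψ x = convolution (k n) ψ
        (ContinuousLinearMap.lsmul ℝ ℝ) volume ((1 - ε n) • x) := by
      rw [contractConv_apply, convolution_eq_swap]; rfl
    rw [Pi.sub_apply, ← dist_eq_norm, hconv]
    refine dist_convolution_le η.2 (hks n) (hk0 n) (hki n) hψ.aestronglyMeasurable fun y hy => ?_
    refine (hρψ ?_).le
    have h1 : dist ((1 - ε n) • x) x = ε n * ‖x‖ := by
      rw [dist_eq_norm, sub_smul, one_smul, sub_sub_cancel_left, norm_neg, norm_smul,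
        Real.norm_of_nonneg (hε0 n).le]
    have h2 : ε n * ‖x‖ ≤ ε n * R' :=
      mul_le_mul_of_nonneg_left ((hR x hx).trans (le_max_left _ _)) (hε0 n).le
    calc dist y x ≤ dist y ((1 - ε n) • x) + dist ((1 - ε n) • x) x := dist_triangle _ _ _
      _ < ε n * M + ε n * R' := by rw [h1]; exact add_lt_add_of_lt_of_le hy h2
      _ = ε n * (M + R') := by ring
      _ < ρ := hn
  · simpa using hη.le

/-- Continuous functions of compact support are dense in L² and the smoothing operators are bounded
uniformly in `n`. The three parts of the error cost `2 ^ d δ'`, `δ'` and `δ'`. -/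
theorem tendsto_eLpNorm_contractConv_sub (hU : IsOpen U) (hb : Bornology.IsBounded U) {M : ℝ}
    {ε : ℕ → ℝ} (hε0 : ∀ n, 0 < ε n) (hε1 : ∀ n, ε n ≤ 1 / 2) (hε : Tendsto ε atTop (𝓝 0))
    {k : ℕ → Pt d → ℝ} (hkc : ∀ n, Continuous (k n)) (hkcs : ∀ n, HasCompactSupport (k n))
    (hk0 : ∀ n x, 0 ≤ k n x) (hki : ∀ n, ∫ x, k n x = 1)
    (hks : ∀ n, Function.support (k n) ⊆ Metric.ball 0 (ε n * M)) {g : Pt d → ℝ}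
    (hg : MemLp g 2 (volume.restrict U)) :
    Tendsto (fun n => eLpNorm (contractConv (k n) (ε n) (U.indicator g) - g) 2 (volume.restrict U))
      atTop (𝓝 0) := by
  have hG : MemLp (U.indicator g) 2 volume := (memLp_indicator_iff_restrict hU.measurableSet).2 hg
  rw [ENNReal.tendsto_nhds_zero]
  intro δ hδ
  obtain ⟨δ', hδ'0, hδ'⟩ := ENNReal.exists_nnreal_pos_mul_lt (a := 2 ^ d + 2) (b := δ)
    (by finiteness) hδ.ne'
  obtain ⟨ψ, hψc, hψ, hψcont, hψL⟩ := hG.exists_hasCompactSupport_eLpNorm_sub_le (by norm_num)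
    (ε := δ') (by exact_mod_cast hδ'0.ne')
  have h1 := ENNReal.tendsto_nhds_zero.1 (tendsto_eLpNorm_contractConv_sub_of_continuous hU hb hε0 hε
    hk0 hki hks hψcont hψc) δ' (by exact_mod_cast hδ'0)
  filter_upwards [h1] with n hn
  set S := contractConv (k n) (ε n)
  have hSsub : S (U.indicator g) - S ψ = S (U.indicator g - ψ) := by
    funext x
    simp only [S, Pi.sub_apply, contractConv_apply, mul_sub]
    rw [integral_sub]
    · exact ((hG.locallyIntegrable (by norm_num)).integrable_smul_left_of_hasCompactSupport
        (by fun_prop) ((hkcs n).comp_homeomorph (Homeomorph.subLeft ((1 - ε n) • x))))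
    · exact ((hψL.locallyIntegrable (by norm_num)).integrable_smul_left_of_hasCompactSupport
        (by fun_prop) ((hkcs n).comp_homeomorph (Homeomorph.subLeft ((1 - ε n) • x))))
  have hSc : ∀ f, LocallyIntegrable f → Continuous (S f) := fun f hf =>
    ((hkcs n).continuous_convolution_right _ hf (hkc n)).comp (continuous_const_smul _)
  have hS1 := hSc _ (hG.locallyIntegrable (by norm_num))
  have hS2 := hSc _ (hψL.locallyIntegrable (by norm_num))
  have e : S (U.indicator g) - g =
      (S (U.indicator g) - S ψ) + (S ψ - ψ) + (ψ - g) := by abel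
  have hgm := hg.aestronglyMeasurable
  have b1 : eLpNorm (S (U.indicator g) - S ψ) 2 (volume.restrict U) ≤ 2 ^ d * δ' := by
    rw [hSsub]
    refine (eLpNorm_mono_measure _ Measure.restrict_le_self).trans ?_
    refine (eLpNorm_contractConv_le (hkc n) (hk0 n) (hki n) (hε1 n)
      (hG.sub hψL).aestronglyMeasurable).trans ?_
    gcongr
  have b3 : eLpNorm (ψ - g) 2 (volume.restrict U) ≤ δ' := by
    rw [eLpNorm_sub_comm]
    refine le_trans ?_ ((eLpNorm_mono_measure _ (Measure.restrict_le_self (s := U))).trans hψ)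
    refine (eLpNorm_congr_ae ?_).le
    filter_upwards [ae_restrict_mem hU.measurableSet] with x hx
    simp [hx]
  rw [e]
  calc _ ≤ eLpNorm (S (U.indicator g) - S ψ) 2 (volume.restrict U) +
        eLpNorm (S ψ - ψ) 2 (volume.restrict U) + eLpNorm (ψ - g) 2 (volume.restrict U) :=
      (eLpNorm_add_le ((hS1.sub hS2).aestronglyMeasurable.add
        (hS2.sub hψcont).aestronglyMeasurable) (hψcont.aestronglyMeasurable.sub hgm)
        (by norm_num)).trans (add_le_add_left (eLpNorm_add_le (hS1.sub hS2).aestronglyMeasurable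
        (hS2.sub hψcont).aestronglyMeasurable (by norm_num)) _)
    _ ≤ 2 ^ d * δ' + δ' + δ' := by gcongr
    _ = δ' * (2 ^ d + 2) := by ring
    _ ≤ δ := hδ'.le

/-- Functions that are smooth up to the boundary are dense in `H¹(U)` for convex bounded `U`. -/
theorem MemH.exists_tendsto_contDiff (hU : IsOpen U) (hb : Bornology.IsBounded U)
    (hc : Convex ℝ U) (hne : U.Nonempty) {g : Pt d → ℝ} (hg : MemH 1 U g) :
    ∃ φ : ℕ → Pt d → ℝ, (∀ n, ContDiff ℝ ∞ (φ n)) ∧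
      Tendsto (fun n => eLpNorm (φ n - g) 2 (volume.restrict U)) atTop (𝓝 0) ∧
      ∀ j, Tendsto (fun n => eLpNorm (partialD j (φ n) - HybridNS.weakPartial U j g) 2
        (volume.restrict U)) atTop (𝓝 0) := by
  obtain ⟨c, hcU⟩ := hne
  obtain ⟨r, hr, hball⟩ := Metric.nhds_basis_closedBall.mem_iff.1 (hU.mem_nhds hcU)
  -- The shift by 2 keeps all `ε n` at most `1 / 2`, as the uniform L² bound requires.
  set ε : ℕ → ℝ := fun n => 1 / ((n : ℝ) + 2) with hεdef
  have hε0 : ∀ n, 0 < ε n := fun n => by positivity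
  have hε1 : ∀ n, ε n ≤ 1 / 2 := fun n => by
    have : (0 : ℝ) ≤ n := Nat.cast_nonneg n
    exact one_div_le_one_div_of_le (by norm_num) (by linarith)
  have hε : Tendsto ε atTop (𝓝 0) := by
    simp only [hεdef, one_div]
    exact tendsto_inv_atTop_zero.comp (tendsto_atTop_add_const_right _ _ tendsto_natCast_atTop_atTop)
  choose k hk hkc hk0 hki hks hkU using fun n =>
    exists_contraction_kernel hc hr hball (hε0 n) ((hε1 n).trans (by norm_num))
  have hG : ∀ f : Pt d → ℝ, MemLp f 2 (volume.restrict U) → MemLp (U.indicator f) 2 volume :=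
    fun f hf => (memLp_indicator_iff_restrict hU.measurableSet).2 hf
  have hGi : ∀ f : Pt d → ℝ, MemLp f 2 (volume.restrict U) → LocallyIntegrable (U.indicator f) :=
    fun f hf => (hG f hf).locallyIntegrable (by norm_num)
  refine ⟨fun n => contractConv (k n) (ε n) (U.indicator g),
    fun n => contractConv_contDiff (hk n) (hkc n) _ (hGi g hg.1), ?_, fun j => ?_⟩
  · exact tendsto_eLpNorm_contractConv_sub hU hb hε0 hε1 hε (fun n => (hk n).continuous) hkc hk0
      hki hks hg.1
  · obtain ⟨hw, hL⟩ := ((memH_one_iff hU).1 hg).2 j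
    set w := HybridNS.weakPartial U j g
    have h1 := tendsto_eLpNorm_contractConv_sub hU hb hε0 hε1 hε (fun n => (hk n).continuous) hkc
      hk0 hki hks hL
    have h2 : Tendsto (fun n => ENNReal.ofReal (ε n) * (2 ^ d * eLpNorm (U.indicator w) 2 volume))
        atTop (𝓝 0) := by
      have := ENNReal.Tendsto.mul_const (b := 2 ^ d * eLpNorm (U.indicator w) 2 volume)
        ((ENNReal.continuous_ofReal.tendsto 0).comp hε) (Or.inr (by
          have := (hG w hL).2.ne
          finiteness))
      simpa using this
    have h3 := h1.add h2
    rw [add_zero] at h3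
    refine tendsto_of_tendsto_of_tendsto_of_le_of_le tendsto_const_nhds h3 (fun _ => zero_le) fun n => ?_
    have hSc : Continuous (contractConv (k n) (ε n) (U.indicator w)) :=
      (contractConv_contDiff (hk n) (hkc n) _ (hGi w hL)).continuous
    -- The derivative of the smoothed function is `1 - ε n` times the smoothed derivative. The
    -- surplus term with factor `-ε n` tends to zero because the smoothing operators are uniformly
    -- bounded.
    have e : eLpNorm (partialD j (contractConv (k n) (ε n) (U.indicator g)) - w) 2
        (volume.restrict U) = eLpNorm ((contractConv (k n) (ε n) (U.indicator w) - w) +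
          (-ε n) • contractConv (k n) (ε n) (U.indicator w)) 2 (volume.restrict U) := by
      refine eLpNorm_congr_ae ?_
      filter_upwards [ae_restrict_mem hU.measurableSet] with x hx
      simp only [Pi.sub_apply, Pi.add_apply, Pi.smul_apply, smul_eq_mul]
      rw [partialD_contractConv_indicator hU (hk n) (hkc n) _ (hGi g hg.1) hw (hkU n x hx)]
      ring
    simp only [e]
    refine (eLpNorm_add_le (hSc.aestronglyMeasurable.sub hL.1) (hSc.const_smul _).aestronglyMeasurable
      (by norm_num)).trans (add_le_add_right ?_ _)
    rw [eLpNorm_const_smul, enorm_neg, Real.enorm_of_nonneg (hε0 n).le]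
    gcongr
    exact (eLpNorm_mono_measure _ Measure.restrict_le_self).trans
      (eLpNorm_contractConv_le (hk n).continuous (hk0 n) (hki n) (hε1 n)
        (hG w hL).aestronglyMeasurable)

end Density

/-! ### Traces on the facets of a simplex -/

theorem isBounded_cell (K : Finset (Pt d)) : Bornology.IsBounded (cell K) :=
  (isCompact_convexHull_finset K).isBounded.subset interior_subset

theorem convex_cell (K : Finset (Pt d)) : Convex ℝ (cell K) := (convex_convexHull ℝ _).interior

theorem IsSimplex.nonempty_cell {K : Finset (Pt d)} (hK : IsSimplex K) : (cell K).Nonempty := by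
  rw [cell, ← range_basis hK]
  exact ⟨_, hK.basis.centroid_mem_interior_convexHull⟩

theorem measurableSet_convexHull_finset (S : Finset (Pt d)) :
    MeasurableSet (convexHull ℝ (S : Set (Pt d))) :=
  (isCompact_convexHull_finset S).measurableSet

theorem ae_surf_mem (F : Finset (Pt d)) : ∀ᵐ x ∂(surf F), x ∈ convexHull ℝ (F : Set (Pt d)) :=
  ae_restrict_mem (measurableSet_convexHull_finset F)

theorem inner_normalPt_single (K : Finset (Pt d)) (a : Pt d) (j : Fin d) :
    inner ℝ (normalPt K a) (EuclideanSpace.single j 1) = normal K a j := by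
  rw [EuclideanSpace.inner_single_right]
  simp [normal]

theorem memLp_surf_of_continuous {K : Finset (Pt d)} (hK : IsSimplex K) (hd : 1 ≤ d) {a : Pt d}
    (ha : a ∈ K) {p : ENNReal} {g : Pt d → ℝ} (hg : Continuous g) :
    MemLp g p (surf (K.erase a)) := by
  have := isFiniteMeasure_surf hK hd ha
  obtain ⟨M, hM⟩ := (isCompact_convexHull_finset (K.erase a)).exists_bound_of_continuousOn
    hg.continuousOn
  refine MemLp.of_bound hg.aestronglyMeasurable M ?_
  filter_upwards [ae_surf_mem (K.erase a)] with x hx using hM x hx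

theorem continuous_apply_sub_const (j : Fin d) (c : ℝ) : ContDiff ℝ ∞ fun x : Pt d => x j - c := by
  fun_prop

/-- The trace inequality for smooth functions. -/
theorem exists_integral_sq_surf_le {K : Finset (Pt d)} (hK : IsSimplex K) (hd : 1 ≤ d) {a : Pt d}
    (ha : a ∈ K) : ∃ C : ℝ, 1 ≤ C ∧ ∀ φ : Pt d → ℝ, ContDiff ℝ ∞ φ →
      ∫ x, φ x ^ 2 ∂(surf (K.erase a)) ≤
        C * ((∫ x in cell K, φ x ^ 2) + ∑ j, ∫ x in cell K, partialD j φ x ^ 2) := by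
  obtain ⟨R, hR⟩ := (isBounded_cell K).exists_norm_le
  set R' := max R 0 + ‖a‖ with hR'
  have hR'0 : 0 ≤ R' := by positivity
  have hcoord : ∀ x ∈ cell K, ∀ j, |x j - a j| ≤ R' := by
    intro x hx j
    have h1 : ‖(x - a) j‖ ≤ ‖x - a‖ := PiLp.norm_apply_le _ _
    calc |x j - a j| = ‖(x - a) j‖ := by simp
      _ ≤ ‖x - a‖ := h1
      _ ≤ ‖x‖ + ‖a‖ := norm_sub_le _ _
      _ ≤ R' := by
        have := (hR x hx).trans (le_max_left R 0)
        linarith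
  have hg := norm_pos_iff.2 (baryGrad_ne_zero hK hd ha)
  set κ := ‖baryGrad K a‖ with hκ
  -- The first two terms come from summing the `d` coordinate bounds below. The final 1 secures `1 ≤
  -- C`, which later allows `C` to be replaced by `C²`.
  refine ⟨κ * (d * (R' + 1)) + κ * R' + 1, ?_, fun φ hφ => ?_⟩
  · have : 0 ≤ κ * (d * (R' + 1)) + κ * R' := by positivity
    linarith
  -- The divergence theorem is applied to the field `φ² (x - a)`. On facets through `a` it is
  -- tangential; on the opposite facet its normal component is `φ²` times the height `κ⁻¹` of the
  -- simplex. Only the desired boundary integral survives.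
  have hf : ∀ j : Fin d, ContDiff ℝ ∞ fun x : Pt d => φ x * φ x * (x j - a j) := fun j =>
    (hφ.mul hφ).mul (continuous_apply_sub_const j _)
  have hdx : ∀ (j : Fin d) (x : Pt d), partialD j (fun x : Pt d => x j - a j) x = 1 := by
    intro j x
    have h : HasFDerivAt (fun x : Pt d => x j - a j)
        (EuclideanSpace.proj j : Pt d →L[ℝ] ℝ) x :=
      (EuclideanSpace.proj j : Pt d →L[ℝ] ℝ).hasFDerivAt.sub_const _
    rw [partialD, h.fderiv]
    simp
  have hdf : ∀ (j : Fin d) (x : Pt d), partialD j (fun x : Pt d => φ x * φ x * (x j - a j)) x =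
      2 * φ x * partialD j φ x * (x j - a j) + φ x ^ 2 := by
    intro j x
    rw [partialD_mul (hφ.mul hφ) (continuous_apply_sub_const j _), partialD_mul hφ hφ, hdx]
    ring
  have hdiv : ∀ j : Fin d, ∫ x in cell K, partialD j (fun x : Pt d => φ x * φ x * (x j - a j)) x =
      ∑ b ∈ K, normal K b j * ∫ x, φ x * φ x * (x j - a j) ∂(surf (K.erase b)) := by
    intro j
    have := integral_fderiv_cell hK hd (hf j) (EuclideanSpace.single j 1)
    simp only [inner_normalPt_single] at this
    exact this
  have hbd : ∀ b ∈ K, ∑ j, normal K b j * ∫ x, φ x * φ x * (x j - a j) ∂(surf (K.erase b)) =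
      if b = a then κ⁻¹ * ∫ x, φ x ^ 2 ∂(surf (K.erase a)) else 0 := by
    intro b hb
    have hint : ∀ j ∈ Finset.univ, Integrable (fun x : Pt d =>
        normal K b j * (φ x * φ x * (x j - a j))) (surf (K.erase b)) := fun j _ =>
      (memLp_one_iff_integrable.1 (memLp_surf_of_continuous hK hd hb (hf j).continuous)).const_mul _
    simp_rw [← integral_const_mul]
    rw [← integral_finsetSum _ hint]
    have hin : ∀ x : Pt d, ∑ j, normal K b j * (φ x * φ x * (x j - a j)) =
        φ x ^ 2 * -(‖baryGrad K b‖⁻¹ * (bary K b x - bary K b a)) := by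
      intro x
      rw [← baryL_sub, ← inner_normalPt hK hd hb, EuclideanSpace.inner_eq_star_dotProduct]
      simp only [dotProduct, Finset.mul_sum]
      refine Finset.sum_congr rfl fun j _ => ?_
      simp [normal]
      ring
    simp_rw [hin]
    have hz : ∀ᵐ x ∂(surf (K.erase b)), bary K b x = 0 := by
      filter_upwards [ae_surf_mem (K.erase b)] with x hx using ((mem_facet_iff hK hb).1 hx).1
    split_ifs with hba
    · subst hba
      refine integral_congr_ae ?_
      filter_upwards [hz] with x hx
      rw [hx, bary_self hK hb]
      ring
    · rw [← integral_zero (Pt d) ℝ (μ := surf (K.erase b))]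
      refine integral_congr_ae ?_
      filter_upwards [hz] with x hx
      rw [hx, bary_ne hK hb ha hba]
      ring
  have hsum : ∑ j, ∫ x in cell K, partialD j (fun x : Pt d => φ x * φ x * (x j - a j)) x =
      κ⁻¹ * ∫ x, φ x ^ 2 ∂(surf (K.erase a)) := by
    simp_rw [hdiv]
    rw [Finset.sum_comm, Finset.sum_congr rfl hbd, Finset.sum_ite_eq' K a, if_pos ha]
  have hintK : ∀ ψ : Pt d → ℝ, Continuous ψ → IntegrableOn ψ (cell K) := fun ψ hψ =>
    memLp_one_iff_integrable.1 (memLp_of_continuous (isBounded_cell K) hψ)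
  have hle : ∀ j : Fin d, ∫ x in cell K, partialD j (fun x : Pt d => φ x * φ x * (x j - a j)) x ≤
      (R' + 1) * (∫ x in cell K, φ x ^ 2) + R' * ∫ x in cell K, partialD j φ x ^ 2 := by
    intro j
    have hc1 : Continuous fun x => φ x ^ 2 := hφ.continuous.pow 2
    have hc2 : Continuous fun x => partialD j φ x ^ 2 := (partialD_continuous hφ j).pow 2
    rw [← integral_const_mul, ← integral_const_mul, ← integral_add
      ((hintK _ hc1).const_mul _) ((hintK _ hc2).const_mul _)]
    refine setIntegral_mono_on (hintK _ (partialD_continuous (hf j) j))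
      (((hintK _ hc1).const_mul _).add ((hintK _ hc2).const_mul _)) (isOpen_cell K).measurableSet
      fun x hx => ?_
    rw [hdf]
    have h1 := hcoord x hx j
    have h2 : 2 * φ x * partialD j φ x * (x j - a j) ≤
        2 * |φ x| * |partialD j φ x| * R' := by
      refine (le_abs_self _).trans ?_
      rw [abs_mul, abs_mul, abs_mul, abs_two]
      gcongr
    have h3 : 2 * |φ x| * |partialD j φ x| ≤ φ x ^ 2 + partialD j φ x ^ 2 := by
      have := two_mul_le_add_sq |φ x| |partialD j φ x|
      rwa [sq_abs, sq_abs] at this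
    have h4 := mul_le_mul_of_nonneg_right h3 hR'0
    linarith
  have htot := Finset.sum_le_sum fun j (_ : j ∈ Finset.univ) => hle j
  rw [hsum, Finset.sum_add_distrib, Finset.sum_const, Finset.card_univ, Fintype.card_fin,
    ← Finset.mul_sum, nsmul_eq_mul] at htot
  have h0 : 0 ≤ ∫ x in cell K, φ x ^ 2 := integral_nonneg fun x => sq_nonneg _
  have h0' : 0 ≤ ∑ j, ∫ x in cell K, partialD j φ x ^ 2 :=
    Finset.sum_nonneg fun j _ => integral_nonneg fun x => sq_nonneg _
  rw [inv_mul_le_iff₀ hg] at htot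
  have e1 : 0 ≤ κ * R' * (∫ x in cell K, φ x ^ 2) := by positivity
  have e2 : 0 ≤ κ * (d * (R' + 1)) * ∑ j, ∫ x in cell K, partialD j φ x ^ 2 := by positivity
  nlinarith [htot, e1, e2, h0, h0']

theorem eLpNorm_two_sq_eq_ofReal {α : Type*} [MeasurableSpace α] {μ : Measure α} {g : α → ℝ}
    (hg : MemLp g 2 μ) : eLpNorm g 2 μ ^ 2 = ENNReal.ofReal (∫ x, g x ^ 2 ∂μ) := by
  rw [eLpNorm_two_sq, ofReal_integral_eq_lintegral_ofReal hg.integrable_sq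
    (Eventually.of_forall fun x => sq_nonneg _)]
  refine lintegral_congr fun x => ?_
  rw [← ofReal_norm, ← ENNReal.ofReal_pow (norm_nonneg _), Real.norm_eq_abs, sq_abs]

/-- The trace inequality in terms of `L²` norms. -/
theorem exists_eLpNorm_surf_le {K : Finset (Pt d)} (hK : IsSimplex K) (hd : 1 ≤ d) {a : Pt d}
    (ha : a ∈ K) : ∃ C : ENNReal, C ≠ ⊤ ∧ ∀ φ : Pt d → ℝ, ContDiff ℝ ∞ φ →
      eLpNorm φ 2 (surf (K.erase a)) ≤
        C * (eLpNorm φ 2 (volume.restrict (cell K)) +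
          ∑ j, eLpNorm (partialD j φ) 2 (volume.restrict (cell K))) := by
  obtain ⟨C, hC1, hC⟩ := exists_integral_sq_surf_le hK hd ha
  refine ⟨ENNReal.ofReal C, ENNReal.ofReal_ne_top, fun φ hφ => ?_⟩
  have hφK : MemLp φ 2 (volume.restrict (cell K)) :=
    memLp_of_continuous (isBounded_cell K) hφ.continuous
  have hφj : ∀ j, MemLp (partialD j φ) 2 (volume.restrict (cell K)) := fun j =>
    memLp_of_continuous (isBounded_cell K) (partialD_continuous hφ j)
  have hφF : MemLp φ 2 (surf (K.erase a)) := memLp_surf_of_continuous hK hd ha hφ.continuous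
  set A := eLpNorm φ 2 (volume.restrict (cell K)) with hA
  set B := fun j => eLpNorm (partialD j φ) 2 (volume.restrict (cell K)) with hB
  have h1 : eLpNorm φ 2 (surf (K.erase a)) ^ 2 ≤ ENNReal.ofReal C * (A ^ 2 + ∑ j, B j ^ 2) := by
    have h0 : 0 ≤ ∫ x in cell K, φ x ^ 2 := integral_nonneg fun x => sq_nonneg _
    have h0' : ∀ j ∈ Finset.univ, 0 ≤ ∫ x in cell K, partialD j φ x ^ 2 := fun j _ =>
      integral_nonneg fun x => sq_nonneg _
    simp only [hA, hB]
    simp_rw [eLpNorm_two_sq_eq_ofReal hφF, eLpNorm_two_sq_eq_ofReal hφK,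
      fun j => eLpNorm_two_sq_eq_ofReal (hφj j)]
    rw [← ENNReal.ofReal_sum_of_nonneg h0', ← ENNReal.ofReal_add h0 (Finset.sum_nonneg h0'),
      ← ENNReal.ofReal_mul (by linarith)]
    exact ENNReal.ofReal_le_ofReal (hC φ hφ)
  have h2 : ∑ j, B j ^ 2 ≤ (∑ j, B j) ^ 2 := by
    rw [sq, Finset.sum_mul]
    refine Finset.sum_le_sum fun j hj => ?_
    rw [sq]
    gcongr
    exact Finset.single_le_sum (f := B) (fun _ _ => zero_le) hj
  have h3 : A ^ 2 + (∑ j, B j) ^ 2 ≤ (A + ∑ j, B j) ^ 2 := by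
    rw [add_sq]
    exact add_le_add_left (le_self_add) _
  have h4 : ENNReal.ofReal C ≤ ENNReal.ofReal C ^ 2 := by
    rw [sq]
    exact le_mul_of_one_le_right zero_le (by simpa using hC1)
  refine (ENNReal.pow_le_pow_left_iff (n := 2) (by norm_num)).1 ?_
  rw [mul_pow]
  exact h1.trans (mul_le_mul' h4 ((add_le_add_right h2 _).trans h3))

/-- The smooth functions `φ n` converge to `g` in `H¹` of the cell `K`. -/
def TendstoH1 (K : Finset (Pt d)) (φ : ℕ → Pt d → ℝ) (g : Pt d → ℝ) : Prop :=
  (∀ n, ContDiff ℝ ∞ (φ n)) ∧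
    Tendsto (fun n => eLpNorm (φ n - g) 2 (volume.restrict (cell K))) atTop (𝓝 0) ∧
    ∀ j, Tendsto (fun n => eLpNorm (partialD j (φ n) - weakPartial (cell K) j g) 2
      (volume.restrict (cell K))) atTop (𝓝 0)

theorem tendsto_eLpNorm_sub_sub {α ι κ : Type*} [MeasurableSpace α] {μ : Measure α} {l : Filter ι}
    {l' : Filter κ} {f : ι → α → ℝ} {f' : κ → α → ℝ} {g : α → ℝ}
    (hf : ∀ n, AEStronglyMeasurable (f n) μ) (hf' : ∀ n, AEStronglyMeasurable (f' n) μ)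
    (hg : AEStronglyMeasurable g μ)
    (h : Tendsto (fun n => eLpNorm (f n - g) 2 μ) l (𝓝 0))
    (h' : Tendsto (fun n => eLpNorm (f' n - g) 2 μ) l' (𝓝 0)) :
    Tendsto (fun p : ι × κ => eLpNorm (f p.1 - f' p.2) 2 μ) (l ×ˢ l') (𝓝 0) := by
  have h1 := (h.comp tendsto_fst).add (h'.comp (tendsto_snd (f := l)))
  rw [add_zero] at h1
  refine tendsto_of_tendsto_of_tendsto_of_le_of_le tendsto_const_nhds h1 (fun _ => zero_le)
    fun p => ?_
  have e : f p.1 - f' p.2 = (f p.1 - g) - (f' p.2 - g) := by abel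
  simp only [e, Function.comp]
  exact eLpNorm_sub_le ((hf _).sub hg) ((hf' _).sub hg) (by norm_num)

section Trace

variable {K : Finset (Pt d)} (hK : IsSimplex K) (hd : 1 ≤ d) {a : Pt d} (ha : a ∈ K)
include hK hd ha

/-- The trace inequality for the differences. With `ψ = φ` this is the Cauchy property behind the
existence of traces; with different sequences it is the independence of the trace from the
approximation. -/
theorem TendstoH1.tendsto_surf_sub {φ ψ : ℕ → Pt d → ℝ} {g : Pt d → ℝ} (hg : MemH 1 (cell K) g)
    (hφ : TendstoH1 K φ g) (hψ : TendstoH1 K ψ g) :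
    Tendsto (fun p : ℕ × ℕ => eLpNorm (φ p.1 - ψ p.2) 2 (surf (K.erase a))) (atTop ×ˢ atTop)
      (𝓝 0) := by
  obtain ⟨C, hC, hCle⟩ := exists_eLpNorm_surf_le hK hd ha
  have hm := (memH_one_iff (isOpen_cell K)).1 hg
  have h1 := tendsto_eLpNorm_sub_sub (fun n => (hφ.1 n).continuous.aestronglyMeasurable)
    (fun n => (hψ.1 n).continuous.aestronglyMeasurable) hg.1.aestronglyMeasurable hφ.2.1 hψ.2.1
  have h2 := fun j => tendsto_eLpNorm_sub_sub
    (fun n => (partialD_continuous (hφ.1 n) j).aestronglyMeasurable)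
    (fun n => (partialD_continuous (hψ.1 n) j).aestronglyMeasurable)
    (hm.2 j).2.aestronglyMeasurable (hφ.2.2 j) (hψ.2.2 j)
  have h3 := ENNReal.Tendsto.const_mul (a := C)
    (h1.add (tendsto_finsetSum Finset.univ fun j _ => h2 j)) (Or.inr hC)
  rw [Finset.sum_const_zero, add_zero, mul_zero] at h3
  refine tendsto_of_tendsto_of_tendsto_of_le_of_le tendsto_const_nhds h3 (fun _ => zero_le)
    fun p => ?_
  refine (hCle _ ((hφ.1 p.1).sub (hψ.1 p.2))).trans_eq ?_
  congr 2
  refine Finset.sum_congr rfl fun j _ => ?_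
  congr 1
  funext x
  simp only [partialD, Pi.sub_apply]
  rw [fderiv_fun_sub ((hφ.1 p.1).differentiable (by simp) x) ((hψ.1 p.2).differentiable (by simp) x)]
  rfl

omit hd ha in
theorem exists_tendstoH1 {g : Pt d → ℝ} (hg : MemH 1 (cell K) g) :
    ∃ φ : ℕ → Pt d → ℝ, TendstoH1 K φ g :=
  hg.exists_tendsto_contDiff (isOpen_cell K) (isBounded_cell K) (convex_cell K) hK.nonempty_cell

theorem exists_isTrace {g : Pt d → ℝ} (hg : MemH 1 (cell K) g) :
    ∃ τ, IsTrace K (K.erase a) g τ := by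
  obtain ⟨φ, hφ⟩ := exists_tendstoH1 hK hg
  have h1 := hφ.tendsto_surf_sub hK hd ha hg hφ
  have hL : ∀ n, MemLp (φ n) 2 (surf (K.erase a)) := fun n =>
    memLp_surf_of_continuous hK hd ha (hφ.1 n).continuous
  have hcau : CauchySeq fun n => (hL n).toLp (φ n) := by
    rw [Lp.cauchySeq_Lp_iff_cauchySeq_eLpNorm, ← prod_atTop_atTop_eq]
    refine h1.congr fun p => eLpNorm_congr_ae ?_
    filter_upwards [(hL p.1).coeFn_toLp, (hL p.2).coeFn_toLp] with x h1 h2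
    simp [h1, h2]
  obtain ⟨τ, hτ⟩ := cauchySeq_tendsto_of_complete hcau
  refine ⟨τ, hg, Lp.memLp τ, φ, hφ.1, hφ.2.1, hφ.2.2, ?_⟩
  rw [Lp.tendsto_Lp_iff_tendsto_eLpNorm'] at hτ
  refine hτ.congr fun n => eLpNorm_congr_ae ?_
  filter_upwards [(hL n).coeFn_toLp] with x h1
  simp [h1]

theorem isTrace_trace {g : Pt d → ℝ} (hg : MemH 1 (cell K) g) :
    IsTrace K (K.erase a) g (trace K (K.erase a) g) := by
  have h := exists_isTrace hK hd ha hg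
  rw [trace, dif_pos h]
  exact h.choose_spec

theorem memLp_trace {g : Pt d → ℝ} (hg : MemH 1 (cell K) g) :
    MemLp (trace K (K.erase a) g) 2 (surf (K.erase a)) :=
  (isTrace_trace hK hd ha hg).2.1

/-- The definition of a trace supplies one approximating sequence; here every sequence is admitted,
so one sequence can serve for all facets of the cell at once. -/
theorem TendstoH1.tendsto_trace {g : Pt d → ℝ} (hg : MemH 1 (cell K) g) {φ : ℕ → Pt d → ℝ}
    (hφ : TendstoH1 K φ g) :
    Tendsto (fun n => eLpNorm (φ n - trace K (K.erase a) g) 2 (surf (K.erase a))) atTop (𝓝 0) := by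
  obtain ⟨_, hτ, ψ, hψ, h0, h1, h2⟩ := isTrace_trace hK hd ha hg
  have h3 := (hφ.tendsto_surf_sub hK hd ha hg ⟨hψ, h0, h1⟩).comp
    (tendsto_id.prodMk tendsto_id (f := atTop (α := ℕ)))
  have h4 := h3.add h2
  rw [add_zero] at h4
  refine tendsto_of_tendsto_of_tendsto_of_le_of_le tendsto_const_nhds h4 (fun _ => zero_le)
    fun n => ?_
  have e : φ n - trace K (K.erase a) g = (φ n - ψ n) + (ψ n - trace K (K.erase a) g) := by abel
  simp only [e, Function.comp]
  exact eLpNorm_add_le ((hφ.1 n).continuous.sub (hψ n).continuous).aestronglyMeasurable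
    ((hψ n).continuous.aestronglyMeasurable.sub hτ.aestronglyMeasurable) (by norm_num)

theorem IsTrace.trace_ae_eq {g τ : Pt d → ℝ} (h : IsTrace K (K.erase a) g τ) :
    trace K (K.erase a) g =ᵐ[surf (K.erase a)] τ := by
  obtain ⟨hg, hτ, ψ, hψ, h0, h1, h2⟩ := h
  have h3 := TendstoH1.tendsto_trace hK hd ha hg ⟨hψ, h0, h1⟩
  have ht := memLp_trace hK hd ha hg
  have h4 : Tendsto (fun _ : ℕ => eLpNorm (trace K (K.erase a) g - τ) 2 (surf (K.erase a)))
      atTop (𝓝 0) := by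
    have h5 := h3.add h2
    rw [add_zero] at h5
    refine tendsto_of_tendsto_of_tendsto_of_le_of_le tendsto_const_nhds h5 (fun _ => zero_le)
      fun n => ?_
    have e : trace K (K.erase a) g - τ = (ψ n - τ) - (ψ n - trace K (K.erase a) g) := by abel
    simp only [e]
    refine (eLpNorm_sub_le ((hψ n).continuous.aestronglyMeasurable.sub hτ.aestronglyMeasurable)
      ((hψ n).continuous.aestronglyMeasurable.sub ht.aestronglyMeasurable) (by norm_num)).trans_eq
      (add_comm _ _)
  have h5 := tendsto_nhds_unique h4 tendsto_const_nhds
  have h6 := (eLpNorm_eq_zero_iff (ht.sub hτ).aestronglyMeasurable (by norm_num)).1 h5.symm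
  filter_upwards [h6] with x hx
  exact sub_eq_zero.1 hx

theorem trace_congr {g k : Pt d → ℝ} (hg : MemH 1 (cell K) g)
    (h : g =ᵐ[volume.restrict (cell K)] k) :
    trace K (K.erase a) g =ᵐ[surf (K.erase a)] trace K (K.erase a) k := by
  have hk := hg.congr h
  obtain ⟨_, hτ, ψ, hψ, h0, h1, h2⟩ := isTrace_trace hK hd ha hk
  refine IsTrace.trace_ae_eq hK hd ha ⟨hg, hτ, ψ, hψ, ?_, fun j => ?_, h2⟩
  · refine h0.congr fun n => eLpNorm_congr_ae ?_
    filter_upwards [h] with x hx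
    simp [hx]
  · refine (h1 j).congr fun n => eLpNorm_congr_ae ?_
    have := ((hg.hasWeakPartial j).congr h (EventuallyEq.refl _ _)).weakPartial_ae_eq
      (isOpen_cell K)
    filter_upwards [this] with x hx
    simp [hx]

theorem trace_ae_eq_of_contDiff {g w : Pt d → ℝ} (hw : ContDiff ℝ ∞ w)
    (h : g =ᵐ[volume.restrict (cell K)] w) :
    trace K (K.erase a) g =ᵐ[surf (K.erase a)] w := by
  have hwH := memH_one_of_contDiff (isBounded_cell K) hw
  refine (trace_congr hK hd ha (hwH.congr h.symm) h).trans (IsTrace.trace_ae_eq hK hd ha ?_)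
  refine ⟨hwH, memLp_surf_of_continuous hK hd ha hw.continuous, fun _ => w, fun _ => hw, ?_,
    fun j => ?_, ?_⟩
  · simp
  · have h1 : eLpNorm (partialD j w - weakPartial (cell K) j w) 2 (volume.restrict (cell K)) = 0 := by
      refine (eLpNorm_congr_ae (g := 0) ?_).trans eLpNorm_zero
      filter_upwards [(hasWeakPartial_of_contDiff j hw).weakPartial_ae_eq (isOpen_cell K)] with x hx
      simp [hx]
    simp [h1]
  · simp

end Trace

/-! ### Green's formula -/

/-- Continuity of the inner product of L². -/
theorem tendsto_integral_mul_of_eLpNorm {α : Type*} [MeasurableSpace α] {μ : Measure α}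
    {f g : ℕ → α → ℝ} {f₀ g₀ : α → ℝ} (hf : ∀ n, MemLp (f n) 2 μ) (hg : ∀ n, MemLp (g n) 2 μ)
    (hf₀ : MemLp f₀ 2 μ) (hg₀ : MemLp g₀ 2 μ)
    (h : Tendsto (fun n => eLpNorm (f n - f₀) 2 μ) atTop (𝓝 0))
    (h' : Tendsto (fun n => eLpNorm (g n - g₀) 2 μ) atTop (𝓝 0)) :
    Tendsto (fun n => ∫ x, f n x * g n x ∂μ) atTop (𝓝 (∫ x, f₀ x * g₀ x ∂μ)) := by
  have e : ∀ {u v : α → ℝ} (hu : MemLp u 2 μ) (hv : MemLp v 2 μ),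
      inner ℝ (hu.toLp u) (hv.toLp v) = ∫ x, u x * v x ∂μ := by
    intro u v hu hv
    rw [L2.inner_def]
    refine integral_congr_ae ?_
    filter_upwards [hu.coeFn_toLp, hv.coeFn_toLp] with x h1 h2
    rw [h1, h2, real_inner_comm]
    rfl
  have h1 := (Lp.tendsto_Lp_iff_tendsto_eLpNorm'' f hf f₀ hf₀).2 h
  have h2 := (Lp.tendsto_Lp_iff_tendsto_eLpNorm'' g hg g₀ hg₀).2 h'
  have h3 := h1.inner (𝕜 := ℝ) h2
  simpa only [e] using h3

theorem memLp_mul_bounded {α : Type*} [MeasurableSpace α] {μ : Measure α} {f w : α → ℝ} {M : ℝ}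
    (hf : MemLp f 2 μ) (hw : AEStronglyMeasurable w μ) (hM : ∀ᵐ x ∂μ, ‖w x‖ ≤ M) :
    MemLp (fun x => f x * w x) 2 μ := by
  refine MemLp.of_le_mul (c := M) hf (hf.aestronglyMeasurable.mul hw) ?_
  filter_upwards [hM] with x hx
  rw [norm_mul, mul_comm]
  gcongr

theorem tendsto_integral_mul_mul_of_eLpNorm {α : Type*} [MeasurableSpace α] {μ : Measure α}
    {f g : ℕ → α → ℝ} {f₀ g₀ w : α → ℝ} {M : ℝ} (hf : ∀ n, MemLp (f n) 2 μ)
    (hg : ∀ n, MemLp (g n) 2 μ) (hf₀ : MemLp f₀ 2 μ) (hg₀ : MemLp g₀ 2 μ)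
    (hw : AEStronglyMeasurable w μ) (hM : ∀ᵐ x ∂μ, ‖w x‖ ≤ M)
    (h : Tendsto (fun n => eLpNorm (f n - f₀) 2 μ) atTop (𝓝 0))
    (h' : Tendsto (fun n => eLpNorm (g n - g₀) 2 μ) atTop (𝓝 0)) :
    Tendsto (fun n => ∫ x, f n x * g n x * w x ∂μ) atTop (𝓝 (∫ x, f₀ x * g₀ x * w x ∂μ)) := by
  have h2 := tendsto_integral_mul_of_eLpNorm hf (fun n => memLp_mul_bounded (hg n) hw hM) hf₀
    (memLp_mul_bounded hg₀ hw hM) h ?_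
  · simpa only [mul_assoc] using h2
  · have h3 := ENNReal.Tendsto.const_mul (a := ENNReal.ofReal M) h' (Or.inr ENNReal.ofReal_ne_top)
    rw [mul_zero] at h3
    refine tendsto_of_tendsto_of_tendsto_of_le_of_le tendsto_const_nhds h3 (fun _ => zero_le)
      fun n => ?_
    refine eLpNorm_le_mul_eLpNorm_of_ae_le_mul ?_ 2
    filter_upwards [hM] with x hx
    simp only [Pi.sub_apply]
    rw [← sub_mul, norm_mul, mul_comm]
    gcongr

theorem exists_bound_cell (K : Finset (Pt d)) {w : Pt d → ℝ} (hw : Continuous w) :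
    ∃ M, ∀ᵐ x ∂(volume.restrict (cell K)), ‖w x‖ ≤ M := by
  obtain ⟨M, hM⟩ := (isCompact_convexHull_finset K).exists_bound_of_continuousOn hw.continuousOn
  exact ⟨M, ae_restrict_of_forall_mem (isOpen_cell K).measurableSet
    fun x hx => hM x (interior_subset hx)⟩

theorem exists_bound_surf (F : Finset (Pt d)) {w : Pt d → ℝ} (hw : Continuous w) :
    ∃ M, ∀ᵐ x ∂(surf F), ‖w x‖ ≤ M := by
  obtain ⟨M, hM⟩ := (isCompact_convexHull_finset F).exists_bound_of_continuousOn hw.continuousOn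
  refine ⟨M, ?_⟩
  filter_upwards [ae_surf_mem F] with x hx using hM x hx

theorem integrable_mul_mul {α : Type*} [MeasurableSpace α] {μ : Measure α} {f g w : α → ℝ} {M : ℝ}
    (hf : MemLp f 2 μ) (hg : MemLp g 2 μ) (hw : AEStronglyMeasurable w μ)
    (hM : ∀ᵐ x ∂μ, ‖w x‖ ≤ M) : Integrable (fun x => f x * g x * w x) μ := by
  have h := hf.integrable_mul (memLp_mul_bounded hg hw hM)
  refine h.congr (Eventually.of_forall fun x => ?_)
  simp only [Pi.mul_apply, mul_assoc]

theorem integrable_cell_mul_mul {K : Finset (Pt d)} {f g w : Pt d → ℝ}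
    (hf : MemLp f 2 (volume.restrict (cell K))) (hg : MemLp g 2 (volume.restrict (cell K)))
    (hw : Continuous w) : IntegrableOn (fun x => f x * g x * w x) (cell K) := by
  obtain ⟨M, hM⟩ := exists_bound_cell K hw
  exact integrable_mul_mul hf hg hw.aestronglyMeasurable hM

/-- **Green's formula** on a simplex for the product of two `H¹` functions and a smooth function. -/
theorem green {K : Finset (Pt d)} (hK : IsSimplex K) (hd : 1 ≤ d) {g h w : Pt d → ℝ}
    (hg : MemH 1 (cell K) g) (hh : MemH 1 (cell K) h) (hw : ContDiff ℝ ∞ w) (j : Fin d) :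
    (∫ x in cell K, weakPartial (cell K) j g x * h x * w x) +
      (∫ x in cell K, g x * weakPartial (cell K) j h x * w x) +
      (∫ x in cell K, g x * h x * partialD j w x) =
    ∑ a ∈ K, normal K a j * ∫ x, trace K (K.erase a) g x * trace K (K.erase a) h x * w x
      ∂(surf (K.erase a)) := by
  obtain ⟨φ, hφ⟩ := exists_tendstoH1 hK hg
  obtain ⟨ψ, hψ⟩ := exists_tendstoH1 hK hh
  have hwc := hw.continuous
  have hwj := partialD_continuous hw j
  obtain ⟨M, hM⟩ := exists_bound_cell K hwc
  obtain ⟨M', hM'⟩ := exists_bound_cell K hwj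
  have hgm := (memH_one_iff (isOpen_cell K)).1 hg
  have hhm := (memH_one_iff (isOpen_cell K)).1 hh
  have hc : ∀ f : Pt d → ℝ, Continuous f → MemLp f 2 (volume.restrict (cell K)) := fun f hf =>
    memLp_of_continuous (isBounded_cell K) hf
  have l1 := tendsto_integral_mul_mul_of_eLpNorm
    (fun n => hc _ (partialD_continuous (hφ.1 n) j)) (fun n => hc _ (hψ.1 n).continuous)
    (hgm.2 j).2 hhm.1 hwc.aestronglyMeasurable hM (hφ.2.2 j) hψ.2.1
  have l2 := tendsto_integral_mul_mul_of_eLpNorm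
    (fun n => hc _ (hφ.1 n).continuous) (fun n => hc _ (partialD_continuous (hψ.1 n) j))
    hgm.1 (hhm.2 j).2 hwc.aestronglyMeasurable hM hφ.2.1 (hψ.2.2 j)
  have l3 := tendsto_integral_mul_mul_of_eLpNorm
    (fun n => hc _ (hφ.1 n).continuous) (fun n => hc _ (hψ.1 n).continuous)
    hgm.1 hhm.1 hwj.aestronglyMeasurable hM' hφ.2.1 hψ.2.1
  have r : Tendsto (fun n => ∑ a ∈ K, normal K a j * ∫ x, φ n x * ψ n x * w x
      ∂(surf (K.erase a))) atTop (𝓝 (∑ a ∈ K, normal K a j * ∫ x, trace K (K.erase a) g x *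
        trace K (K.erase a) h x * w x ∂(surf (K.erase a)))) := by
    refine tendsto_finsetSum _ fun a ha => Tendsto.const_mul _ ?_
    obtain ⟨M'', hM''⟩ := exists_bound_surf (K.erase a) hwc
    exact tendsto_integral_mul_mul_of_eLpNorm
      (fun n => memLp_surf_of_continuous hK hd ha (hφ.1 n).continuous)
      (fun n => memLp_surf_of_continuous hK hd ha (hψ.1 n).continuous)
      (memLp_trace hK hd ha hg) (memLp_trace hK hd ha hh) hwc.aestronglyMeasurable hM''
      (hφ.tendsto_trace hK hd ha hg) (hψ.tendsto_trace hK hd ha hh)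
  -- Both sides are limits of the two sides of the divergence theorem for the smooth function `φ n *
  -- ψ n * w`.
  refine tendsto_nhds_unique ((l1.add l2).add l3) (r.congr fun n => ?_)
  have hp : ContDiff ℝ ∞ fun x => φ n x * ψ n x * w x := ((hφ.1 n).mul (hψ.1 n)).mul hw
  have hdiv := integral_fderiv_cell hK hd hp (EuclideanSpace.single j 1)
  simp only [inner_normalPt_single] at hdiv
  have i1 := integrable_cell_mul_mul (hc _ (partialD_continuous (hφ.1 n) j))
    (hc _ (hψ.1 n).continuous) hwc
  have i2 := integrable_cell_mul_mul (hc _ (hφ.1 n).continuous)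
    (hc _ (partialD_continuous (hψ.1 n) j)) hwc
  have i3 := integrable_cell_mul_mul (hc _ (hφ.1 n).continuous) (hc _ (hψ.1 n).continuous) hwj
  rw [← hdiv, ← integral_add i1 i2, ← integral_add (f := fun x => partialD j (φ n) x * ψ n x * w x +
    φ n x * partialD j (ψ n) x * w x) (i1.add i2) i3]
  refine integral_congr_ae (Eventually.of_forall fun x => ?_)
  have := partialD_mul ((hφ.1 n).mul (hψ.1 n)) hw j x
  rw [partialD_mul (hφ.1 n) (hψ.1 n)] at this
  simp only [partialD] at this ⊢
  rw [this]
  ring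

/-! ### Geometry of triangulations -/

section TwoSimplices

theorem bary_apply (K : Finset (Pt d)) (a x : Pt d) : bary K a x = baryL K a x + bary K a 0 := by
  have := baryL_sub K a x 0
  rw [sub_zero] at this
  linarith

theorem bary_sum_smul (K : Finset (Pt d)) (a : Pt d) {S : Finset (Pt d)} {w : Pt d → ℝ}
    (hw : ∑ b ∈ S, w b = 1) : bary K a (∑ b ∈ S, w b • b) = ∑ b ∈ S, w b * bary K a b := by
  have h : ∀ b, w b * bary K a b = w b * baryL K a b + w b * bary K a 0 := fun b => by
    rw [bary_apply K a b, mul_add]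
  rw [bary_apply K a (∑ b ∈ S, w b • b), map_sum, Finset.sum_congr rfl fun b _ => h b,
    Finset.sum_add_distrib, ← Finset.sum_mul, hw, one_mul]
  simp only [map_smul, smul_eq_mul]

variable {K K' : Finset (Pt d)} (hK : IsSimplex K) (hK' : IsSimplex K') {a a' : Pt d}
  (ha : a ∈ K) (ha' : a' ∈ K') (h : K.erase a = K'.erase a')
include hK hK' ha ha' h

/-- The barycentric coordinates of two simplices with a common facet are proportional. -/
theorem bary_opposite_eq (x : Pt d) : bary K' a' x = bary K' a' a * bary K a x := by
  conv_lhs => rw [← sum_bary_smul hK x]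
  rw [bary_sum_smul K' a' (sum_bary hK x), ← Finset.add_sum_erase K _ ha, Finset.sum_eq_zero, add_zero,
    mul_comm]
  intro b hb
  rw [h] at hb
  rw [bary_ne hK' ha' (Finset.mem_of_mem_erase hb) (Finset.ne_of_mem_erase hb).symm, mul_zero]

omit ha' in
-- On the facet the weight of `a` is zero, and all remaining vertices of `K` are shared with `K'`.
theorem bary_eq_of_mem_facet {x : Pt d}
    (hx : bary K a x = 0) {b : Pt d} (hb : b ∈ K.erase a) : bary K' b x = bary K b x := by
  conv_lhs => rw [← sum_bary_smul hK x]
  have hb' := hb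
  rw [h] at hb'
  rw [bary_sum_smul K' b (sum_bary hK x), ← Finset.add_sum_erase K _ ha, hx, zero_mul, zero_add,
    Finset.sum_eq_single b]
  · rw [bary_self hK' (Finset.mem_of_mem_erase hb'), mul_one]
  · intro c hc hcb
    rw [h] at hc
    rw [bary_ne hK' (Finset.mem_of_mem_erase hb') (Finset.mem_of_mem_erase hc) hcb.symm, mul_zero]
  · exact fun hn => absurd hb hn

/-- The coordinates of the two opposite vertices are proportional with a negative factor, so their
gradients point in opposite directions, and so do the unit normals. -/
theorem normal_eq_neg_of_neg (hd : 1 ≤ d) (hneg : bary K' a' a < 0) :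
    normal K' a' = -normal K a := by
  have hL : baryL K' a' = bary K' a' a • baryL K a := by
    ext v
    have h1 := baryL_sub K' a' v 0
    have h2 := baryL_sub K a v 0
    rw [sub_zero] at h1 h2
    rw [h1, bary_opposite_eq hK hK' ha ha' h v, bary_opposite_eq hK hK' ha ha' h 0, _root_.smul_apply,
      h2, smul_eq_mul]
    ring
  have hG : baryGrad K' a' = bary K' a' a • baryGrad K a := by
    rw [baryGrad, hL, map_smulₛₗ]
    rfl
  have hpt : normalPt K' a' = -normalPt K a := by
    rw [normalPt_eq hK' hd ha', normalPt_eq hK hd ha, hG, norm_smul, smul_smul, Real.norm_of_nonpos hneg.le,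
      ← neg_smul, ← neg_smul, ← neg_smul]
    congr 1
    have h0 : ‖baryGrad K a‖ ≠ 0 := norm_ne_zero_iff.2 (baryGrad_ne_zero hK hd ha)
    have := hneg.ne
    field_simp
  funext i
  simp [normal, hpt]

end TwoSimplices

/-! ### Cells, facets and neighbors in a triangulation -/

namespace Triangulation

variable {Ω : Set (Pt d)} (T : Triangulation Ω)

theorem mem_cells {K : Finset (Pt d)} : K ∈ T.cells ↔ K ∈ T.complex.faces ∧ K.card = d + 1 := by
  simp [cells]

theorem mem_facets {F : Finset (Pt d)} : F ∈ T.facets ↔ F ∈ T.complex.faces ∧ F.card = d := by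
  simp [facets]

variable {T}

theorem isSimplex {K : Finset (Pt d)} (hK : K ∈ T.cells) : IsSimplex K :=
  ⟨T.complex.indep (T.mem_cells.1 hK).1, (T.mem_cells.1 hK).2⟩

theorem erase_mem_facets (hd : 1 ≤ d) {K : Finset (Pt d)} (hK : K ∈ T.cells) {a : Pt d}
    (ha : a ∈ K) : K.erase a ∈ T.facets := by
  have hc : (K.erase a).card = d := by
    rw [Finset.card_erase_of_mem ha, (isSimplex hK).2, Nat.add_sub_cancel]
  refine T.mem_facets.2 ⟨T.complex.down_closed (T.mem_cells.1 hK).1 (Finset.erase_subset _ _) ?_, hc⟩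
  rw [← Finset.card_pos, hc]
  exact hd

theorem isOpen_domain (T : Triangulation Ω) : IsOpen Ω := by
  rw [T.domain_eq]; exact isOpen_interior

theorem convexHull_subset_space {K : Finset (Pt d)} (hK : K ∈ T.cells) :
    convexHull ℝ (K : Set (Pt d)) ⊆ T.complex.space :=
  T.complex.convexHull_subset_space (T.mem_cells.1 hK).1

theorem cell_subset {K : Finset (Pt d)} (hK : K ∈ T.cells) : cell K ⊆ Ω := by
  conv_rhs => rw [T.domain_eq]
  exact interior_mono (convexHull_subset_space hK)

theorem space_subset {x : Pt d} (hx : x ∈ T.complex.space) :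
    ∃ K ∈ T.cells, x ∈ convexHull ℝ (K : Set (Pt d)) := by
  obtain ⟨s, hs, hxs⟩ := T.complex.mem_space_iff.1 hx
  obtain ⟨K, hK, hsK, hc⟩ := T.pure s hs
  exact ⟨K, T.mem_cells.2 ⟨hK, hc⟩, convexHull_mono (by exact_mod_cast hsK) hxs⟩

theorem domain_subset {x : Pt d} (hx : x ∈ Ω) :
    ∃ K ∈ T.cells, x ∈ convexHull ℝ (K : Set (Pt d)) := by
  rw [T.domain_eq] at hx
  exact space_subset (interior_subset hx)

/-- A nondegenerate closed simplex is the closure of its interior, and that interior lies in `Ω`. -/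
theorem convexHull_subset_closure {K : Finset (Pt d)} (hK : K ∈ T.cells) :
    convexHull ℝ (K : Set (Pt d)) ⊆ closure Ω := by
  have h := (convex_convexHull ℝ (K : Set (Pt d))).closure_interior_eq_closure_of_nonempty_interior
    (isSimplex hK).nonempty_cell
  rw [(isCompact_convexHull_finset K).isClosed.closure_eq] at h
  rw [← h]
  exact closure_mono (cell_subset hK)

theorem mem_domain_or_frontier {K : Finset (Pt d)} (hK : K ∈ T.cells) {x : Pt d}
    (hx : x ∈ convexHull ℝ (K : Set (Pt d))) : x ∈ Ω ∨ x ∈ frontier Ω := by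
  by_cases h : x ∈ Ω
  · exact Or.inl h
  · right
    rw [T.isOpen_domain.frontier_eq]
    exact ⟨convexHull_subset_closure hK hx, h⟩

/-- A point of a face at which all coordinates in a set of vertices are positive can only lie in
faces which contain these vertices. -/
theorem subset_of_bary_pos {K s F : Finset (Pt d)} (hK : K ∈ T.cells) (hs : s ∈ T.complex.faces)
    (hF : F ⊆ K) {x : Pt d} (hxK : x ∈ convexHull ℝ (K : Set (Pt d)))
    (hxs : x ∈ convexHull ℝ (s : Set (Pt d))) (hpos : ∀ b ∈ F, 0 < bary K b x) : F ⊆ s := by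
  -- Conformity puts `x` in the hull of the common vertices, so the coordinate of any vertex of `F`
  -- missing from `s` would vanish at `x`.
  have h1 := T.complex.inter_subset_convexHull (T.mem_cells.1 hK).1 hs ⟨hxK, hxs⟩
  rw [← Finset.coe_inter] at h1
  have h2 := ((mem_convexHull_subset_iff (isSimplex hK) Finset.inter_subset_left).1 h1).2
  intro b hb
  by_contra hbs
  exact (hpos b hb).ne' (h2 b (hF hb) (fun h => hbs (Finset.mem_inter.1 h).2))

/-- At an interior point of `K` all coordinates are positive, so every vertex of `K` is a vertex of
`K'`, and both have `d + 1` vertices. -/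
theorem eq_of_mem_cell {K K' : Finset (Pt d)} (hK : K ∈ T.cells) (hK' : K' ∈ T.cells) {x : Pt d}
    (hx : x ∈ cell K) (hx' : x ∈ convexHull ℝ (K' : Set (Pt d))) : K = K' := by
  have := subset_of_bary_pos hK (T.mem_cells.1 hK').1 (Finset.Subset.refl K) (interior_subset hx) hx'
    ((mem_cell_iff (isSimplex hK)).1 hx)
  exact Finset.eq_of_subset_of_card_le this (by rw [(isSimplex hK).2, (isSimplex hK').2])

theorem disjoint_cells {K K' : Finset (Pt d)} (hK : K ∈ T.cells) (hK' : K' ∈ T.cells)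
    (hne : K ≠ K') : Disjoint (cell K) (cell K') :=
  Set.disjoint_left.2 fun _ hx hx' => hne (eq_of_mem_cell hK hK' hx (interior_subset hx'))

/-- The closed cells cover `Ω`, and the frontier of a convex set is a null set. -/
theorem ae_eq_biUnion_cells (T : Triangulation Ω) : (Ω : Set (Pt d)) =ᵐ[volume] ⋃ K ∈ T.cells, cell K := by
  have hnull : volume (⋃ K ∈ T.cells, frontier (convexHull ℝ (K : Set (Pt d)))) = 0 :=
    (measure_biUnion_null_iff T.cells.countable_toSet).2 fun K _ =>
      (convex_convexHull ℝ _).addHaar_frontier volume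
  refine EventuallyLE.antisymm ?_ ((iUnion₂_subset fun K hK => cell_subset hK).eventuallyLE)
  filter_upwards [measure_eq_zero_iff_ae_notMem.1 hnull] with x hx hxΩ
  obtain ⟨K, hK, hxK⟩ := T.domain_subset hxΩ
  refine mem_biUnion hK ?_
  by_contra hnot
  refine hx (mem_biUnion hK ?_)
  rw [(isCompact_convexHull_finset K).isClosed.frontier_eq]
  exact ⟨hxK, hnot⟩

/-- Integrals over the domain are sums of integrals over the cells. -/
theorem integral_domain_eq (T : Triangulation Ω) {f : Pt d → ℝ}
    (hf : ∀ K ∈ T.cells, IntegrableOn f (cell K)) :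
    ∫ x in Ω, f x = ∑ K ∈ T.cells, ∫ x in cell K, f x := by
  rw [setIntegral_congr_set T.ae_eq_biUnion_cells, integral_biUnion_finset _
    (fun K _ => (isOpen_cell K).measurableSet) ?_ hf]
  intro K hK K' hK' hne
  exact disjoint_cells hK hK' hne

theorem ae_cell_of_ae {p : Pt d → Prop} (h : ∀ᵐ x ∂(volume.restrict Ω), p x)
    {K : Finset (Pt d)} (hK : K ∈ T.cells) : ∀ᵐ x ∂(volume.restrict (cell K)), p x :=
  ae_mono (Measure.restrict_mono (cell_subset hK) le_rfl) h

/-- The cells `K` and `K'` are different and have a common facet, opposite to the vertices `a` and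
`a'`. -/
structure IsNeighbor (T : Triangulation Ω) (K : Finset (Pt d)) (a : Pt d) (K' : Finset (Pt d))
    (a' : Pt d) : Prop where
  left : K ∈ T.cells
  right : K' ∈ T.cells
  mem_left : a ∈ K
  mem_right : a' ∈ K'
  ne : K ≠ K'
  erase_eq : K.erase a = K'.erase a'

variable {K K' : Finset (Pt d)} {a a' : Pt d}

theorem IsNeighbor.symm (h : T.IsNeighbor K a K' a') : T.IsNeighbor K' a' K a :=
  ⟨h.right, h.left, h.mem_right, h.mem_left, h.ne.symm, h.erase_eq.symm⟩

/-- The barycentre of the facet serves as a point of its relative interior. -/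
theorem exists_bary_pos (hd : 1 ≤ d) (hK : IsSimplex K) (ha : a ∈ K) :
    ∃ m, bary K a m = 0 ∧ ∀ b ∈ K.erase a, 0 < bary K b m := by
  have hc : (K.erase a).card = d := by
    rw [Finset.card_erase_of_mem ha, hK.2, Nat.add_sub_cancel]
  have hd0 : (0 : ℝ) < d := by exact_mod_cast hd
  have hw : ∑ b ∈ K.erase a, (d : ℝ)⁻¹ = 1 := by
    rw [Finset.sum_const, hc, nsmul_eq_mul, mul_inv_cancel₀ hd0.ne']
  refine ⟨∑ b ∈ K.erase a, (d : ℝ)⁻¹ • b, ?_, fun b hb => ?_⟩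
  · rw [bary_sum_smul K a hw]
    refine Finset.sum_eq_zero fun b hb => ?_
    rw [bary_ne hK ha (Finset.mem_of_mem_erase hb) (Finset.ne_of_mem_erase hb).symm, mul_zero]
  · rw [bary_sum_smul K b hw, Finset.sum_eq_single b]
    · rw [bary_self hK (Finset.mem_of_mem_erase hb)]
      positivity
    · intro c hc hcb
      rw [bary_ne hK (Finset.mem_of_mem_erase hb) (Finset.mem_of_mem_erase hc) hcb.symm, mul_zero]
    · exact fun hn => absurd hb hn

/-- Neighbors lie on different sides of their common facet. -/
theorem IsNeighbor.bary_neg (hd : 1 ≤ d) (h : T.IsNeighbor K a K' a') : bary K' a' a < 0 := by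
  -- If `a` were not strictly beyond the facet as seen from `K'`, a small step from a relative
  -- interior point `m` of the facet towards `a` would enter the open cell `K` while staying in the
  -- closed simplex `K'`.
  by_contra hnn
  have hK := isSimplex h.left
  have hK' := isSimplex h.right
  obtain ⟨m, hm0, hm⟩ := exists_bary_pos hd hK' h.mem_right
  have hcont : ∀ (L : Finset (Pt d)) (b : Pt d),
      Tendsto (fun ε : ℝ => bary L b (m + ε • (a - m))) (𝓝[>] 0) (𝓝 (bary L b m)) := by
    intro L b
    have : Continuous fun ε : ℝ => bary L b (m + ε • (a - m)) :=
      (continuous_bary L b).comp (by fun_prop)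
    have := this.tendsto 0
    simp only [zero_smul, add_zero] at this
    exact this.mono_left nhdsWithin_le_nhds
  have hm' : bary K a m = 0 := by
    rw [bary_opposite_eq hK' hK h.mem_right h.mem_left h.erase_eq.symm, hm0, mul_zero]
  have e1 : ∀ᶠ ε : ℝ in 𝓝[>] 0, ∀ b ∈ K'.erase a', 0 < bary K' b (m + ε • (a - m)) :=
    (Finset.eventually_all _).2 fun b hb => (hcont K' b).eventually_const_lt (hm b hb)
  have e2 : ∀ᶠ ε : ℝ in 𝓝[>] 0, ∀ b ∈ K.erase a, 0 < bary K b (m + ε • (a - m)) :=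
    (Finset.eventually_all _).2 fun b hb => (hcont K b).eventually_const_lt (by
      rw [← bary_eq_of_mem_facet hK hK' h.mem_left h.erase_eq hm' hb]
      exact hm b (h.erase_eq ▸ hb))
  obtain ⟨ε, h1, h2, hε⟩ := (e1.and (e2.and self_mem_nhdsWithin)).exists
  have hε' : (0 : ℝ) < ε := hε
  have hcoord : ∀ (L : Finset (Pt d)) (b : Pt d), bary L b (m + ε • (a - m)) =
      bary L b m + ε * (bary L b a - bary L b m) := by
    intro L b
    rw [bary_add, map_smul, smul_eq_mul, baryL_sub]
  refine h.ne (eq_of_mem_cell h.left h.right (x := m + ε • (a - m)) ?_ ?_)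
  · refine (mem_cell_iff hK).2 fun b hb => ?_
    by_cases hba : b = a
    · subst hba
      rw [hcoord, hm', bary_self hK hb]
      simpa using hε'
    · exact h2 b (Finset.mem_erase.2 ⟨hba, hb⟩)
  · refine (mem_convexHull_iff_bary hK').2 fun b hb => ?_
    by_cases hba : b = a'
    · subst hba
      rw [hcoord, hm0, zero_add, sub_zero]
      exact mul_nonneg hε'.le (not_lt.1 hnn)
    · exact (h1 b (Finset.mem_erase.2 ⟨hba, hb⟩)).le

theorem IsNeighbor.normal_eq (hd : 1 ≤ d) (h : T.IsNeighbor K a K' a') :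
    normal K' a' = -normal K a :=
  normal_eq_neg_of_neg (isSimplex h.left) (isSimplex h.right) h.mem_left h.mem_right h.erase_eq hd
    (h.bary_neg hd)

/-- The relative interior of a common facet of two cells lies in the domain. -/
theorem IsNeighbor.mem_domain (hd : 1 ≤ d) (h : T.IsNeighbor K a K' a') {x : Pt d}
    (hx0 : bary K a x = 0) (hx : ∀ b ∈ K.erase a, 0 < bary K b x) : x ∈ Ω := by
  have hK := isSimplex h.left
  have hK' := isSimplex h.right
  have e1 : ∀ᶠ y in 𝓝 x, ∀ b ∈ K.erase a, 0 < bary K b y :=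
    (Finset.eventually_all _).2 fun b hb =>
      ((continuous_bary K b).tendsto x).eventually_const_lt (hx b hb)
  have e2 : ∀ᶠ y in 𝓝 x, ∀ b ∈ K.erase a, 0 < bary K' b y :=
    (Finset.eventually_all _).2 fun b hb =>
      ((continuous_bary K' b).tendsto x).eventually_const_lt (by
        rw [bary_eq_of_mem_facet hK hK' h.mem_left h.erase_eq hx0 hb]
        exact hx b hb)
  rw [T.domain_eq, mem_interior_iff_mem_nhds]
  filter_upwards [e1, e2] with y h1 h2
  -- Near `x` the coordinates of the shared vertices are positive in both simplices, so the sign of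
  -- the coordinate of `a` alone decides which of them contains `y`.
  rcases le_or_gt 0 (bary K a y) with hy | hy
  · refine convexHull_subset_space h.left ((mem_convexHull_iff_bary hK).2 fun b hb => ?_)
    by_cases hba : b = a
    · rwa [hba]
    · exact (h1 b (Finset.mem_erase.2 ⟨hba, hb⟩)).le
  · refine convexHull_subset_space h.right ((mem_convexHull_iff_bary hK').2 fun b hb => ?_)
    by_cases hba : b = a'
    · rw [hba, bary_opposite_eq hK hK' h.mem_left h.mem_right h.erase_eq]
      exact (mul_pos_of_neg_of_neg (h.bary_neg hd) hy).le
    · exact (h2 b (h.erase_eq ▸ Finset.mem_erase.2 ⟨hba, hb⟩)).le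

theorem IsNeighbor.not_isExterior (hd : 1 ≤ d) (h : T.IsNeighbor K a K' a') :
    ¬ IsExterior Ω K a := by
  intro hext
  obtain ⟨m, hm0, hm⟩ := exists_bary_pos hd (isSimplex h.left) h.mem_left
  have h1 := h.mem_domain hd hm0 hm
  have h2 := hext ((mem_facet_iff (isSimplex h.left) h.mem_left).2 ⟨hm0, fun b hb => (hm b hb).le⟩)
  rw [T.isOpen_domain.frontier_eq] at h2
  exact h2.2 h1

/-- Three cells on one facet would have to lie pairwise on opposite sides of it. In coordinates, a
negative number would be the product of two negative ones. -/
theorem IsNeighbor.unique (hd : 1 ≤ d) {K'' : Finset (Pt d)} {a'' : Pt d}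
    (h : T.IsNeighbor K a K' a') (h' : T.IsNeighbor K a K'' a'') : K' = K'' ∧ a' = a'' := by
  have hKK : K' = K'' := by
    by_contra hne
    have h3 : T.IsNeighbor K' a' K'' a'' := ⟨h.right, h'.right, h.mem_right, h'.mem_right, hne,
      h.erase_eq.symm.trans h'.erase_eq⟩
    have h4 := bary_opposite_eq (isSimplex h.left) (isSimplex h'.right) h.mem_left h'.mem_right
      h'.erase_eq a'
    have h5 := h3.bary_neg hd
    have h6 := h.symm.bary_neg hd
    have h7 := h'.bary_neg hd
    rw [h4] at h5
    nlinarith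
  refine ⟨hKK, ?_⟩
  subst hKK
  have := h.erase_eq.symm.trans h'.erase_eq
  by_contra hne
  have h8 : a'' ∈ K'.erase a' := Finset.mem_erase.2 ⟨Ne.symm hne, h'.mem_right⟩
  rw [this] at h8
  simp at h8

/-- A facet that does not lie on the boundary of the domain belongs to two cells. -/
theorem exists_isNeighbor (hd : 1 ≤ d) (hKc : K ∈ T.cells) (ha : a ∈ K)
    (hext : ¬ IsExterior Ω K a) : ∃ K' a', T.IsNeighbor K a K' a' := by
  have hK := isSimplex hKc
  obtain ⟨x₀, hx₀, hx₀f⟩ := Set.not_subset.1 hext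
  have hx₀K := convexHull_mono (by exact_mod_cast Finset.erase_subset a K) hx₀
  have hx₀Ω : x₀ ∈ Ω := (mem_domain_or_frontier hKc hx₀K).resolve_right hx₀f
  rw [mem_facet_iff hK ha] at hx₀
  obtain ⟨m, hm0, hm⟩ := exists_bary_pos hd hK ha
  -- A small step from `x₀` towards the barycentre of the facet stays in the open set `Ω` and
  -- reaches the relative interior of the facet.
  obtain ⟨x, hxΩ, hxa, hx⟩ : ∃ x ∈ Ω, bary K a x = 0 ∧ ∀ b ∈ K.erase a, 0 < bary K b x := by
    have hc : Continuous fun δ : ℝ => x₀ + δ • (m - x₀) := by fun_prop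
    have e1 : ∀ᶠ δ : ℝ in 𝓝[>] 0, x₀ + δ • (m - x₀) ∈ Ω :=
      nhdsWithin_le_nhds (hc.continuousAt.preimage_mem_nhds (by
        simpa using T.isOpen_domain.mem_nhds hx₀Ω))
    obtain ⟨δ, h1, h2⟩ := (e1.and (Ioo_mem_nhdsGT (zero_lt_one' ℝ))).exists
    have hcoord : ∀ b, bary K b (x₀ + δ • (m - x₀)) = (1 - δ) * bary K b x₀ + δ * bary K b m := by
      intro b
      rw [bary_add, map_smul, smul_eq_mul, baryL_sub]
      ring
    refine ⟨_, h1, ?_, fun b hb => ?_⟩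
    · rw [hcoord, hx₀.1, hm0]; ring
    · rw [hcoord]
      have := mul_pos h2.1 (hm b hb)
      have := mul_nonneg (sub_nonneg.2 h2.2.le) (hx₀.2 b hb)
      linarith
  have hxK : x ∈ convexHull ℝ (K : Set (Pt d)) :=
    convexHull_mono (by exact_mod_cast Finset.erase_subset a K)
      ((mem_facet_iff hK ha).2 ⟨hxa, fun b hb => (hx b hb).le⟩)
  have hc : Continuous fun ε : ℝ => x - ε • (a - x) := by fun_prop
  have hc0 : Tendsto (fun ε : ℝ => x - ε • (a - x)) (𝓝[>] 0) (𝓝 x) := by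
    have := hc.tendsto 0
    simp only [zero_smul, sub_zero] at this
    exact this.mono_left nhdsWithin_le_nhds
  have e1 : ∀ᶠ ε : ℝ in 𝓝[>] 0, x - ε • (a - x) ∈ Ω := hc0 (T.isOpen_domain.mem_nhds hxΩ)
  -- The points `x - ε (a - x)` approach `x` from beyond the facet. They are eventually in `Ω`, and
  -- since there are finitely many cells, one closed cell contains them for arbitrarily small `ε`,
  -- hence also their limit `x`.
  obtain ⟨K', hK', hfreq⟩ : ∃ K' ∈ T.cells,
      ∃ᶠ ε : ℝ in 𝓝[>] 0, x - ε • (a - x) ∈ convexHull ℝ (K' : Set (Pt d)) := by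
    by_contra hcon
    push Not at hcon
    have e2 := (Finset.eventually_all T.cells).2 hcon
    obtain ⟨ε, h1, h2⟩ := (e1.and e2).exists
    obtain ⟨L, hL, hxL⟩ := T.domain_subset h1
    exact h2 L hL hxL
  have hxK' : x ∈ convexHull ℝ (K' : Set (Pt d)) :=
    (isCompact_convexHull_finset K').isClosed.mem_of_frequently_of_tendsto hfreq hc0
  have hsub := subset_of_bary_pos hKc (T.mem_cells.1 hK').1 (Finset.erase_subset a K) hxK hxK' hx
  -- The coordinate of `a` in `K` equals `-ε` at these points.
  have hne : K ≠ K' := by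
    rintro rfl
    obtain ⟨ε, h1, h2⟩ := (hfreq.and_eventually self_mem_nhdsWithin).exists
    have h2' : (0 : ℝ) < ε := h2
    have h3 := (mem_convexHull_iff_bary hK).1 h1 a ha
    rw [sub_eq_add_neg, ← neg_smul, bary_add, map_smul, smul_eq_mul, baryL_sub, hxa,
      bary_self hK ha] at h3
    linarith
  have hcard : (K' \ K.erase a).card = 1 := by
    rw [Finset.card_sdiff_of_subset hsub, Finset.card_erase_of_mem ha, hK.2, (isSimplex hK').2]
    omega
  obtain ⟨a', ha'⟩ := Finset.card_eq_one.1 hcard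
  have ha'm : a' ∈ K' \ K.erase a := by rw [ha']; simp
  refine ⟨K', a', hKc, hK', ha, (Finset.mem_sdiff.1 ha'm).1, hne, ?_⟩
  rw [Finset.erase_eq K', ← ha', Finset.sdiff_sdiff_eq_self hsub]

/-- Two cells with a common facet are equal or neighbors. -/
theorem eq_or_isNeighbor (hK : K ∈ T.cells) (hK' : K' ∈ T.cells) (ha : a ∈ K) (ha' : a' ∈ K')
    (h : K.erase a = K'.erase a') : (K = K' ∧ a = a') ∨ T.IsNeighbor K a K' a' := by
  by_cases hne : K = K'
  · left
    subst hne
    refine ⟨rfl, ?_⟩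
    by_contra hne
    have h8 : a' ∈ K.erase a := Finset.mem_erase.2 ⟨Ne.symm hne, ha'⟩
    rw [h] at h8
    simp at h8
  · exact Or.inr ⟨hK, hK', ha, ha', hne, h⟩

/-- In a sum over the boundaries of all cells, contributions which cancel between neighbors can be
dropped. -/
theorem sum_skeleton_eq_sum_exterior (hd : 1 ≤ d) (T : Triangulation Ω)
    {G : Finset (Pt d) → Pt d → ℝ}
    (hG : ∀ K a K' a', T.IsNeighbor K a K' a' → G K a + G K' a' = 0) :
    ∑ K ∈ T.cells, ∑ a ∈ K, G K a =
      ∑ K ∈ T.cells, ∑ a ∈ K.filter (fun a => IsExterior Ω K a), G K a := by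
  have h1 : ∀ K ∈ T.cells, ∑ a ∈ K, G K a =
      (∑ a ∈ K.filter (fun a => IsExterior Ω K a), G K a) +
        ∑ a ∈ K.filter (fun a => ¬ IsExterior Ω K a), G K a := fun K _ =>
    (Finset.sum_filter_add_sum_filter_not K _ _).symm
  rw [Finset.sum_congr rfl h1, Finset.sum_add_distrib, add_eq_left, Finset.sum_sigma']
  have hex : ∀ p ∈ T.cells.sigma (fun K => K.filter (fun a => ¬ IsExterior Ω K a)),
      ∃ q : (_ : Finset (Pt d)) × Pt d, T.IsNeighbor p.1 p.2 q.1 q.2 := by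
    intro p hp
    rw [Finset.mem_sigma, Finset.mem_filter] at hp
    obtain ⟨K', a', h⟩ := exists_isNeighbor hd hp.1 hp.2.1 hp.2.2
    exact ⟨⟨K', a'⟩, h⟩
  choose! N hN using hex
  -- Passing to the neighbor is an involution without fixed points on the facets that are not
  -- exterior.
  refine Finset.sum_involution (fun p hp => N p) (fun p hp => hG _ _ _ _ (hN p hp)) ?_ ?_ ?_
  · intro p hp _ hpp
    exact (hN p hp).ne (congrArg Sigma.fst hpp).symm
  · intro p hp
    have h := hN p hp
    rw [Finset.mem_sigma, Finset.mem_filter]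
    exact ⟨h.right, h.mem_right, h.symm.not_isExterior hd⟩
  · intro p hp
    have h := hN p hp
    have hm : N p ∈ T.cells.sigma (fun K => K.filter (fun a => ¬ IsExterior Ω K a)) := by
      rw [Finset.mem_sigma, Finset.mem_filter]
      exact ⟨h.right, h.mem_right, h.symm.not_isExterior hd⟩
    have h2 := (hN _ hm).unique hd h.symm
    exact Sigma.ext h2.1 (heq_of_eq h2.2)

end Triangulation

/-! ### Functions in `H¹` of a triangulated domain -/

theorem exists_normal_ne_zero {K : Finset (Pt d)} (hK : IsSimplex K) (hd : 1 ≤ d) {a : Pt d}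
    (ha : a ∈ K) : ∃ j, normal K a j ≠ 0 := by
  by_contra! h
  have h0 : normalPt K a = 0 := by
    ext j
    exact h j
  have hg := norm_ne_zero_iff.2 (baryGrad_ne_zero hK hd ha)
  rw [normalPt_eq hK hd ha, neg_eq_zero, smul_eq_zero, inv_eq_zero] at h0
  exact h0.elim hg (baryGrad_ne_zero hK hd ha)

theorem green_single {K : Finset (Pt d)} (hK : IsSimplex K) (hd : 1 ≤ d) {g w : Pt d → ℝ}
    (hg : MemH 1 (cell K) g) (hw : ContDiff ℝ ∞ w) (j : Fin d) :
    (∫ x in cell K, weakPartial (cell K) j g x * w x) + (∫ x in cell K, g x * partialD j w x) =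
    ∑ a ∈ K, normal K a j * ∫ x, trace K (K.erase a) g x * w x ∂(surf (K.erase a)) := by
  have hone : ContDiff ℝ ∞ fun _ : Pt d => (1 : ℝ) := contDiff_const
  have h := green hK hd hg (memH_one_of_contDiff (isBounded_cell K) hone) hw j
  have e1 : ∫ x in cell K, g x * weakPartial (cell K) j (fun _ => (1 : ℝ)) x * w x = 0 := by
    refine (integral_congr_ae ?_).trans (integral_zero _ _)
    filter_upwards [(hasWeakPartial_of_contDiff j hone).weakPartial_ae_eq (isOpen_cell K)] with x hx
    rw [hx]
    simp [partialD]
  rw [e1, add_zero] at h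
  simp only [mul_one] at h
  rw [h]
  refine Finset.sum_congr rfl fun a ha => ?_
  congr 1
  refine integral_congr_ae ?_
  filter_upwards [trace_ae_eq_of_contDiff hK hd ha hone (EventuallyEq.refl _ _)] with x hx
  rw [hx, mul_one]

theorem integrable_mul_continuous_cell {K : Finset (Pt d)} {s w : Pt d → ℝ}
    (hs : IntegrableOn s (cell K)) (hw : Continuous w) :
    IntegrableOn (fun x => s x * w x) (cell K) := by
  obtain ⟨M, hM⟩ := exists_bound_cell K hw
  exact hs.mul_bdd hw.aestronglyMeasurable hM

theorem integrable_mul_continuous_surf {F : Finset (Pt d)} {s w : Pt d → ℝ}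
    (hs : Integrable s (surf F)) (hw : Continuous w) :
    Integrable (fun x => s x * w x) (surf F) := by
  obtain ⟨M, hM⟩ := exists_bound_surf F hw
  exact hs.mul_bdd hw.aestronglyMeasurable hM

theorem integrableOn_cell_of_memLp {K : Finset (Pt d)} {s : Pt d → ℝ}
    (hs : MemLp s 2 (volume.restrict (cell K))) : IntegrableOn s (cell K) := by
  have := integrable_cell_mul_mul hs (memLp_of_continuous (isBounded_cell K) (p := 2)
    (continuous_const (y := (1 : ℝ)))) (continuous_const (y := (1 : ℝ)))
  simpa using this

theorem integrable_trace {K : Finset (Pt d)} (hK : IsSimplex K) (hd : 1 ≤ d) {a : Pt d}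
    (ha : a ∈ K) {g : Pt d → ℝ} (hg : MemH 1 (cell K) g) :
    Integrable (trace K (K.erase a) g) (surf (K.erase a)) := by
  have : IsFiniteMeasure (surf (K.erase a)) := isFiniteMeasure_surf hK hd ha
  exact (memLp_trace hK hd ha hg).integrable (by norm_num)

/-! ### Traces across interior facets and the product rule -/

namespace Triangulation

variable {Ω : Set (Pt d)} {T : Triangulation Ω}

/-- For `g ∈ H¹(Ω)` the traces from both sides of an interior facet agree. -/
theorem IsNeighbor.trace_ae_eq (hd : 1 ≤ d) {K K' : Finset (Pt d)} {a a' : Pt d}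
    (h : T.IsNeighbor K a K' a') {g : Pt d → ℝ} (hg : MemH 1 Ω g) :
    trace K (K.erase a) g =ᵐ[surf (K.erase a)] trace K' (K'.erase a') g := by
  have hK := isSimplex h.left
  have hK' := isSimplex h.right
  have hgK := fun {L : Finset (Pt d)} (hL : L ∈ T.cells) => hg.mono (cell_subset hL)
  obtain ⟨j, hj⟩ := exists_normal_ne_zero hK hd h.mem_left
  -- Test functions supported in this open set see no other facet, and it still contains almost all
  -- of the facet under consideration.
  set U : Set (Pt d) := Ω \ ⋃ F' ∈ T.facets.erase (K.erase a), convexHull ℝ (F' : Set (Pt d))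
    with hUdef
  have hU : IsOpen U := T.isOpen_domain.sdiff (isClosed_biUnion_finset fun F' _ =>
    (isCompact_convexHull_finset F').isClosed)
  have haeU : ∀ᵐ x ∂(surf (K.erase a)), x ∈ U := by
    filter_upwards [ae_surf_bary_pos hK hd h.mem_left] with x hx
    refine ⟨h.mem_domain hd hx.1 hx.2, fun hxF => ?_⟩
    obtain ⟨F', hF', hxF'⟩ := mem_iUnion₂.1 hxF
    have hF'm := T.mem_facets.1 (Finset.mem_of_mem_erase hF')
    have hsub := subset_of_bary_pos h.left hF'm.1 (Finset.erase_subset a K)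
      (convexHull_mono (by exact_mod_cast Finset.erase_subset a K)
        ((mem_facet_iff hK h.mem_left).2 ⟨hx.1, fun b hb => (hx.2 b hb).le⟩)) hxF' hx.2
    refine Finset.ne_of_mem_erase hF' (Finset.eq_of_subset_of_card_le hsub ?_).symm
    rw [hF'm.2, (T.mem_facets.1 (erase_mem_facets hd h.left h.mem_left)).2]
  have hi := integrable_trace hK hd h.mem_left (hgK h.left)
  have hi' : Integrable (trace K' (K'.erase a') g) (surf (K.erase a)) := by
    have := integrable_trace hK' hd h.mem_right (hgK h.right)
    rwa [← h.erase_eq] at this ⊢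
  have key := hU.ae_eq_zero_of_integral_contDiff_smul_eq_zero (μ := surf (K.erase a))
    (f := fun x => trace K (K.erase a) g x - trace K' (K'.erase a') g x)
    ((hi.sub hi').locallyIntegrable.locallyIntegrableOn U) ?_
  · filter_upwards [key, haeU] with x hx hxU
    exact sub_eq_zero.1 (hx hxU)
  intro φ hφ hc hs
  have ht : IsTestFunction Ω φ := ⟨hφ, hc, hs.trans sdiff_subset⟩
  -- The volume terms of Green's formula, summed over all cells, form the defining identity of the
  -- weak derivative on `Ω`, so the boundary terms add up to zero.
  have h0 : ∑ L ∈ T.cells, ∑ b ∈ L, normal L b j *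
      ∫ x, trace L (L.erase b) g x * φ x ∂(surf (L.erase b)) = 0 := by
    have hw := (hg.hasWeakPartial j).2.2 φ ht
    have i1 : ∀ L ∈ T.cells, IntegrableOn (fun x => g x * partialD j φ x) (cell L) := fun L hL =>
      integrable_mul_continuous_cell (integrableOn_cell_of_memLp (hgK hL).1)
        (partialD_continuous hφ j)
    have hLp := ((memH_one_iff T.isOpen_domain).1 hg).2 j
    have i2 : ∀ L ∈ T.cells, IntegrableOn (fun x => weakPartial Ω j g x * φ x) (cell L) :=
      fun L hL => integrable_mul_continuous_cell (integrableOn_cell_of_memLp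
        (hLp.2.mono_measure (Measure.restrict_mono (cell_subset hL) le_rfl))) hφ.continuous
    rw [T.integral_domain_eq i1, T.integral_domain_eq i2, eq_neg_iff_add_eq_zero, add_comm,
      ← Finset.sum_add_distrib] at hw
    rw [← hw]
    refine Finset.sum_congr rfl fun L hL => ?_
    rw [← green_single (isSimplex hL) hd (hgK hL) hφ j]
    congr 1
    refine integral_congr_ae ?_
    filter_upwards [hg.weakPartial_ae_eq (isOpen_cell L) (cell_subset hL) j] with x hx
    rw [hx]
  -- Only the two sides of the common facet contribute. Their normals are opposite, and dividing by
  -- the nonzero component `normal K a j` shows that the difference of the traces is orthogonal to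
  -- `φ`.
  rw [Finset.sum_sigma', Finset.sum_eq_add (⟨K, a⟩ : (_ : Finset (Pt d)) × Pt d) ⟨K', a'⟩
    (fun he => h.ne (congrArg Sigma.fst he)) ?_ ?_ ?_] at h0
  · simp only [h.normal_eq hd, Pi.neg_apply, neg_mul, ← sub_eq_add_neg, ← mul_sub] at h0
    have h1 := (mul_eq_zero.1 h0).resolve_left hj
    rw [← h.erase_eq] at h1 hi' ⊢
    rw [← integral_sub (integrable_mul_continuous_surf hi hφ.continuous)
      (integrable_mul_continuous_surf hi' hφ.continuous)] at h1
    rw [← h1]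
    refine integral_congr_ae (Eventually.of_forall fun x => ?_)
    simp only [smul_eq_mul]
    ring
  · rintro ⟨L, b⟩ hLb ⟨hne, hne'⟩
    rw [Finset.mem_sigma] at hLb
    by_cases hF : K.erase a = L.erase b
    · rcases eq_or_isNeighbor h.left hLb.1 h.mem_left hLb.2 hF with ⟨rfl, rfl⟩ | hN
      · exact absurd rfl hne
      · obtain ⟨rfl, rfl⟩ := h.unique hd hN
        exact absurd rfl hne'
    · refine mul_eq_zero_of_right _ ((integral_congr_ae ?_).trans (integral_zero _ _))
      filter_upwards [ae_surf_mem (L.erase b)] with x hx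
      refine mul_eq_zero_of_right _ (image_eq_zero_of_notMem_tsupport fun hxs => ?_)
      exact (hs hxs).2 (mem_biUnion (Finset.mem_coe.2 (Finset.mem_erase.2
        ⟨Ne.symm hF, erase_mem_facets hd hLb.1 hLb.2⟩)) hx)
  · exact fun hn => absurd (Finset.mem_sigma.2 ⟨h.left, h.mem_left⟩) hn
  · exact fun hn => absurd (Finset.mem_sigma.2 ⟨h.right, h.mem_right⟩) hn

/-- The definition fixes the trace from only one adjacent cell; agreement across interior facets
transfers it to the cell at hand. -/
theorem EqTrace.ae_eq (hd : 1 ≤ d) {g gbar : Pt d → ℝ} (h : T.EqTrace g gbar) (hg : MemH 1 Ω g)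
    {K : Finset (Pt d)} (hK : K ∈ T.cells) {a : Pt d} (ha : a ∈ K) :
    gbar =ᵐ[surf (K.erase a)] trace K (K.erase a) g := by
  have hF := erase_mem_facets hd hK ha
  obtain ⟨K', hK', hsub, hae⟩ := h _ hF
  have hcard : (K' \ K.erase a).card = 1 := by
    rw [Finset.card_sdiff_of_subset hsub, (T.mem_facets.1 hF).2, (isSimplex hK').2]
    omega
  obtain ⟨a', ha'⟩ := Finset.card_eq_one.1 hcard
  have ha'm : a' ∈ K' \ K.erase a := by rw [ha']; simp
  have he : K.erase a = K'.erase a' := by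
    rw [Finset.erase_eq K', ← ha', Finset.sdiff_sdiff_eq_self hsub]
  rcases eq_or_isNeighbor hK hK' ha (Finset.mem_sdiff.1 ha'm).1 he with ⟨rfl, rfl⟩ | hN
  · exact hae
  · refine EventuallyEq.trans hae ?_
    have := hN.trace_ae_eq hd hg
    rw [← he] at this
    exact this.symm

/-- Interior contributions cancel between neighbors, and on exterior facets the test function is
zero. -/
theorem sum_skeleton_eq_zero (hd : 1 ≤ d) (T : Triangulation Ω) {g h φ : Pt d → ℝ}
    (hg : MemH 1 Ω g) (hh : MemH 1 Ω h) (hφ : IsTestFunction Ω φ) (j : Fin d) :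
    ∑ K ∈ T.cells, ∑ a ∈ K, normal K a j * ∫ x, trace K (K.erase a) g x *
      trace K (K.erase a) h x * φ x ∂(surf (K.erase a)) = 0 := by
  rw [T.sum_skeleton_eq_sum_exterior hd]
  · refine Finset.sum_eq_zero fun K hK => Finset.sum_eq_zero fun a ha => ?_
    refine mul_eq_zero_of_right _ ((integral_congr_ae ?_).trans (integral_zero _ _))
    filter_upwards [ae_surf_mem (K.erase a)] with x hx
    refine mul_eq_zero_of_right _ (image_eq_zero_of_notMem_tsupport fun hxs => ?_)
    have hxf := (Finset.mem_filter.1 ha).2 hx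
    rw [T.isOpen_domain.frontier_eq] at hxf
    exact hxf.2 (hφ.2.2 hxs)
  · intro K a K' a' hN
    rw [hN.normal_eq hd, ← hN.erase_eq, Pi.neg_apply, neg_mul, ← sub_eq_add_neg, sub_eq_zero]
    congr 1
    refine integral_congr_ae ?_
    have e1 := hN.trace_ae_eq hd hg
    have e2 := hN.trace_ae_eq hd hh
    rw [← hN.erase_eq] at e1 e2
    filter_upwards [e1, e2] with x h1 h2
    rw [h1, h2]

/-- The product rule for the product of two functions in `H¹` of a triangulated domain. -/
theorem hasWeakPartial_mul (hd : 1 ≤ d) (T : Triangulation Ω) {g h : Pt d → ℝ}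
    (hg : MemH 1 Ω g) (hh : MemH 1 Ω h) (j : Fin d) :
    HasWeakPartial Ω j (fun x => g x * h x)
      (fun x => weakPartial Ω j g x * h x + g x * weakPartial Ω j h x) := by
  have hg' := (memH_one_iff T.isOpen_domain).1 hg
  have hh' := (memH_one_iff T.isOpen_domain).1 hh
  have hr : ∀ {f : Pt d → ℝ}, MemLp f 2 (volume.restrict Ω) → ∀ K ∈ T.cells,
      MemLp f 2 (volume.restrict (cell K)) := fun hf K hK =>
    hf.mono_measure (Measure.restrict_mono (cell_subset hK) le_rfl)
  have hL : IntegrableOn (fun x => g x * h x) Ω := hg'.1.integrable_mul hh'.1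
  have hL' : IntegrableOn (fun x => weakPartial Ω j g x * h x + g x * weakPartial Ω j h x) Ω :=
    ((hg'.2 j).2.integrable_mul hh'.1).add (hg'.1.integrable_mul (hh'.2 j).2)
  refine ⟨hL.locallyIntegrableOn, hL'.locallyIntegrableOn, fun φ hφ => ?_⟩
  have hφc := hφ.1.continuous
  have i1 := fun K hK => integrable_cell_mul_mul (hr (hg'.2 j).2 K hK) (hr hh'.1 K hK) hφc
  have i2 := fun K hK => integrable_cell_mul_mul (hr hg'.1 K hK) (hr (hh'.2 j).2 K hK) hφc
  have i3 := fun K hK => integrable_cell_mul_mul (hr hg'.1 K hK) (hr hh'.1 K hK)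
    (partialD_continuous hφ.1 j)
  simp only [add_mul]
  -- The defect of the weak identity is the sum of the boundary terms in Green's formula over all
  -- cells, which is zero. No approximation by smooth functions on `Ω` is involved.
  rw [T.integral_domain_eq i3, T.integral_domain_eq (f := fun x => weakPartial Ω j g x * h x * φ x +
      g x * weakPartial Ω j h x * φ x) (fun K hK => (i1 K hK).add (i2 K hK)),
    eq_neg_iff_add_eq_zero, add_comm, ← Finset.sum_add_distrib,
    ← T.sum_skeleton_eq_zero hd hg hh hφ j]
  refine Finset.sum_congr rfl fun K hK => ?_
  rw [← green (isSimplex hK) hd (hg.mono (cell_subset hK)) (hh.mono (cell_subset hK)) hφ.1 j]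
  rw [integral_add (i1 K hK) (i2 K hK)]
  congr 2
  · refine integral_congr_ae ?_
    filter_upwards [hg.weakPartial_ae_eq (isOpen_cell K) (cell_subset hK) j] with x hx
    rw [hx]
  · refine integral_congr_ae ?_
    filter_upwards [hh.weakPartial_ae_eq (isOpen_cell K) (cell_subset hK) j] with x hx
    rw [hx]

end Triangulation

/-! ### Integration by parts for fluxes -/

/-- On the cell `K`, the function `s` has the partial derivative `s'` with respect to `x_j` and, on
the facet opposite to `a`, the boundary values `τ a`, in the sense that integration by parts against
smooth functions holds. -/
structure HasGreen (K : Finset (Pt d)) (j : Fin d) (s s' : Pt d → ℝ) (τ : Pt d → Pt d → ℝ) :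
    Prop where
  integrable : IntegrableOn s (cell K)
  integrable_deriv : IntegrableOn s' (cell K)
  integrable_bdry : ∀ a ∈ K, Integrable (τ a) (surf (K.erase a))
  eq : ∀ w, ContDiff ℝ ∞ w → (∫ x in cell K, s' x * w x) + (∫ x in cell K, s x * partialD j w x) =
    ∑ a ∈ K, normal K a j * ∫ x, τ a x * w x ∂(surf (K.erase a))

section HasGreen

variable {K : Finset (Pt d)} {j : Fin d} {s s' s₁ s₁' : Pt d → ℝ} {τ τ₁ : Pt d → Pt d → ℝ}

theorem HasGreen.add (h : HasGreen K j s s' τ) (h₁ : HasGreen K j s₁ s₁' τ₁) :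
    HasGreen K j (fun x => s x + s₁ x) (fun x => s' x + s₁' x) (fun a x => τ a x + τ₁ a x) := by
  refine ⟨h.1.add h₁.1, h.2.add h₁.2, fun a ha => (h.3 a ha).add (h₁.3 a ha), fun w hw => ?_⟩
  have hwj := partialD_continuous hw j
  simp only [add_mul]
  rw [integral_add (integrable_mul_continuous_cell h.2 hw.continuous)
    (integrable_mul_continuous_cell h₁.2 hw.continuous),
    integral_add (integrable_mul_continuous_cell h.1 hwj) (integrable_mul_continuous_cell h₁.1 hwj),
    add_add_add_comm, h.eq w hw, h₁.eq w hw, ← Finset.sum_add_distrib]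
  refine Finset.sum_congr rfl fun a ha => ?_
  rw [integral_add (integrable_mul_continuous_surf (h.3 a ha) hw.continuous)
    (integrable_mul_continuous_surf (h₁.3 a ha) hw.continuous), mul_add]

theorem HasGreen.const_mul (h : HasGreen K j s s' τ) (c : ℝ) :
    HasGreen K j (fun x => c * s x) (fun x => c * s' x) (fun a x => c * τ a x) := by
  refine ⟨h.1.const_mul c, h.2.const_mul c, fun a ha => (h.3 a ha).const_mul c, fun w hw => ?_⟩
  simp only [mul_assoc, integral_const_mul]
  rw [← mul_add, h.eq w hw, Finset.mul_sum]
  exact Finset.sum_congr rfl fun a _ => mul_left_comm _ _ _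

theorem HasGreen.congr_bdry (h : HasGreen K j s s' τ)
    (hτ : ∀ a ∈ K, τ a =ᵐ[surf (K.erase a)] τ₁ a) : HasGreen K j s s' τ₁ := by
  refine ⟨h.1, h.2, fun a ha => (h.3 a ha).congr (hτ a ha), fun w hw => ?_⟩
  rw [h.eq w hw]
  refine Finset.sum_congr rfl fun a ha => ?_
  congr 1
  refine integral_congr_ae ?_
  filter_upwards [hτ a ha] with x hx
  rw [hx]

variable {Ω : Set (Pt d)} {T : Triangulation Ω}

theorem MemH.hasGreen (hd : 1 ≤ d) (hK : K ∈ T.cells) {g : Pt d → ℝ} (hg : MemH 1 Ω g)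
    (j : Fin d) :
    HasGreen K j g (HybridNS.weakPartial Ω j g) (fun a => trace K (K.erase a) g) := by
  have hgK := hg.mono (T.cell_subset hK)
  have hm := (memH_one_iff (isOpen_cell K)).1 hgK
  have hae := hg.weakPartial_ae_eq (isOpen_cell K) (T.cell_subset hK) j
  refine ⟨integrableOn_cell_of_memLp hm.1, (integrableOn_cell_of_memLp (hm.2 j).2).congr hae,
    fun a ha => integrable_trace (T.isSimplex hK) hd ha hgK, fun w hw => ?_⟩
  rw [← green_single (T.isSimplex hK) hd hgK hw j]
  congr 1
  refine integral_congr_ae ?_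
  filter_upwards [hae] with x hx
  rw [hx]

/-- In general the product is only integrable with integrable derivatives, so it has no trace in the
`H¹` sense. The product of the traces serves as its boundary values. -/
theorem hasGreen_mul (hd : 1 ≤ d) (hK : K ∈ T.cells) {g h : Pt d → ℝ} (hg : MemH 1 Ω g)
    (hh : MemH 1 Ω h) (j : Fin d) :
    HasGreen K j (fun x => g x * h x)
      (fun x => weakPartial Ω j g x * h x + g x * weakPartial Ω j h x)
      (fun a x => trace K (K.erase a) g x * trace K (K.erase a) h x) := by
  have hS := T.isSimplex hK
  have hgK := hg.mono (T.cell_subset hK)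
  have hhK := hh.mono (T.cell_subset hK)
  have hm := (memH_one_iff (isOpen_cell K)).1 hgK
  have hm' := (memH_one_iff (isOpen_cell K)).1 hhK
  have hae := hg.weakPartial_ae_eq (isOpen_cell K) (T.cell_subset hK) j
  have hae' := hh.weakPartial_ae_eq (isOpen_cell K) (T.cell_subset hK) j
  have L1 := (hm.2 j).2.ae_eq hae
  have L2 := (hm'.2 j).2.ae_eq hae'
  refine ⟨hm.1.integrable_mul hm'.1, (L1.integrable_mul hm'.1).add (hm.1.integrable_mul L2),
    fun a ha => (memLp_trace hS hd ha hgK).integrable_mul (memLp_trace hS hd ha hhK),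
    fun w hw => ?_⟩
  rw [← green hS hd hgK hhK hw j]
  simp only [add_mul]
  rw [integral_add (integrable_cell_mul_mul L1 hm'.1 hw.continuous)
    (integrable_cell_mul_mul hm.1 L2 hw.continuous)]
  congr 2
  · refine integral_congr_ae ?_
    filter_upwards [hae] with x hx
    rw [hx]
  · refine integral_congr_ae ?_
    filter_upwards [hae'] with x hx
    rw [hx]

theorem HasGreen.row {s s' : Fin d → Pt d → ℝ} {τ : Fin d → Pt d → Pt d → ℝ}
    (h : ∀ j, HasGreen K j (s j) (s' j) (τ j)) {w : Pt d → ℝ} (hw : ContDiff ℝ ∞ w) :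
    (∫ x in cell K, (∑ j, s' j x) * w x) + (∫ x in cell K, ∑ j, s j x * partialD j w x) =
      ∑ a ∈ K, ∫ x, (∑ j, τ j a x * normal K a j) * w x ∂(surf (K.erase a)) := by
  have e : ∀ a ∈ K, ∫ x, (∑ j, τ j a x * normal K a j) * w x ∂(surf (K.erase a)) =
      ∑ j, normal K a j * ∫ x, τ j a x * w x ∂(surf (K.erase a)) := fun a ha => by
    simp only [Finset.sum_mul, ← integral_const_mul]
    rw [integral_finsetSum _ fun j _ => ?_]
    · refine Finset.sum_congr rfl fun j _ => integral_congr_ae (Eventually.of_forall fun x => ?_)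
      simp only
      ring
    · exact integrable_mul_continuous_surf (((h j).3 a ha).mul_const _) hw.continuous
  rw [Finset.sum_congr rfl e, Finset.sum_comm]
  simp only [Finset.sum_mul]
  rw [integral_finsetSum _ fun j _ => integrable_mul_continuous_cell (h j).2 hw.continuous,
    integral_finsetSum _ fun j _ => integrable_mul_continuous_cell (h j).1
      (partialD_continuous hw j), ← Finset.sum_add_distrib]
  exact Finset.sum_congr rfl fun j _ => (h j).eq w hw

theorem HasGreen.tensor {s s' : Fin d → Fin d → Pt d → ℝ} {τ : Fin d → Fin d → Pt d → Pt d → ℝ}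
    (h : ∀ i j, HasGreen K j (s i j) (s' i j) (τ i j)) {w : Fin d → Pt d → ℝ}
    (hw : ∀ i, ContDiff ℝ ∞ (w i)) :
    (∫ x in cell K, ∑ i, (∑ j, s' i j x) * w i x) +
      (∫ x in cell K, ∑ i, ∑ j, s i j x * partialD j (w i) x) =
      ∑ a ∈ K, ∫ x, ∑ i, (∑ j, τ i j a x * normal K a j) * w i x ∂(surf (K.erase a)) := by
  have e : ∀ a ∈ K, ∫ x, ∑ i, (∑ j, τ i j a x * normal K a j) * w i x ∂(surf (K.erase a)) =
      ∑ i, ∫ x, (∑ j, τ i j a x * normal K a j) * w i x ∂(surf (K.erase a)) := fun a ha =>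
    integral_finsetSum _ fun i _ => integrable_mul_continuous_surf
      (integrable_finsetSum _ fun j _ => ((h i j).3 a ha).mul_const _) (hw i).continuous
  rw [Finset.sum_congr rfl e, Finset.sum_comm,
    integral_finsetSum _ fun i _ => integrable_mul_continuous_cell
      (integrable_finsetSum _ fun j _ => (h i j).2) (hw i).continuous,
    integral_finsetSum _ fun i _ => integrable_finsetSum _ fun j _ =>
      integrable_mul_continuous_cell (h i j).1 (partialD_continuous (hw i) j),
    ← Finset.sum_add_distrib]
  exact Finset.sum_congr rfl fun i _ => HasGreen.row (h i) (hw i)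

theorem HasGreen.integrable_tensor {s s' : Fin d → Fin d → Pt d → ℝ}
    {τ : Fin d → Fin d → Pt d → Pt d → ℝ}
    (h : ∀ i j, HasGreen K j (s i j) (s' i j) (τ i j)) {w : Fin d → Pt d → ℝ}
    (hw : ∀ i, Continuous (w i)) :
    IntegrableOn (fun x => ∑ i, (∑ j, s' i j x) * w i x) (cell K) :=
  integrable_finsetSum _ fun i _ => integrable_mul_continuous_cell
    (integrable_finsetSum _ fun j _ => (h i j).2) (hw i)

theorem HasGreen.integrable_bdry_tensor {s s' : Fin d → Fin d → Pt d → ℝ}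
    {τ : Fin d → Fin d → Pt d → Pt d → ℝ}
    (h : ∀ i j, HasGreen K j (s i j) (s' i j) (τ i j)) {w : Fin d → Pt d → ℝ}
    (hw : ∀ i, Continuous (w i)) {a : Pt d} (ha : a ∈ K) :
    Integrable (fun x => ∑ i, (∑ j, τ i j a x * normal K a j) * w i x) (surf (K.erase a)) :=
  integrable_finsetSum _ fun i _ => integrable_mul_continuous_surf
      (integrable_finsetSum _ fun j _ => ((h i j).3 a ha).mul_const _) (hw i)

end HasGreen

/-! ### Momentum fluxes -/

/-- The weak derivative `∂/∂x_j` of the entry `(i, j)` of the diffusive flux. -/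
def diffFluxPartial (Ω : Set (Pt d)) (ν : ℝ) (p : Pt d → ℝ) (u : Pt d → Vec d) (i j : Fin d)
    (x : Pt d) : ℝ :=
  (1 : Ten d) i j * weakPartial Ω j p x +
    (-ν) * (weakPartial Ω j (fun y => grad Ω u y i j) x + weakPartial Ω j (fun y => grad Ω u y j i) x)

/-- The weak derivative `∂/∂x_j` of the entry `(i, j)` of the tensor `u ⊗ u`. -/
def convPartial (Ω : Set (Pt d)) (u : Pt d → Vec d) (i j : Fin d) (x : Pt d) : ℝ :=
  weakPartial Ω j (fun y => u y i) x * u x j + u x i * weakPartial Ω j (fun y => u y j) x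

/-- Writing an entry as a linear combination of `H¹` functions makes the linearity of weak
derivatives and of `HasGreen` applicable. -/
theorem diffFlux_apply (ν p : ℝ) (G : Ten d) (i j : Fin d) :
    diffFlux ν p G i j = (1 : Ten d) i j * p + (-ν) * (G i j + G j i) := by
  simp only [diffFlux, symm, Matrix.sub_apply, Matrix.smul_apply, Matrix.add_apply,
    Matrix.transpose_apply, smul_eq_mul]
  ring

section Flux

variable {Ω : Set (Pt d)} {T : Triangulation Ω} {u : Pt d → Vec d} {p : Pt d → ℝ}
  (hu : ∀ i, MemH 2 Ω (fun x => u x i)) (hp : MemH 1 Ω p)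

include hu

theorem memH_one_grad (T : Triangulation Ω) (i j : Fin d) : MemH 1 Ω (fun y => grad Ω u y i j) :=
  (hu i).weakPartial T.isOpen_domain j

theorem grad_cell_ae_eq {K : Finset (Pt d)} (hK : K ∈ T.cells) :
    grad (cell K) u =ᵐ[volume.restrict (cell K)] grad Ω u := by
  have h := fun i j => (hu i).weakPartial_ae_eq (isOpen_cell K) (T.cell_subset hK) j
  have h' := ae_all_iff.2 fun i => ae_all_iff.2 (h i)
  filter_upwards [h'] with x hx
  ext i j
  exact hx i j

/-- The scheme takes the gradient on each cell; replacing it by the gradient on `Ω` makes the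
agreement of traces across facets available. -/
theorem traceGrad_ae_eq (hd : 1 ≤ d) {K : Finset (Pt d)} (hK : K ∈ T.cells) {a : Pt d}
    (ha : a ∈ K) (i j : Fin d) :
    (fun x => traceGrad K (K.erase a) u x i j) =ᵐ[surf (K.erase a)]
      trace K (K.erase a) (fun y => grad Ω u y i j) := by
  have h : (fun y => grad Ω u y i j) =ᵐ[volume.restrict (cell K)]
      fun y => grad (cell K) u y i j := by
    filter_upwards [grad_cell_ae_eq hu hK] with x hx
    rw [hx]
  exact (trace_congr (T.isSimplex hK) hd ha ((memH_one_grad hu T i j).mono (T.cell_subset hK))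
    h).symm

theorem hasGreen_conv (hd : 1 ≤ d) {K : Finset (Pt d)} (hK : K ∈ T.cells) (i j : Fin d) :
    HasGreen K j (fun x => u x i * u x j) (convPartial Ω u i j)
      (fun a x => traceV K (K.erase a) u x i * traceV K (K.erase a) u x j) :=
  hasGreen_mul hd hK (hu i).of_succ (hu j).of_succ j

include hp

theorem hasGreen_diffFlux (hd : 1 ≤ d) {K : Finset (Pt d)} (hK : K ∈ T.cells) (ν : ℝ)
    (i j : Fin d) :
    HasGreen K j (fun x => diffFlux ν (p x) (grad Ω u x) i j) (diffFluxPartial Ω ν p u i j)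
      (fun a x => diffFlux ν (trace K (K.erase a) p x) (traceGrad K (K.erase a) u x) i j) := by
  have hG := fun i' j' => ((memH_one_grad hu T i' j').hasGreen hd hK j).congr_bdry
    fun a ha => (traceGrad_ae_eq hu hd hK ha i' j').symm
  have h := ((hp.hasGreen hd hK j).const_mul ((1 : Ten d) i j)).add
    (((hG i j).add (hG j i)).const_mul (-ν))
  simp only [diffFlux_apply]
  exact h

/-- Linearity and the product rule exhibit a weak derivative of each entry of the full flux, and
uniqueness identifies it with the one in the momentum equation. -/
theorem tensorDiv_momentumFlux_ae_eq (hd : 1 ≤ d) (T : Triangulation Ω) (ν : ℝ) :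
    ∀ᵐ x ∂(volume.restrict Ω), ∀ i,
      tensorDiv Ω (fun y => momentumFlux ν (p y) (grad Ω u y) (u y)) x i =
        (∑ j, diffFluxPartial Ω ν p u i j x) + ∑ j, convPartial Ω u i j x := by
  have h : ∀ i j, weakPartial Ω j (fun y => momentumFlux ν (p y) (grad Ω u y) (u y) i j)
      =ᵐ[volume.restrict Ω] fun x => diffFluxPartial Ω ν p u i j x + convPartial Ω u i j x := by
    intro i j
    refine HasWeakPartial.weakPartial_ae_eq T.isOpen_domain ?_
    have hG := fun i' j' => (memH_one_grad hu T i' j').hasWeakPartial j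
    have h := (((hp.hasWeakPartial j).const_mul ((1 : Ten d) i j)).add
      (((hG i j).add (hG j i)).const_mul (-ν))).add
      (T.hasWeakPartial_mul hd (hu i).of_succ (hu j).of_succ j)
    simp only [momentumFlux, Matrix.add_apply, diffFlux_apply, Matrix.vecMulVec_apply]
    exact h
  have h' := ae_all_iff.2 fun i => ae_all_iff.2 (h i)
  filter_upwards [h'] with x hx i
  rw [← Finset.sum_add_distrib]
  exact Finset.sum_congr rfl fun j _ => hx i j

end Flux

/-! ### Discrete test functions -/

theorem contDiff_polyFun (Q : MvPolynomial (Fin d) ℝ) : ContDiff ℝ ∞ (polyFun Q) := by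
  induction Q using MvPolynomial.induction_on with
  | C c =>
    have : polyFun (d := d) (MvPolynomial.C c) = fun _ => c := by
      funext x
      simp [polyFun]
    rw [this]
    exact contDiff_const
  | add p q hp hq =>
    have : polyFun (p + q) = fun x => polyFun p x + polyFun q x := by
      funext x
      simp [polyFun]
    rw [this]
    exact hp.add hq
  | mul_X p i hp =>
    have : polyFun (p * MvPolynomial.X i) = fun x => polyFun p x * x i := by
      funext x
      simp [polyFun]
    rw [this]
    exact hp.mul (by fun_prop)

section TestFunctions

variable {Ω : Set (Pt d)} {T : Triangulation Ω} {K : Finset (Pt d)}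

/-- Smoothness of a representative on each cell is all that the momentum argument needs from a
discrete velocity. -/
theorem exists_contDiff_of_mem_Vh {k : ℕ} {v : Pt d → Vec d} (hv : v ∈ Vh T k)
    (hK : K ∈ T.cells) : ∃ w : Fin d → Pt d → ℝ, (∀ i, ContDiff ℝ ∞ (w i)) ∧
      ∀ᵐ x ∂(volume.restrict (cell K)), ∀ i, v x i = w i x := by
  choose Q _ hQ using fun i => hv i K hK
  exact ⟨fun i => polyFun (Q i), fun i => contDiff_polyFun _, ae_all_iff.2 hQ⟩

theorem grad_ae_eq_of_contDiff {v : Pt d → Vec d} {w : Fin d → Pt d → ℝ}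
    (hw : ∀ i, ContDiff ℝ ∞ (w i)) (h : ∀ᵐ x ∂(volume.restrict (cell K)), ∀ i, v x i = w i x) :
    ∀ᵐ x ∂(volume.restrict (cell K)), ∀ i j, grad (cell K) v x i j = partialD j (w i) x := by
  refine ae_all_iff.2 fun i => ae_all_iff.2 fun j => ?_
  have hi : w i =ᵐ[volume.restrict (cell K)] fun y => v y i := (ae_all_iff.1 h i).mono fun _ h =>
    h.symm
  exact ((hasWeakPartial_of_contDiff j (hw i)).congr hi (EventuallyEq.refl _ _)).weakPartial_ae_eq
    (isOpen_cell K)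

theorem traceV_ae_eq_of_contDiff (hd : 1 ≤ d) (hK : IsSimplex K) {a : Pt d} (ha : a ∈ K)
    {v : Pt d → Vec d} {w : Fin d → Pt d → ℝ} (hw : ∀ i, ContDiff ℝ ∞ (w i))
    (h : ∀ᵐ x ∂(volume.restrict (cell K)), ∀ i, v x i = w i x) :
    ∀ᵐ x ∂(surf (K.erase a)), ∀ i, traceV K (K.erase a) v x i = w i x :=
  ae_all_iff.2 fun i => trace_ae_eq_of_contDiff hK hd ha (hw i) (ae_all_iff.1 h i)

end TestFunctions

/-! ### Consistency -/

section Consistency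

open Scheme

variable {P : Problem d} (S : Scheme P) {t : ℝ} {U : Fields d}

/-! ### Vanishing of the four functionals -/

section Facets

variable (hd : 1 ≤ d) (hu : ∀ i, MemH 2 P.Ω (fun x => U.u t x i)) (hp : MemH 1 P.Ω (U.p t))
  (hubar : ∀ i, S.T.EqTrace (fun x => U.u t x i) (fun x => U.ubar t x i))
  (hpbar : S.T.EqTrace (U.p t) (U.pbar t))

include hd hu hubar in
theorem ubar_ae_eq {K : Finset (Pt d)} (hK : K ∈ S.T.cells) {a : Pt d} (ha : a ∈ K) :
    U.ubar t =ᵐ[surf (K.erase a)] traceV K (K.erase a) (U.u t) := by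
  have h := ae_all_iff.2 fun i => Triangulation.EqTrace.ae_eq hd (hubar i) (hu i).of_succ hK ha
  filter_upwards [h] with x hx
  funext i
  exact hx i

include hd hu hubar in
theorem jump_ae_eq {K : Finset (Pt d)} (hK : K ∈ S.T.cells) {a : Pt d} (ha : a ∈ K) :
    ∀ᵐ x ∂(surf (K.erase a)), jump U t K a x = 0 := by
  filter_upwards [ubar_ae_eq S hd hu hubar hK ha] with x hx
  rw [jump, hx, sub_self]

include hd hp hpbar in
-- The stabilization term carries the pressure jump, which is zero for the exact pressure.
theorem uhatN_ae_eq {K : Finset (Pt d)} (hK : K ∈ S.T.cells) {a : Pt d} (ha : a ∈ K) :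
    ∀ᵐ x ∂(surf (K.erase a)),
      S.uhatN U t K a x = traceV K (K.erase a) (U.u t) x ⬝ᵥ normal K a := by
  filter_upwards [Triangulation.EqTrace.ae_eq hd hpbar hp hK ha] with x hx
  rw [uhatN, uhat, hx, sub_self, mul_zero, zero_smul, sub_zero]

include hd hu hp hubar hpbar in
theorem diffFluxHat_ae_eq {K : Finset (Pt d)} (hK : K ∈ S.T.cells) {a : Pt d} (ha : a ∈ K) :
    ∀ᵐ x ∂(surf (K.erase a)), S.diffFluxHat U t K a x =
      diffFlux P.ν (trace K (K.erase a) (U.p t) x) (traceGrad K (K.erase a) (U.u t) x) := by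
  filter_upwards [Triangulation.EqTrace.ae_eq hd hpbar hp hK ha, jump_ae_eq S hd hu hubar hK ha]
    with x h1 h2
  rw [diffFluxHat, h1, h2, Matrix.zero_vecMulVec, smul_zero, sub_zero]

include hd hp hpbar hu in
-- On each cell the two terms differ by the integral of `q div u`.
theorem Fc_eq_zero (hdiv : ∀ᵐ x ∂(volume.restrict P.Ω), divergence P.Ω (U.u t) x = 0)
    {m : ℕ} {q : Pt d → ℝ} (hq : q ∈ Qh S.T m) : S.Fc U t q = 0 := by
  rw [Fc, Triangulation.cellIntegral, Triangulation.skeletonIntegral, ← Finset.sum_sub_distrib]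
  refine Finset.sum_eq_zero fun K hK => ?_
  obtain ⟨Q, _, hQ⟩ := hq K hK
  have hw := contDiff_polyFun Q
  have hg := HasGreen.row (fun j => (hu j).of_succ.hasGreen hd hK j) hw
  have e0 : ∫ x in cell K, (∑ j, weakPartial P.Ω j (fun y => U.u t y j) x) * polyFun Q x = 0 := by
    refine (integral_congr_ae ?_).trans (integral_zero _ _)
    filter_upwards [S.T.ae_cell_of_ae hdiv hK] with x hx
    rw [divergence] at hx
    rw [hx, zero_mul]
  rw [e0, zero_add] at hg
  rw [sub_eq_zero, cellBdryIntegral]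
  refine Eq.trans ?_ (hg.trans (Finset.sum_congr rfl fun a ha => integral_congr_ae ?_))
  · refine integral_congr_ae ?_
    have h1 := ae_all_iff.2 fun j => ((hasWeakPartial_of_contDiff j hw).congr
      (EventuallyEq.symm hQ) (EventuallyEq.refl _ _)).weakPartial_ae_eq (isOpen_cell K)
    filter_upwards [h1] with x hx
    exact Finset.sum_congr rfl fun j _ => by rw [sgrad, hx j]
  · filter_upwards [uhatN_ae_eq S hd hp hpbar hK ha,
      trace_ae_eq_of_contDiff (S.T.isSimplex hK) hd ha hw hQ] with x h1 h2
    rw [h1, h2]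
    rfl

include hd hu in
theorem traceV_ae_eq_of_isNeighbor {K K' : Finset (Pt d)} {a a' : Pt d}
    (hN : S.T.IsNeighbor K a K' a') :
    traceV K (K.erase a) (U.u t) =ᵐ[surf (K.erase a)] traceV K' (K'.erase a') (U.u t) := by
  have h := ae_all_iff.2 fun i => hN.trace_ae_eq hd (hu i).of_succ
  filter_upwards [h] with x hx
  funext i
  exact hx i

include hd hu hp hubar hpbar in
-- Interior facets cancel and exterior facets match the subtracted boundary term. The integrands are
-- opposite or equal almost everywhere, so no integrability of `qbar` enters.
theorem Fcbar_eq_zero (qbar : Pt d → ℝ) : S.Fcbar U t qbar = 0 := by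
  rw [Fcbar, sub_eq_zero, Triangulation.skeletonIntegral, Triangulation.bdryIntegral]
  simp only [cellBdryIntegral]
  rw [S.T.sum_skeleton_eq_sum_exterior hd]
  · refine Finset.sum_congr rfl fun K hK => Finset.sum_congr rfl fun a ha => ?_
    obtain ⟨ha, hext⟩ := Finset.mem_filter.1 ha
    rw [Measure.restrict_eq_self_of_ae_mem ((ae_surf_mem _).mono fun x hx => hext hx)]
    refine integral_congr_ae ?_
    filter_upwards [uhatN_ae_eq S hd hp hpbar hK ha, ubar_ae_eq S hd hu hubar hK ha] with x h1 h2
    rw [h1, h2]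
  · intro K a K' a' hN
    have h1 := uhatN_ae_eq S hd hp hpbar hN.right hN.mem_right
    have h2 := traceV_ae_eq_of_isNeighbor S hd hu hN
    rw [← hN.erase_eq] at h1 ⊢
    rw [add_eq_zero_iff_eq_neg, ← integral_neg]
    refine integral_congr_ae ?_
    rw [← hN.erase_eq] at h2
    filter_upwards [h1, h2, uhatN_ae_eq S hd hp hpbar hN.left hN.mem_left] with x h1 h2 h3
    rw [h3, h1, h2, hN.normal_eq hd, dotProduct_neg, neg_mul, neg_neg]

theorem conv_bdry_eq (c n w : Vec d) :
    ∑ i, (∑ j, c i * c j * n j) * w i = (c ⬝ᵥ n) * (c ⬝ᵥ w) := by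
  simp only [dotProduct, Finset.mul_sum]
  refine Finset.sum_congr rfl fun i _ => ?_
  simp only [Finset.sum_mul]
  exact Finset.sum_congr rfl fun j _ => by ring

include hd hu hp in
/-- The weak form on a cell of the momentum equation. -/
theorem integral_momentum_cell (hf : MemLp (P.f t) 2 (volume.restrict P.Ω))
    (hmom : ∀ᵐ x ∂(volume.restrict P.Ω),
      timeDerivV P.I P.Ω U.u t x + tensorDiv P.Ω (P.σ (U.u t) (U.p t)) x = P.f t x)
    {K : Finset (Pt d)} (hK : K ∈ S.T.cells) {v : Pt d → Vec d} {w : Fin d → Pt d → ℝ}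
    (hw : ∀ i, ContDiff ℝ ∞ (w i)) (hv : ∀ᵐ x ∂(volume.restrict (cell K)), ∀ i, v x i = w i x) :
    IntegrableOn (fun x => timeDerivV P.I P.Ω U.u t x ⬝ᵥ v x) (cell K) ∧
    IntegrableOn (fun x => P.f t x ⬝ᵥ v x) (cell K) ∧
    (∫ x in cell K, timeDerivV P.I P.Ω U.u t x ⬝ᵥ v x) =
      (∫ x in cell K, P.f t x ⬝ᵥ v x) -
      (∫ x in cell K, ∑ i, (∑ j, diffFluxPartial P.Ω P.ν (U.p t) (U.u t) i j x) * w i x) -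
      ∫ x in cell K, ∑ i, (∑ j, convPartial P.Ω (U.u t) i j x) * w i x := by
  have i1 := HasGreen.integrable_tensor (fun i j => hasGreen_diffFlux hu hp hd hK P.ν i j)
    fun i => (hw i).continuous
  have i2 := HasGreen.integrable_tensor (fun i j => hasGreen_conv hu hd hK i j)
    fun i => (hw i).continuous
  have hfi : ∀ i, IntegrableOn (fun x => P.f t x i) (cell K) := fun i =>
    integrableOn_cell_of_memLp ((memLp_pi_iff.1 hf i).mono_measure
      (Measure.restrict_mono (S.T.cell_subset hK) le_rfl))
  have i3 : IntegrableOn (fun x => P.f t x ⬝ᵥ v x) (cell K) := by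
    have : IntegrableOn (fun x => ∑ i, P.f t x i * w i x) (cell K) :=
      integrable_finsetSum _ fun i _ => integrable_mul_continuous_cell (hfi i) (hw i).continuous
    refine this.congr ?_
    filter_upwards [hv] with x hx
    exact Finset.sum_congr rfl fun i _ => by rw [hx]
  -- The time derivative is only known to be locally integrable. Its integrability against `v` up to
  -- the boundary of the cell is read off from the momentum equation.
  have hae : (fun x => timeDerivV P.I P.Ω U.u t x ⬝ᵥ v x) =ᵐ[volume.restrict (cell K)]
      fun x => P.f t x ⬝ᵥ v x -
        (∑ i, (∑ j, diffFluxPartial P.Ω P.ν (U.p t) (U.u t) i j x) * w i x) -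
        ∑ i, (∑ j, convPartial P.Ω (U.u t) i j x) * w i x := by
    filter_upwards [hv, S.T.ae_cell_of_ae hmom hK,
      S.T.ae_cell_of_ae (tensorDiv_momentumFlux_ae_eq hu hp hd S.T P.ν) hK] with x h1 h2 h3
    simp only [dotProduct]
    rw [← Finset.sum_sub_distrib, ← Finset.sum_sub_distrib]
    refine Finset.sum_congr rfl fun i _ => ?_
    have h4 := congrFun h2 i
    have h5 := h3 i
    simp only [Pi.add_apply] at h4
    rw [h1 i, ← h4]
    change tensorDiv P.Ω (P.σ (U.u t) (U.p t)) x i = _ at h5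
    rw [h5]
    ring
  have i4 : IntegrableOn (fun x => P.f t x ⬝ᵥ v x -
      ∑ i, (∑ j, diffFluxPartial P.Ω P.ν (U.p t) (U.u t) i j x) * w i x) (cell K) := i3.sub i1
  refine ⟨(i4.sub i2).congr hae.symm, i3, ?_⟩
  rw [integral_congr_ae hae, integral_sub i4 i2, integral_sub i3 i1]

include hd hu hp hubar hpbar in
-- On each cell Green's formula for `u ⊗ u` and the constraint `div u = 0` make the conservative and
-- the advective terms equal, so `χ` disappears. Green's formula for the diffusive flux then leaves
-- the momentum equation tested with `v`.
theorem Fm_eq_zero (hf : MemLp (P.f t) 2 (volume.restrict P.Ω))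
    (hmom : ∀ᵐ x ∂(volume.restrict P.Ω),
      timeDerivV P.I P.Ω U.u t x + tensorDiv P.Ω (P.σ (U.u t) (U.p t)) x = P.f t x)
    (hdiv : ∀ᵐ x ∂(volume.restrict P.Ω), divergence P.Ω (U.u t) x = 0) (χ : ℝ)
    {k : ℕ} {v : Pt d → Vec d} (hv : v ∈ Vh S.T k) : S.Fm U t χ v = 0 := by
  have hcell : ∀ K ∈ S.T.cells, ∃ w : Fin d → Pt d → ℝ, (∀ i, ContDiff ℝ ∞ (w i)) ∧
      ∀ᵐ x ∂(volume.restrict (cell K)), ∀ i, v x i = w i x := fun K hK =>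
    exists_contDiff_of_mem_Vh hv hK
  choose! w hw hvw using hcell
  have hmc := fun K hK => integral_momentum_cell S hd hu hp hf hmom hK (hw K hK) (hvw K hK)
  simp only [Fm, Triangulation.cellIntegral, Triangulation.skeletonIntegral]
  rw [S.T.integral_domain_eq fun K hK => (hmc K hK).1,
    S.T.integral_domain_eq fun K hK => (hmc K hK).2.1]
  simp only [Finset.mul_sum, ← Finset.sum_add_distrib, ← Finset.sum_sub_distrib]
  refine Finset.sum_eq_zero fun K hK => ?_
  have hgrad := grad_ae_eq_of_contDiff (hw K hK) (hvw K hK)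
  have htr := fun {a : Pt d} (ha : a ∈ K) =>
    traceV_ae_eq_of_contDiff hd (S.T.isSimplex hK) ha (hw K hK) (hvw K hK)
  have g1 := HasGreen.tensor (fun i j => hasGreen_conv hu hd hK i j) (hw K hK)
  have g2 := HasGreen.tensor (fun i j => hasGreen_diffFlux hu hp hd hK P.ν i j) (hw K hK)
  have e1 := (hmc K hK).2.2
  have e2 : ∫ x in cell K, ddot (Matrix.vecMulVec (U.u t x) (U.u t x)) (grad (cell K) v x) =
      ∫ x in cell K, ∑ i, ∑ j, U.u t x i * U.u t x j * partialD j (w K i) x := by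
    refine integral_congr_ae ?_
    filter_upwards [hgrad] with x hx
    exact Finset.sum_congr rfl fun i _ => Finset.sum_congr rfl fun j _ => by
      rw [hx, Matrix.vecMulVec_apply]
  -- The two forms of convection differ by `(div u) u · v`, which vanishes.
  have e3 : ∫ x in cell K, (grad (cell K) (U.u t) x *ᵥ U.u t x) ⬝ᵥ v x =
      ∫ x in cell K, ∑ i, (∑ j, convPartial P.Ω (U.u t) i j x) * w K i x := by
    refine integral_congr_ae ?_
    filter_upwards [hvw K hK, grad_cell_ae_eq hu hK, S.T.ae_cell_of_ae hdiv hK] with x h1 h2 h3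
    refine Finset.sum_congr rfl fun i _ => ?_
    rw [h1, h2]
    simp only [convPartial]
    rw [Finset.sum_add_distrib, ← Finset.mul_sum]
    rw [divergence] at h3
    rw [h3, mul_zero, add_zero]
    rfl
  have e4 : cellBdryIntegral K (fun a x => S.uhatN U t K a x *
      (traceV K (K.erase a) (U.u t) x ⬝ᵥ traceV K (K.erase a) v x)) =
      ∑ a ∈ K, ∫ x, ∑ i, (∑ j, traceV K (K.erase a) (U.u t) x i * traceV K (K.erase a) (U.u t) x j *
        normal K a j) * w K i x ∂(surf (K.erase a)) := by
    refine Finset.sum_congr rfl fun a ha => integral_congr_ae ?_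
    filter_upwards [htr ha, uhatN_ae_eq S hd hp hpbar hK ha] with x h1 h2
    rw [h2, conv_bdry_eq _ _ fun i => w K i x]
    congr 2
    exact funext h1
  have e5 : cellBdryIntegral K (fun a x => S.lam U t K a x * S.uhatN U t K a x *
      (jump U t K a x ⬝ᵥ traceV K (K.erase a) v x)) = 0 := by
    refine Finset.sum_eq_zero fun a ha => (integral_congr_ae ?_).trans (integral_zero _ _)
    filter_upwards [jump_ae_eq S hd hu hubar hK ha] with x hx
    rw [hx, zero_dotProduct, mul_zero]
  have e6 : ∫ x in cell K, ddot (diffFlux P.ν (U.p t x) (grad (cell K) (U.u t) x))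
      (grad (cell K) v x) = ∫ x in cell K, ∑ i, ∑ j,
        diffFlux P.ν (U.p t x) (grad P.Ω (U.u t) x) i j * partialD j (w K i) x := by
    refine integral_congr_ae ?_
    filter_upwards [hgrad, grad_cell_ae_eq hu hK] with x h1 h2
    rw [h2]
    exact Finset.sum_congr rfl fun i _ => Finset.sum_congr rfl fun j _ => by rw [h1]
  have e7 : cellBdryIntegral K (fun a x => (S.diffFluxHat U t K a x *ᵥ normal K a) ⬝ᵥ
      traceV K (K.erase a) v x) =
      ∑ a ∈ K, ∫ x, ∑ i, (∑ j, diffFlux P.ν (trace K (K.erase a) (U.p t) x)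
        (traceGrad K (K.erase a) (U.u t) x) i j * normal K a j) * w K i x ∂(surf (K.erase a)) := by
    refine Finset.sum_congr rfl fun a ha => integral_congr_ae ?_
    filter_upwards [htr ha, diffFluxHat_ae_eq S hd hu hp hubar hpbar hK ha] with x h1 h2
    rw [h2]
    exact Finset.sum_congr rfl fun i _ => by rw [h1]; rfl
  have e8 : cellBdryIntegral K (fun a x => 2 * P.ν *
      (jump U t K a x ⬝ᵥ (symm (traceGrad K (K.erase a) v x) *ᵥ normal K a))) = 0 := by
    refine Finset.sum_eq_zero fun a ha => (integral_congr_ae ?_).trans (integral_zero _ _)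
    filter_upwards [jump_ae_eq S hd hu hubar hK ha] with x hx
    rw [hx, zero_dotProduct, mul_zero]
  rw [e1, e2, e3, e4, e5, e6, e7, e8, ← g1, ← g2]
  ring

include hd hu hp in
theorem diffFlux_trace_ae_eq_of_isNeighbor {K K' : Finset (Pt d)} {a a' : Pt d}
    (hN : S.T.IsNeighbor K a K' a') :
    ∀ᵐ x ∂(surf (K.erase a)),
      diffFlux P.ν (trace K (K.erase a) (U.p t) x) (traceGrad K (K.erase a) (U.u t) x) =
      diffFlux P.ν (trace K' (K'.erase a') (U.p t) x) (traceGrad K' (K'.erase a') (U.u t) x) := by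
  have h1 := ae_all_iff.2 fun i => ae_all_iff.2 fun j =>
    traceGrad_ae_eq hu hd hN.left hN.mem_left i j
  have h2 := ae_all_iff.2 fun i => ae_all_iff.2 fun j =>
    traceGrad_ae_eq hu hd hN.right hN.mem_right i j
  rw [← hN.erase_eq] at h2
  have h3 := ae_all_iff.2 fun i => ae_all_iff.2 fun j =>
    hN.trace_ae_eq hd (memH_one_grad hu S.T i j)
  filter_upwards [h1, h2, h3, hN.trace_ae_eq hd hp] with x h1 h2 h3 h4
  have hG : traceGrad K (K.erase a) (U.u t) x = traceGrad K' (K'.erase a') (U.u t) x := by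
    ext i j
    rw [h1, h3, ← hN.erase_eq, h2]
  rw [hG, h4]

include hd hu hp hubar hpbar in
/-- The balance of the momentum flux on an exterior facet. -/
theorem momentum_exterior {K : Finset (Pt d)} (hK : K ∈ S.T.cells) {a : Pt d} (ha : a ∈ K)
    (hext : IsExterior P.Ω K a)
    (hN : ∀ᵐ x ∂(surf (K.erase a)), x ∈ P.ΓN →
      momentumFlux P.ν (trace K (K.erase a) (U.p t) x) (traceGrad K (K.erase a) (U.u t) x)
          (traceV K (K.erase a) (U.u t) x) *ᵥ normal K a
        - max (traceV K (K.erase a) (U.u t) x ⬝ᵥ normal K a) 0 • traceV K (K.erase a) (U.u t) x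
      = P.h t x)
    (χ : ℝ) {kbar : ℕ} {vbar : Pt d → Vec d} (hv : vbar ∈ Vbarh S.T P.ΓD kbar) :
    χ * (∫ x, (traceV K (K.erase a) (U.u t) x ⬝ᵥ normal K a) *
        (traceV K (K.erase a) (U.u t) x ⬝ᵥ vbar x) ∂(surf (K.erase a))) +
      ∫ x, (diffFlux P.ν (trace K (K.erase a) (U.p t) x) (traceGrad K (K.erase a) (U.u t) x) *ᵥ
        normal K a) ⬝ᵥ vbar x ∂(surf (K.erase a)) =
    (∫ x in P.ΓN, (χ - S.lam U t K a x) * (U.ubar t x ⬝ᵥ normal K a) * (U.ubar t x ⬝ᵥ vbar x)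
        ∂(surf (K.erase a))) +
      ∫ x in P.ΓN, P.h t x ⬝ᵥ vbar x ∂(surf (K.erase a)) := by
  have hF := S.T.erase_mem_facets hd hK ha
  choose Q _ hQ using fun i => hv.1 i _ hF
  have hQ := ae_all_iff.2 hQ
  have hw := fun i => contDiff_polyFun (Q i)
  set τ := traceV K (K.erase a) (U.u t) with hτ
  set n := normal K a with hn
  set σ : Pt d → Ten d := fun x =>
    diffFlux P.ν (trace K (K.erase a) (U.p t) x) (traceGrad K (K.erase a) (U.u t) x) with hσ
  -- An exterior facet lies in `Γ_D ∪ Γ_N`, so integrals over `Γ_N` of expressions linear in `vbar`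
  -- extend to the whole facet.
  have hvanish : ∀ᵐ x ∂(surf (K.erase a)), x ∉ P.ΓN → vbar x = 0 := by
    filter_upwards [hv.2 _ hF, ae_surf_mem (K.erase a)] with x h1 h2 hx
    have h3 := hext h2
    rw [← P.union_eq] at h3
    exact h1 (h3.resolve_right hx)
  have i1 : Integrable (fun x => (τ x ⬝ᵥ n) * (τ x ⬝ᵥ vbar x)) (surf (K.erase a)) := by
    refine (HasGreen.integrable_bdry_tensor (fun i j => hasGreen_conv hu hd hK i j)
      (fun i => (hw i).continuous) ha).congr ?_
    filter_upwards [hQ] with x hx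
    rw [conv_bdry_eq _ _ fun i => polyFun (Q i) x]
    congr 2
    exact funext fun i => (hx i).symm
  have i2 : Integrable (fun x => (σ x *ᵥ n) ⬝ᵥ vbar x) (surf (K.erase a)) := by
    refine (HasGreen.integrable_bdry_tensor (fun i j => hasGreen_diffFlux hu hp hd hK P.ν i j)
      (fun i => (hw i).continuous) ha).congr ?_
    filter_upwards [hQ] with x hx
    exact Finset.sum_congr rfl fun i _ => by rw [hx]; rfl
  have hτm : ∀ i, MemLp (fun x => τ x i) 2 (surf (K.erase a)) := fun i =>
    memLp_trace (S.T.isSimplex hK) hd ha ((hu i).of_succ.mono (S.T.cell_subset hK))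
  have hτn : AEStronglyMeasurable (fun x => τ x ⬝ᵥ n) (surf (K.erase a)) :=
    Finset.aestronglyMeasurable_fun_sum _ fun i _ => (hτm i).1.mul_const _
  have hτv : AEStronglyMeasurable (fun x => τ x ⬝ᵥ vbar x) (surf (K.erase a)) :=
    Finset.aestronglyMeasurable_fun_sum _ fun i _ => (hτm i).1.mul
      ((hw i).continuous.aestronglyMeasurable.congr (by
        filter_upwards [hQ] with x hx using (hx i).symm))
  -- Dominated by the integrand of `i1`, since `max(y, 0) ≤ |y|`.
  have i3 : Integrable (fun x => max (τ x ⬝ᵥ n) 0 * (τ x ⬝ᵥ vbar x)) (surf (K.erase a)) := by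
    refine i1.mono ((hτn.sup aestronglyMeasurable_const).mul hτv) (Eventually.of_forall fun x => ?_)
    rw [norm_mul, norm_mul]
    gcongr
    rw [Real.norm_eq_abs, Real.norm_eq_abs, abs_of_nonneg (le_max_right _ _)]
    exact max_le (le_abs_self _) (abs_nonneg _)
  have hr : ∀ {f : Pt d → ℝ}, (∀ x, vbar x = 0 → f x = 0) →
      ∫ x in P.ΓN, f x ∂(surf (K.erase a)) = ∫ x, f x ∂(surf (K.erase a)) := fun hf =>
    setIntegral_eq_integral_of_ae_compl_eq_zero (hvanish.mono fun x hx hxN => hf x (hx hxN))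
  rw [hr fun x hx => by rw [hx, dotProduct_zero, mul_zero], hr fun x hx => by rw [hx, dotProduct_zero]]
  -- With `y = u · n`, both signs of `y` give `(χ - λ) y = χ y - y + max(y, 0)`. The terms `y` and
  -- `max(y, 0)` cancel against those in the Neumann condition.
  have e1 : (fun x => (χ - S.lam U t K a x) * (U.ubar t x ⬝ᵥ n) * (U.ubar t x ⬝ᵥ vbar x))
      =ᵐ[surf (K.erase a)] fun x => (χ * ((τ x ⬝ᵥ n) * (τ x ⬝ᵥ vbar x)) -
        (τ x ⬝ᵥ n) * (τ x ⬝ᵥ vbar x)) + max (τ x ⬝ᵥ n) 0 * (τ x ⬝ᵥ vbar x) := by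
    filter_upwards [ubar_ae_eq S hd hu hubar hK ha, uhatN_ae_eq S hd hp hpbar hK ha] with x h1 h2
    rw [h1, lam, h2, ← hτ, ← hn]
    split_ifs with hneg
    · rw [max_eq_right hneg.le]; ring
    · rw [max_eq_left (not_lt.1 hneg)]; ring
  have e2 : (fun x => P.h t x ⬝ᵥ vbar x) =ᵐ[surf (K.erase a)] fun x =>
      ((σ x *ᵥ n) ⬝ᵥ vbar x + (τ x ⬝ᵥ n) * (τ x ⬝ᵥ vbar x)) -
        max (τ x ⬝ᵥ n) 0 * (τ x ⬝ᵥ vbar x) := by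
    filter_upwards [hN, hvanish] with x h1 h2
    by_cases hx : x ∈ P.ΓN
    · rw [← h1 hx, sub_dotProduct, smul_dotProduct, momentumFlux, Matrix.add_mulVec,
        add_dotProduct, Matrix.vecMulVec_mulVec, smul_eq_mul]
      congr 2
      rw [op_smul_eq_smul, smul_dotProduct, smul_eq_mul]
    · rw [h2 hx]
      simp
  have i4 : Integrable (fun x => χ * ((τ x ⬝ᵥ n) * (τ x ⬝ᵥ vbar x)) -
      (τ x ⬝ᵥ n) * (τ x ⬝ᵥ vbar x)) (surf (K.erase a)) := (i1.const_mul χ).sub i1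
  have i5 : Integrable (fun x => (σ x *ᵥ n) ⬝ᵥ vbar x + (τ x ⬝ᵥ n) * (τ x ⬝ᵥ vbar x))
      (surf (K.erase a)) := i2.add i1
  rw [integral_congr_ae e1, integral_congr_ae e2, integral_add i4 i3,
    integral_sub (i1.const_mul χ) i1, integral_sub i5 i3, integral_add i2 i1,
    integral_const_mul]
  ring

include hd hu hp hubar hpbar in
-- Once the jumps are gone, only `χ (u · n) u` and the normal diffusive flux remain, tested with
-- `vbar`. Both change sign between neighbors, and on exterior facets they balance the Neumann terms
-- by `momentum_exterior`.
theorem Fmbar_eq_zero (hsol : P.SolvesAt S.T t U.u U.p) (χ : ℝ) {kbar : ℕ} {vbar : Pt d → Vec d}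
    (hv : vbar ∈ Vbarh S.T P.ΓD kbar) : S.Fmbar U t χ vbar = 0 := by
  have e1 : S.T.skeletonIntegral (fun K a x => S.uhatN U t K a x *
      (traceV K (K.erase a) (U.u t) x ⬝ᵥ vbar x)) = ∑ K ∈ S.T.cells, ∑ a ∈ K,
      ∫ x, (traceV K (K.erase a) (U.u t) x ⬝ᵥ normal K a) *
        (traceV K (K.erase a) (U.u t) x ⬝ᵥ vbar x) ∂(surf (K.erase a)) := by
    refine Finset.sum_congr rfl fun K hK => Finset.sum_congr rfl fun a ha => integral_congr_ae ?_
    filter_upwards [uhatN_ae_eq S hd hp hpbar hK ha] with x hx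
    rw [hx]
  have e2 : S.T.skeletonIntegral (fun K a x => S.uhatN U t K a x *
      (jump U t K a x ⬝ᵥ vbar x)) = 0 := by
    refine Finset.sum_eq_zero fun K hK => Finset.sum_eq_zero fun a ha =>
      (integral_congr_ae ?_).trans (integral_zero _ _)
    filter_upwards [jump_ae_eq S hd hu hubar hK ha] with x hx
    rw [hx, zero_dotProduct, mul_zero]
  have e3 : S.T.skeletonIntegral (fun K a x => S.lam U t K a x * S.uhatN U t K a x *
      (jump U t K a x ⬝ᵥ vbar x)) = 0 := by
    refine Finset.sum_eq_zero fun K hK => Finset.sum_eq_zero fun a ha =>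
      (integral_congr_ae ?_).trans (integral_zero _ _)
    filter_upwards [jump_ae_eq S hd hu hubar hK ha] with x hx
    rw [hx, zero_dotProduct, mul_zero]
  have e4 : S.T.skeletonIntegral (fun K a x => (S.diffFluxHat U t K a x *ᵥ normal K a) ⬝ᵥ vbar x) =
      ∑ K ∈ S.T.cells, ∑ a ∈ K, ∫ x, (diffFlux P.ν (trace K (K.erase a) (U.p t) x)
        (traceGrad K (K.erase a) (U.u t) x) *ᵥ normal K a) ⬝ᵥ vbar x ∂(surf (K.erase a)) := by
    refine Finset.sum_congr rfl fun K hK => Finset.sum_congr rfl fun a ha => integral_congr_ae ?_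
    filter_upwards [diffFluxHat_ae_eq S hd hu hp hubar hpbar hK ha] with x hx
    rw [hx]
  rw [Fmbar, e1, e2, e3, e4, mul_zero, sub_zero, add_zero, Finset.mul_sum, ← Finset.sum_add_distrib]
  simp only [Finset.mul_sum, ← Finset.sum_add_distrib]
  rw [S.T.sum_skeleton_eq_sum_exterior hd]
  · simp only [Triangulation.bdryIntegral, ← Finset.sum_sub_distrib]
    refine Finset.sum_eq_zero fun K hK => Finset.sum_eq_zero fun a ha => ?_
    obtain ⟨ha, hext⟩ := Finset.mem_filter.1 ha
    rw [momentum_exterior S hd hu hp hubar hpbar hK ha hext (hsol.neumann K hK a ha hext) χ hv]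
    ring
  · intro K a K' a' hN
    have h1 := traceV_ae_eq_of_isNeighbor S hd hu hN
    have h2 := diffFlux_trace_ae_eq_of_isNeighbor S hd hu hp hN
    rw [← hN.erase_eq] at h1 h2 ⊢
    rw [hN.normal_eq hd]
    simp only [dotProduct_neg, Matrix.mulVec_neg, neg_dotProduct, neg_mul, integral_neg, mul_neg]
    rw [← neg_add, ← sub_eq_add_neg, sub_eq_zero]
    congr 1
    · congr 1
      refine integral_congr_ae ?_
      filter_upwards [h1] with x hx
      rw [hx]
    · refine integral_congr_ae ?_
      filter_upwards [h2] with x hx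
      rw [hx]

end Facets

end Consistency

end HybridNS

end

theorem mainTheorem4 (d : ℕ) (hd1 : 1 ≤ d) (hd3 : d ≤ 3)
    (P : Problem d) (S : Scheme P) (t : ℝ) (ht : t ∈ P.I)
    (hf : MemLp (P.f t) 2 (volume.restrict P.Ω))
    (hh : MemLp (P.h t) 2 ((Measure.euclideanHausdorffMeasure (d - 1)).restrict P.ΓN))
    (U : Fields d)
    (hu : ∀ i, MemH 2 P.Ω (fun x => U.u t x i))
    (hp : MemH 1 P.Ω (U.p t))
    (hsol : P.SolvesAt S.T t U.u U.p)
    (hubar : ∀ i, S.T.EqTrace (fun x => U.u t x i) (fun x => U.ubar t x i))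
    (hpbar : S.T.EqTrace (U.p t) (U.pbar t))
    (k kbar m mbar : ℕ) (hk : 0 < k)
    (χ : ℝ) (hχ : χ ∈ Set.Icc (0 : ℝ) 1)
    (W : TestFields d) (hW : S.IsDiscrete k kbar m mbar W) :
    S.F U t χ W = 0 := by
  rw [Scheme.F, Fm_eq_zero S hd1 hu hp hubar hpbar hf hsol.momentum hsol.incompressible χ hW.1,
    Fmbar_eq_zero S hd1 hu hp hubar hpbar hsol χ hW.2.1,
    Fc_eq_zero S hd1 hu hp hpbar hsol.incompressible hW.2.2.1,
    Fcbar_eq_zero S hd1 hu hp hubar hpbar W.qbar]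
  norm_num
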